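/- Let $(\mathcal M,g)$ be a connected, Hausdorff, time-oriented four-dimensional spacetime with smooth manifold structure and metric of signature $(-,+,+,+)$ and class $C^{1,1}$. Suppose that it is asymptotically flat at future null infinity in the following sense: there is a chart with Bondi coordinates $(u,r,x^I)$, $x\in S^2$, with $\partial_u$ future-directed near infinity, which covers, for every $u_0\in\mathbb R$, all $(u,r,x)$ with $u\ge u_0$ and $r$ sufficiently large, and in which near future null infinity $g_{rr}=g_{rI}=0$, $\sqrt{\det (g_{IJ}/r^2)}=\omega_2$ (the volume element of the unit sphere), and $$g_{uu}=-1+m r^{-1}+O(r^{-2}),\quad g_{ur}=-1+O(r^{-2}),\quad g_{IJ}=\omega_{IJ}r^2+h^{(1)}_{IJ}r+O(1),\quad g_{uI}=O(1).$$ Here $\omega_{IJ}$ is the metric of the unit sphere, and $m$, $h^{(1)}_{IJ}$ are functions of $(u,x)$. The notation $f=O(r^{n})$ means that $f$ is $C^1$ and, for every $u_0$, the functions $f,\partial_uf,\partial_If$ are bounded by a constant times $r^{n}$ and $\partial_rf$ by a constant times $r^{n-1}$, uniformly for $u\ge u_0$, $x\in S^2$ and $r$ sufficiently large; $m$ and $h^{(1)}_{IJ}$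 are themselves $O(1)$ in this sense. Let $$\Omega_{IJ}=\omega_{IJ}-\tfrac12\partial_uh^{(1)}_{IJ}+\tfrac12(\partial_um)\,\omega_{IJ},\qquad \Omega_i=\inf_{u,\,x,\,v\neq0}\frac{\Omega_{IJ}(u,x)v^Iv^J}{\omega_{IJ}v^Iv^J},$$ and assume $\Omega_i>0$. A curve reaches future null infinity if along it eventually $r\to\infty$ while $u$ tends to a finite limit. Assume that there is a black hole, i.e. the set of points from which no future-directed causal curve reaches future null infinity is nonempty. Let $T^\mu$ be a vector field on $\mathcal M$ with $T_\mu T^\mu=-1$ which near future null infinity is proportional to $\nabla^\mu(u+r)$. The outer dark domain $S$ associated with $T^\mu$ is the set of all $p\in\mathcal M$ such that for every spacelike vector $n^\mu$ at $p$ orthogonal to $T^\mu$ there is a maximally extended future-directed null geodesic emanating from $p$, with tangent vector $k^\mu$ at $p$ orthogonal to $n^\mu$, that does not reach future null infinity. The outer dark horizon associated with $T^\mu$ is the boundary $\partial S$ of $S$ in $\mathcal M$. Then the outer dark horizon associated with $T^\mu$ is nonempty, and it is not connected to future null infinity: for every $u_0$ there is an $R$ such that it contains no point of the Bondi chart with $u\ge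 u_0$ and $r>R$. -/

import Mathlib

open Set Filter Topology Manifold ContDiff

noncomputable section

/-- The model space of four-dimensional spacetimes. -/
abbrev E4 : Type := EuclideanSpace ℝ (Fin 4)

/-- Three-dimensional Euclidean space; its unit sphere is the sphere of angular coordinates. -/
abbrev E3 : Type := EuclideanSpace ℝ (Fin 3)

/-- A real function of class `C^{1,1}` on a set: continuously differentiable with locally
Lipschitz derivative. -/
def IsC11On (f : E4 → ℝ) (s : Set E4) : Prop :=
  ContDiffOn ℝ 1 f s ∧ LocallyLipschitzOn s (fderiv ℝ f)

/-- The components `g_x(v, w)` of a field of bilinear forms in the chart `e`, at the coordinate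
point `x`, on the coordinate vectors `v`, `w`. -/
def metricInChart {M : Type*} [TopologicalSpace M] [ChartedSpace E4 M]
    (g : (p : M) → TangentSpace (𝓡 4) p →L[ℝ] TangentSpace (𝓡 4) p →L[ℝ] ℝ)
    (e : OpenPartialHomeomorph M E4) (x v w : E4) : ℝ :=
  g (e.symm x) (mfderiv (𝓡 4) (𝓡 4) e.symm x v) (mfderiv (𝓡 4) (𝓡 4) e.symm x w)

/-- A time-oriented Lorentzian metric of class `C^{1,1}` and signature `(-,+,+,+)` on a smooth
four-manifold. The time orientation is given by a continuous timelike vector field. -/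
structure Spacetime (M : Type*) [TopologicalSpace M] [ChartedSpace E4 M]
    [IsManifold (𝓡 4) ∞ M] where
  g : (p : M) → TangentSpace (𝓡 4) p →L[ℝ] TangentSpace (𝓡 4) p →L[ℝ] ℝ
  symm : ∀ (p : M) (v w : TangentSpace (𝓡 4) p), g p v w = g p w v
  lorentzian : ∀ p : M, ∃ v : TangentSpace (𝓡 4) p, g p v v < 0 ∧
    ∀ w : TangentSpace (𝓡 4) p, g p v w = 0 → w ≠ 0 → 0 < g p w w
  regular : ∀ e ∈ IsManifold.maximalAtlas (𝓡 4) ∞ M, ∀ v w : E4,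
    IsC11On (fun x => metricInChart g e x v w) e.target
  timeField : (p : M) → TangentSpace (𝓡 4) p
  timeField_continuous : Continuous fun p => (⟨p, timeField p⟩ : TangentBundle (𝓡 4) M)
  timeField_timelike : ∀ p : M, g p (timeField p) (timeField p) < 0

/-- The interval `[0, b)`, with `b` possibly infinite. -/
def parameterInterval (b : EReal) : Set ℝ := {t : ℝ | 0 ≤ t ∧ (t : EReal) < b}

/-- The velocity at parameter `t` of a curve defined on `[0, b)`. -/
def velocity {M : Type*} [TopologicalSpace M] [ChartedSpace E4 M]
    (γ : ℝ → M) (b : EReal) (t : ℝ) : TangentSpace (𝓡 4) (γ t) :=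
  mfderivWithin 𝓘(ℝ, ℝ) (𝓡 4) γ (parameterInterval b) t (1 : ℝ)

/-- The point with retarded time `u` and Cartesian-like position `X` (so `r = |X|`, and the
angular position is `X / |X|`). -/
def bondiPoint (u : ℝ) (X : E3) : E4 := !₂[u, X 0, X 1, X 2]

/-- The spatial part `X` of a point `(u, X)`. -/
def spatialPart (z : E4) : E3 := !₂[z 1, z 2, z 3]

/-- A property of the Bondi coordinates `(u, r, x)`, `x` a unit vector, holds near future null
infinity: on every half-line `u ≥ u₀` it holds for all sufficiently large `r`. -/
def NearScri (P : ℝ → ℝ → E3 → Prop) : Prop :=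
  ∀ u₀ : ℝ, ∃ R : ℝ, 0 < R ∧ ∀ u r : ℝ, u₀ ≤ u → R < r → ∀ x : E3, ‖x‖ = 1 → P u r x

/-- A function of `(u, r, x)`, `x` on the unit sphere, regarded as a function on an open subset
of a vector space by extending it to be homogeneous of degree zero in `x`. -/
def radialExtension (F : ℝ → ℝ → E3 → ℝ) (z : ℝ × ℝ × E3) : ℝ :=
  F z.1 z.2.1 (‖z.2.2‖⁻¹ • z.2.2)

/-- `F = O(r^n)` near future null infinity, as an expansion in powers of `r` that may be
differentiated once: `F` is `C¹`, the function, its `u`-derivative and its angular derivatives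
are `O(r^n)`, and its `r`-derivative is `O(r^(n-1))`, uniformly on `u ≥ u₀` for every `u₀`. -/
def IsBondiO (n : ℤ) (F : ℝ → ℝ → E3 → ℝ) : Prop :=
  ∀ u₀ : ℝ, ∃ C R : ℝ, 0 < R ∧ ∀ u r : ℝ, u₀ ≤ u → R < r → ∀ x : E3, ‖x‖ = 1 →
    ContDiffAt ℝ 1 (radialExtension F) (u, r, x) ∧
    |F u r x| ≤ C * r ^ n ∧
    |fderiv ℝ (radialExtension F) (u, r, x) (1, 0, 0)| ≤ C * r ^ n ∧
    |fderiv ℝ (radialExtension F) (u, r, x) (0, 1, 0)| ≤ C * r ^ (n - 1) ∧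
    ∀ v : E3, |fderiv ℝ (radialExtension F) (u, r, x) (0, 0, v)| ≤ C * r ^ n * ‖v‖

/-- The orthogonal projection of `a` to the tangent plane of the unit sphere at `x`. For fixed
`a` this is a smooth vector field on the sphere, and these fields span every tangent plane:
bounds on the contractions of a tensor with them are bounds on its angular components. -/
def tangentialPart (x a : E3) : E3 := a - inner ℝ x a • x

namespace Spacetime

variable {M : Type*} [TopologicalSpace M] [ChartedSpace E4 M] [IsManifold (𝓡 4) ∞ M]

/-- Nonzero tangent vectors that are timelike or null and point to the future. -/
def FutureCausal (S : Spacetime M) (p : M) (v : TangentSpace (𝓡 4) p) : Prop :=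
  v ≠ 0 ∧ S.g p v v ≤ 0 ∧ S.g p (S.timeField p) v < 0

/-- The affinely parametrized geodesic equation on `[0, b)` for a `C²` curve. In every chart of
the smooth atlas it is the usual second-order equation with the Christoffel symbols of the
metric, written with the free index lowered:
`g_{λμ} c''^μ + ∂_α g_{λμ} c'^α c'^μ - (1/2) ∂_λ g_{αμ} c'^α c'^μ = 0`. -/
def IsGeodesicOn (S : Spacetime M) (γ : ℝ → M) (b : EReal) : Prop :=
  ContMDiffOn 𝓘(ℝ, ℝ) (𝓡 4) 2 γ (parameterInterval b) ∧
  ∀ t ∈ parameterInterval b, ∀ e ∈ IsManifold.maximalAtlas (𝓡 4) ∞ M, γ t ∈ e.source →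
    let J := parameterInterval b
    let c : ℝ → E4 := fun s => e (γ s)
    let c' : E4 := derivWithin c J t
    let c'' : E4 := derivWithin (derivWithin c J) J t
    ∀ w : E4,
      metricInChart S.g e (c t) c'' w
        + fderiv ℝ (fun y => metricInChart S.g e y c' w) (c t) c'
        - (1 / 2) * fderiv ℝ (fun y => metricInChart S.g e y c' c') (c t) w = 0

/-- A future-directed null geodesic on `[0, b)`, `0 < b ≤ ∞`. -/
def IsNullGeodesicOn (S : Spacetime M) (γ : ℝ → M) (b : EReal) : Prop :=
  0 < b ∧ S.IsGeodesicOn γ b ∧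
  ∀ t ∈ parameterInterval b, S.FutureCausal (γ t) (velocity γ b t) ∧
    S.g (γ t) (velocity γ b t) (velocity γ b t) = 0

/-- A future-directed null geodesic on `[0, b)` that is not the beginning of a longer one. -/
def IsMaximalNullGeodesicOn (S : Spacetime M) (γ : ℝ → M) (b : EReal) : Prop :=
  S.IsNullGeodesicOn γ b ∧
  ¬ ∃ (γ' : ℝ → M) (b' : EReal), b < b' ∧ S.IsNullGeodesicOn γ' b' ∧
    EqOn γ' γ (parameterInterval b)

/-- A future-directed causal curve of class `C¹` on `[0, b)`, `0 < b ≤ ∞`. -/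
def IsCausalCurveOn (S : Spacetime M) (γ : ℝ → M) (b : EReal) : Prop :=
  0 < b ∧ ContMDiffOn 𝓘(ℝ, ℝ) (𝓡 4) 1 γ (parameterInterval b) ∧
  ∀ t ∈ parameterInterval b, S.FutureCausal (γ t) (velocity γ b t)

/-- The metric components in a chart with coordinates `(u, X)`, in terms of the Bondi coordinates
`u`, `r = |X|`, `x = X / |X|`. The coordinate vectors at `(u, r x)` are `∂_u = (1, 0)`,
`∂_r = (0, x)`, and `(0, r v)` for the angular direction `v` tangent to the sphere at `x`. -/
def guu (S : Spacetime M) (e : OpenPartialHomeomorph M E4) (u r : ℝ) (x : E3) : ℝ :=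
  metricInChart S.g e (bondiPoint u (r • x)) (bondiPoint 1 0) (bondiPoint 1 0)

def gur (S : Spacetime M) (e : OpenPartialHomeomorph M E4) (u r : ℝ) (x : E3) : ℝ :=
  metricInChart S.g e (bondiPoint u (r • x)) (bondiPoint 1 0) (bondiPoint 0 x)

def grr (S : Spacetime M) (e : OpenPartialHomeomorph M E4) (u r : ℝ) (x : E3) : ℝ :=
  metricInChart S.g e (bondiPoint u (r • x)) (bondiPoint 0 x) (bondiPoint 0 x)

def guA (S : Spacetime M) (e : OpenPartialHomeomorph M E4) (u r : ℝ) (x v : E3) : ℝ :=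
  metricInChart S.g e (bondiPoint u (r • x)) (bondiPoint 1 0) (bondiPoint 0 (r • v))

def grA (S : Spacetime M) (e : OpenPartialHomeomorph M E4) (u r : ℝ) (x v : E3) : ℝ :=
  metricInChart S.g e (bondiPoint u (r • x)) (bondiPoint 0 x) (bondiPoint 0 (r • v))

def gAB (S : Spacetime M) (e : OpenPartialHomeomorph M E4) (u r : ℝ) (x v w : E3) : ℝ :=
  metricInChart S.g e (bondiPoint u (r • x)) (bondiPoint 0 (r • v)) (bondiPoint 0 (r • w))

/-- Bondi coordinates near future null infinity `{r = ∞} ≅ ℝ × S²` of a four-dimensional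
asymptotically flat spacetime: a chart whose image contains, for every `u₀`, all `(u, r, x)` with
`u ≥ u₀` and `r` sufficiently large, and in which the metric has the Bondi form and fall-off.
`m` and `h1` are the coefficients of the expansions
`g_uu = -1 + m/r + O(r⁻²)` and `g_IJ = r² ω_IJ + r h1_IJ + O(1)`. -/
structure BondiChart (S : Spacetime M) where
  chart : OpenPartialHomeomorph M E4
  chart_mem : chart ∈ IsManifold.maximalAtlas (𝓡 4) ∞ M
  domain : NearScri fun u r x => bondiPoint u (r • x) ∈ chart.target
  m : ℝ → E3 → ℝ
  h1 : ℝ → E3 → E3 →L[ℝ] E3 →L[ℝ] ℝ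
  future : NearScri fun u r x => S.FutureCausal (chart.symm (bondiPoint u (r • x)))
    (mfderiv (𝓡 4) (𝓡 4) chart.symm (bondiPoint u (r • x)) (bondiPoint 1 0))
  m_regular : IsBondiO 0 fun u _ x => m u x
  h1_regular : ∀ a b : E3,
    IsBondiO 0 fun u _ x => h1 u x (tangentialPart x a) (tangentialPart x b)
  guu_expansion : IsBondiO (-2) fun u r x => S.guu chart u r x - (-1 + m u x * r⁻¹)
  gur_expansion : IsBondiO (-2) fun u r x => S.gur chart u r x - (-1)
  gAB_expansion : ∀ a b : E3, IsBondiO 0 fun u r x =>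
    S.gAB chart u r x (tangentialPart x a) (tangentialPart x b)
      - (inner ℝ (tangentialPart x a) (tangentialPart x b) * r ^ 2
        + h1 u x (tangentialPart x a) (tangentialPart x b) * r)
  guA_expansion : ∀ a : E3, IsBondiO 0 fun u r x => S.guA chart u r x (tangentialPart x a)
  grr_zero : NearScri fun u r x => S.grr chart u r x = 0
  grA_zero : NearScri fun u r x => ∀ v : E3, inner ℝ x v = 0 → S.grA chart u r x v = 0
  /-- The gauge condition `√(det h_IJ) = ω₂` for `h_IJ = g_IJ / r²`, evaluated in an orthonormal
  basis `v`, `w` of the tangent plane of the unit sphere. -/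
  gauge : NearScri fun u r x => ∀ v w : E3, inner ℝ x v = 0 → inner ℝ x w = 0 →
    ‖v‖ = 1 → ‖w‖ = 1 → inner ℝ v w = 0 →
      S.gAB chart u r x v v / r ^ 2 * (S.gAB chart u r x w w / r ^ 2)
        - (S.gAB chart u r x v w / r ^ 2) ^ 2 = 1

namespace BondiChart

variable {S : Spacetime M}

/-- The retarded time, on the domain of the chart. -/
def u (B : S.BondiChart) (p : M) : ℝ := B.chart p 0

/-- The areal radius, on the domain of the chart. -/
def r (B : S.BondiChart) (p : M) : ℝ := ‖spatialPart (B.chart p)‖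

/-- `Ω(u, x; v) = (ω_IJ v^I v^J)⁻¹ Ω_IJ v^I v^J` for a nonzero vector `v` tangent to the sphere
at `x`, where `Ω_IJ = ω_IJ - (1/2) ∂_u h1_IJ + (1/2) (∂_u m) ω_IJ`. -/
def Omega (B : S.BondiChart) (u : ℝ) (x v : E3) : ℝ :=
  (‖v‖ ^ 2)⁻¹ * (‖v‖ ^ 2 - (1 / 2) * deriv (fun s => B.h1 s x v v) u
    + (1 / 2) * deriv (fun s => B.m s x) u * ‖v‖ ^ 2)

/-- `Ω_i`, the infimum of `Ω(u, x; v)` over all `u`, `x` and nonzero tangent directions `v`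
(it may be `-∞`). -/
def OmegaInf (B : S.BondiChart) : EReal :=
  sInf {y : EReal | ∃ (u : ℝ) (x v : E3), ‖x‖ = 1 ∧ inner ℝ x v = 0 ∧ v ≠ 0 ∧
    y = (B.Omega u x v : EReal)}

/-- The curve `γ` on `[0, b)` reaches future null infinity: towards its end it is in the Bondi
domain, `r → ∞`, and `u` has a finite limit. -/
def Reaches (B : S.BondiChart) (γ : ℝ → M) (b : EReal) : Prop :=
  (∀ᶠ t : parameterInterval b in atTop, γ t ∈ B.chart.source) ∧
  Tendsto (fun t : parameterInterval b => B.r (γ t)) atTop atTop ∧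
  ∃ u₁ : ℝ, Tendsto (fun t : parameterInterval b => B.u (γ t)) atTop (𝓝 u₁)

/-- The causal past of future null infinity. -/
def pastOfScri (B : S.BondiChart) : Set M :=
  {p | ∃ (γ : ℝ → M) (b : EReal), S.IsCausalCurveOn γ b ∧ γ 0 = p ∧ B.Reaches γ b}

/-- The black hole region. -/
def blackHole (B : S.BondiChart) : Set M := (B.pastOfScri)ᶜ

/-- The outer dark domain associated with `T`: the points `p` such that for every spacelike `n`
at `p` orthogonal to `T` there is a (maximally extended, future-directed) null geodesic emanating
from `p`, with initial tangent vector `k` orthogonal to `n`, that does not reach future null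
infinity. -/
def outerDarkDomain (B : S.BondiChart) (T : (p : M) → TangentSpace (𝓡 4) p) : Set M :=
  {p | ∀ n : TangentSpace (𝓡 4) p, 0 < S.g p n n → S.g p n (T p) = 0 →
    ∃ (k : TangentSpace (𝓡 4) p) (γ : ℝ → M) (b : EReal),
      S.IsMaximalNullGeodesicOn γ b ∧
      (⟨γ 0, velocity γ b 0⟩ : TangentBundle (𝓡 4) M) = ⟨p, k⟩ ∧
      S.g p k n = 0 ∧ ¬ B.Reaches γ b}

/-- The outer dark horizon associated with `T`. -/
def outerDarkHorizon (B : S.BondiChart) (T : (p : M) → TangentSpace (𝓡 4) p) : Set M :=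
  frontier (B.outerDarkDomain T)

/-- `T^μ ∝ d(u + r)^μ` near future null infinity: there the one-form `g(T, ·)` is a multiple
of `d(u + r)`. -/
def ProportionalToGradient (B : S.BondiChart) (T : (p : M) → TangentSpace (𝓡 4) p) : Prop :=
  NearScri fun u r x =>
    let p : M := B.chart.symm (bondiPoint u (r • x))
    ∃ c : ℝ, ∀ v : TangentSpace (𝓡 4) p,
      let dv : ℝ := mfderiv (𝓡 4) 𝓘(ℝ, ℝ) (fun q => B.u q + B.r q) p v
      S.g p (T p) v = c * dv

/-- A set of spacetime points is not connected to future null infinity: it keeps away from it,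
i.e. for every `u₀` it contains no points with `u ≥ u₀` and `r` sufficiently large. In particular
no point of future null infinity is in its closure. -/
def NotConnectedToScri (B : S.BondiChart) (A : Set M) : Prop :=
  ∀ u₀ : ℝ, ∃ R : ℝ, ∀ p ∈ B.chart.source, u₀ ≤ B.u p → R < B.r p → p ∉ A

end BondiChart

end Spacetime

end

/-! In a connected space the frontier of a nonempty proper subset is nonempty. So two facts suffice:
the dark domain contains the black hole, and it misses every region `u ≥ u₀` with `r` large.

The first fact (`blackHole_subset_outerDarkDomain`) is linear algebra and ODE theory. In dimension
four some `w ≠ 0` is orthogonal to both `T` and `n`; `T` plus the normalised `w` is null and, up to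
sign, future-directed, and it is orthogonal to `n`. A `C^{1,1}` metric gives a locally Lipschitz
geodesic field, so a null geodesic with this tangent exists, and by Zorn it has a maximal extension.
From a black hole point it cannot reach future null infinity, being a causal curve.

For the second fact (`exists_region_disjoint`) the defining condition is tested on the single vector
`n = ∂_u - ∂_r`, which is spacelike near infinity and orthogonal to `T` because `T` is proportional
to the gradient of `u + r`. A null vector orthogonal to it has almost no radial component, so it
remains to show that nearly tangential light rays reach infinity (`reaches_of_orthogonal`).

Let `y`, `ρ` be the `u`- and `r`-components of the velocity, `ℓ` the length of its angular part, `p`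
and `Q` its products with `-∂_r` and `-∂_u`, and `j` its angular momentum. Up to relative errors of
order `1/r`, `2yρ = ℓ² - y²`, `p = y`, `Q = y + ρ`, `j = rℓ`. In flat space `j` and `Q` are constant
and `(rp)' = -(y² + ℓ²)/2`. Hence `K = j²/(rp)²`, which is at least `99/100` initially, increases,
while `r/K` decreases at a rate of at least `y/6`; both survive the errors (`ratio_rates`).
Integration bounds the total increase of `u` by `12 r(0)`, however long the ray lives. Consequently
`r` stays above `3/4 r(0)`, `Q` changes by a bounded factor only, and `p` decays at most
exponentially.

These conclusions are stronger than the assumptions used to derive them, so a continuity argument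
keeps the ray in the good region (`outgoingState_of_initial`). On a finite parameter interval
position and velocity stay in a compact set, which contradicts maximality
(`not_isMaximal_of_outgoing`). On an infinite one `u` is monotone and bounded, `u + r` grows
linearly, and so `r → ∞` (`reaches_of_outgoing`). -/

set_option maxSynthPendingDepth 3
set_option linter.unusedSectionVars false

/-! ### The metric in a chart and Lorentzian linear algebra. -/

namespace Spacetime

variable {M : Type*} [TopologicalSpace M] [ChartedSpace E4 M] [IsManifold (𝓡 4) ∞ M]

/-- The metric in the chart `e`, as a field of bilinear forms on the coordinate space. -/
noncomputable def chartMetric (S : Spacetime M) (e : OpenPartialHomeomorph M E4) (z : E4) :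
    E4 →L[ℝ] E4 →L[ℝ] ℝ :=
  LinearMap.toContinuousLinearMap (LinearMap.toContinuousLinearMap.toLinearMap ∘ₗ
    LinearMap.mk₂ ℝ (fun v w : E4 => metricInChart S.g e z v w)
      (fun v v' w => by
        have h := (mfderiv (𝓡 4) (𝓡 4) e.symm z).map_add v v'
        exact (congrArg (fun q => S.g _ q (mfderiv (𝓡 4) (𝓡 4) e.symm z w)) h).trans
          (by rw [map_add]; rfl))
      (fun a v w => by
        have h := (mfderiv (𝓡 4) (𝓡 4) e.symm z).map_smul a v
        exact (congrArg (fun q => S.g _ q (mfderiv (𝓡 4) (𝓡 4) e.symm z w)) h).trans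
          (by rw [map_smul]; rfl))
      (fun v w w' => by
        have h := (mfderiv (𝓡 4) (𝓡 4) e.symm z).map_add w w'
        exact (congrArg (fun q => S.g _ (mfderiv (𝓡 4) (𝓡 4) e.symm z v) q) h).trans
          (by rw [map_add]; rfl))
      (fun a v w => by
        have h := (mfderiv (𝓡 4) (𝓡 4) e.symm z).map_smul a w
        exact (congrArg (fun q => S.g _ (mfderiv (𝓡 4) (𝓡 4) e.symm z v) q) h).trans
          (by rw [map_smul]; rfl)))

theorem chartMetric_apply (S : Spacetime M) (e : OpenPartialHomeomorph M E4) (z v w : E4) :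
    S.chartMetric e z v w = metricInChart S.g e z v w := rfl

theorem chartMetric_symm (S : Spacetime M) (e : OpenPartialHomeomorph M E4) (z v w : E4) :
    S.chartMetric e z v w = S.chartMetric e z w v := S.symm _ _ _

variable {S : Spacetime M} {e : OpenPartialHomeomorph M E4}

theorem contDiffOn_chartMetric (he : e ∈ IsManifold.maximalAtlas (𝓡 4) ∞ M) :
    ContDiffOn ℝ 1 (S.chartMetric e) e.target := by
  rw [contDiffOn_clm_apply]
  intro v
  rw [contDiffOn_clm_apply]
  intro w
  exact (S.regular e he v w).1

theorem differentiableAt_chartMetric (he : e ∈ IsManifold.maximalAtlas (𝓡 4) ∞ M) {z : E4}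
    (hz : z ∈ e.target) : DifferentiableAt ℝ (S.chartMetric e) z :=
  ((contDiffOn_chartMetric he).contDiffAt (e.open_target.mem_nhds hz)).differentiableAt
    one_ne_zero

/-! ### Linear algebra of Lorentzian forms -/

/-- The axiom provides one timelike `V` with positive definite complement. If `w` were not
spacelike, the form would be negative semidefinite on the span of `v` and `w`, yet a combination of
the two lies in the complement of `V`. -/
theorem pos_of_orthogonal_timelike (S : Spacetime M) {p : M} {v w : TangentSpace (𝓡 4) p}
    (hv : S.g p v v < 0) (hw : w ≠ 0) (hvw : S.g p v w = 0) : 0 < S.g p w w := by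
  obtain ⟨V, hV, hpos⟩ := S.lorentzian p
  by_contra hcon
  push Not at hcon
  have hwv : S.g p w v = 0 := by rw [S.symm, hvw]
  set a := S.g p V w with ha
  set b := S.g p V v with hb
  have hzV : S.g p V (a • v - b • w) = 0 := by
    rw [map_sub, map_smul, map_smul, smul_eq_mul, smul_eq_mul, ← ha, ← hb]; ring
  have hzz : S.g p (a • v - b • w) (a • v - b • w) = a ^ 2 * S.g p v v + b ^ 2 * S.g p w w := by
    simp only [map_sub, map_smul, sub_apply, smul_apply,
      smul_eq_mul, hvw, hwv]
    ring
  by_cases hz : a • v - b • w = 0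
  · have hb0 : b = 0 := by
      by_contra hb0
      have hw' : w = (b⁻¹ * a) • v := by
        rw [sub_eq_zero] at hz
        rw [mul_smul, hz, smul_smul, inv_mul_cancel₀ hb0, one_smul]
      rw [hw', map_smul, smul_eq_mul] at hvw
      rcases mul_eq_zero.1 hvw with h | h
      · exact hw (by rw [hw', h, zero_smul])
      · exact hv.ne h
    have hv0 : v ≠ 0 := by
      rintro rfl
      simp at hv
    have := hpos v (hb ▸ hb0) hv0
    linarith
  · have := hpos _ hzV hz
    rw [hzz] at this
    nlinarith [sq_nonneg a, sq_nonneg b]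

theorem ne_zero_of_timelike_causal (S : Spacetime M) {p : M} {v w : TangentSpace (𝓡 4) p}
    (hv : S.g p v v < 0) (hw : w ≠ 0) (hww : S.g p w w ≤ 0) : S.g p v w ≠ 0 :=
  fun h => (S.pos_of_orthogonal_timelike hv hw h).not_ge hww

/-- If `g(v, w) ≥ 0`, then `-g(τ, w) v + g(v, w) τ` is a timelike vector orthogonal to the causal
vector `w`, where `τ` is the time orientation. This is impossible. -/
theorem FutureCausal.neg_of_timelike {p : M} {v w : TangentSpace (𝓡 4) p}
    (hv : S.FutureCausal p v) (hvv : S.g p v v < 0) (hw : S.FutureCausal p w) :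
    S.g p v w < 0 := by
  by_contra hcon
  push Not at hcon
  set τ := S.timeField p
  have hτ : S.g p τ τ < 0 := S.timeField_timelike p
  have hτv : S.g p τ v < 0 := hv.2.2
  have hτw : S.g p τ w < 0 := hw.2.2
  set a := S.g p v w
  set b := S.g p τ w with hb
  have hne : a - b ≠ 0 := by linarith
  refine S.ne_zero_of_timelike_causal (v := (-b) • v + a • τ) (w := w) ?_ hw.1 hw.2.1 ?_
  · have : S.g p ((-b) • v + a • τ) ((-b) • v + a • τ)
        = b ^ 2 * S.g p v v + 2 * (-b * a) * S.g p τ v + a ^ 2 * S.g p τ τ := by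
      simp only [map_add, map_smul, add_apply, smul_apply,
        smul_eq_mul, S.symm p v τ]
      ring
    rw [this]
    have h1 : b ^ 2 * S.g p v v < 0 := mul_neg_of_pos_of_neg (by nlinarith) hvv
    have h2 : 2 * (-b * a) * S.g p τ v ≤ 0 :=
      mul_nonpos_of_nonneg_of_nonpos (by nlinarith) hτv.le
    nlinarith [sq_nonneg a]
  · simp only [map_add, map_smul, add_apply, smul_apply,
        smul_eq_mul]
    change -b * a + a * b = 0
    ring

/-- A null future-directed vector orthogonal to a spacelike vector that is orthogonal to a unit
timelike one. -/
theorem exists_futureNull_orthogonal (S : Spacetime M) {p : M} {T n : TangentSpace (𝓡 4) p}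
    (hT : S.g p T T = -1) :
    ∃ k : TangentSpace (𝓡 4) p, S.g p k k = 0 ∧ S.FutureCausal p k ∧
      (S.g p n T = 0 → S.g p k n = 0) := by
  -- Two linear conditions in dimension four have a nonzero common solution.
  obtain ⟨w, hw0, hwT, hwn⟩ : ∃ w : TangentSpace (𝓡 4) p,
      w ≠ 0 ∧ S.g p T w = 0 ∧ S.g p n w = 0 := by
    let f : TangentSpace (𝓡 4) p →ₗ[ℝ] ℝ × ℝ :=
      LinearMap.prod (S.g p T).toLinearMap (S.g p n).toLinearMap
    have : FiniteDimensional ℝ (TangentSpace (𝓡 4) p) :=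
      inferInstanceAs (FiniteDimensional ℝ E4)
    have hdim : Module.finrank ℝ (TangentSpace (𝓡 4) p) = 4 :=
      (finrank_euclideanSpace_fin : Module.finrank ℝ E4 = 4)
    have hker : LinearMap.ker f ≠ ⊥ := by
      apply LinearMap.ker_ne_bot_of_finrank_lt
      rw [hdim]
      simp
    obtain ⟨w, hw, hw0⟩ := Submodule.exists_mem_ne_zero_of_ne_bot hker
    have hw' : f w = 0 := hw
    exact ⟨w, hw0, congrArg Prod.fst hw', congrArg Prod.snd hw'⟩
  have hTT : S.g p T T < 0 := by rw [hT]; norm_num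
  have hww := S.pos_of_orthogonal_timelike hTT hw0 hwT
  set w' : TangentSpace (𝓡 4) p := (Real.sqrt (S.g p w w))⁻¹ • w with hw'
  have hTw' : S.g p T w' = 0 := by rw [hw', map_smul, hwT, smul_zero]
  have hw'T : S.g p w' T = 0 := by rw [S.symm, hTw']
  have hnw' : S.g p n w' = 0 := by rw [hw', map_smul, hwn, smul_zero]
  have hw'w' : S.g p w' w' = 1 := by
    have h := Real.mul_self_sqrt hww.le
    have h0 : Real.sqrt (S.g p w w) ≠ 0 := (Real.sqrt_pos.2 hww).ne'
    simp only [hw', map_smul, smul_apply, smul_eq_mul]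
    field_simp
    rw [sq]; exact h.symm
  have hk : S.g p (T + w') (T + w') = 0 := by
    simp only [map_add, add_apply, hT, hTw', hw'T, hw'w']
    norm_num
  have hk0 : T + w' ≠ 0 := by
    intro h
    have : S.g p T (T + w') = -1 := by rw [map_add, hT, hTw', add_zero]
    rw [h, map_zero] at this
    norm_num at this
  have hkn : S.g p n T = 0 → S.g p (T + w') n = 0 := by
    intro h
    rw [S.symm, map_add, h, hnw', add_zero]
  -- Either `T + w'` or its negative points to the future; both are null and orthogonal to `n`.
  rcases (S.ne_zero_of_timelike_causal (S.timeField_timelike p) hk0 hk.le).lt_or_gt with h | h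
  · exact ⟨_, hk, ⟨hk0, hk.le, h⟩, hkn⟩
  · have hk' : S.g p (-(T + w')) (-(T + w')) = 0 := by
      simp only [map_neg, neg_apply, hk, neg_zero]
    refine ⟨-(T + w'), hk', ⟨neg_ne_zero.2 hk0, hk'.le, ?_⟩, fun hn => ?_⟩
    · rw [map_neg]; linarith
    · rw [map_neg, neg_apply, hkn hn, neg_zero]

end Spacetime

/-! ### Local existence of geodesics for a `C^{1,1}` metric. -/

/-- The Picard-Lindelöf theorem for an autonomous vector field that is Lipschitz near a point. -/
theorem exists_hasDerivAt_of_lipschitzOnWith {E : Type*} [NormedAddCommGroup E] [NormedSpace ℝ E]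
    [CompleteSpace E] {f : E → E} {x₀ : E} {K : NNReal} {s : Set E} (hs : s ∈ 𝓝 x₀)
    (hl : LipschitzOnWith K f s) (t₀ : ℝ) :
    ∃ α : ℝ → E, α t₀ = x₀ ∧ ∃ ε > (0 : ℝ),
      ∀ t ∈ Ioo (t₀ - ε) (t₀ + ε), HasDerivAt α (f (α t)) t := by
  obtain ⟨a, ha, has⟩ := Metric.mem_nhds_iff.mp hs
  have ha : 0 < a := ha
  set L : ℝ := K * a + ‖f x₀‖ + 1 with hL
  have hL0 : 0 < L := by positivity
  have hsub : Metric.closedBall x₀ (a / 2) ⊆ s :=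
    (Metric.closedBall_subset_ball (half_lt_self ha)).trans has
  have hb : ∀ x ∈ Metric.closedBall x₀ (a / 2), ‖f x‖ ≤ L := by
    intro x hx
    have h1 : ‖f x‖ ≤ ‖f x - f x₀‖ + ‖f x₀‖ := norm_le_norm_sub_add _ _
    have h2 : ‖f x - f x₀‖ ≤ K * ‖x - x₀‖ := hl.norm_sub_le (hsub hx) (mem_of_mem_nhds hs)
    have h3 : ‖x - x₀‖ ≤ a := by
      rw [← mem_closedBall_iff_norm]
      exact Metric.closedBall_subset_closedBall (half_le_self ha.le) hx
    have h4 : (K : ℝ) * ‖x - x₀‖ ≤ K * a := by gcongr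
    linarith
  -- At speed at most `L`, time `a / (2L)` is needed to leave the ball of radius `a / 2`.
  set ε := a / L / 2 with hε
  have hε0 : 0 < ε := by positivity
  have hpl : IsPicardLindelof (fun _ ↦ f) (tmin := t₀ - ε) (tmax := t₀ + ε)
      ⟨t₀, by simp [hε0.le]⟩ x₀ ⟨a / 2, (half_pos ha).le⟩ 0 ⟨L, hL0.le⟩ K := by
    refine IsPicardLindelof.of_time_independent hb (hl.mono hsub) ?_
    have : L * ε = a / 2 := by rw [hε]; field_simp
    have h5 : L * max (t₀ + ε - t₀) (t₀ - (t₀ - ε)) ≤ a / 2 - 0 := by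
      rw [add_sub_cancel_left, sub_sub_cancel, max_self, this, sub_zero]
    exact h5
  obtain ⟨α, h1, h2⟩ := hpl.exists_eq_forall_mem_Icc_hasDerivWithinAt₀
  exact ⟨α, h1, ε, hε0, fun t ht =>
    (h2 t (Ioo_subset_Icc_self ht)).hasDerivAt (Icc_mem_nhds ht.1 ht.2)⟩

namespace Spacetime

variable {M : Type*} [TopologicalSpace M] [ChartedSpace E4 M] [IsManifold (𝓡 4) ∞ M]
variable {S : Spacetime M} {e : OpenPartialHomeomorph M E4}

theorem mdifferentiable_of_mem_maximalAtlas (he : e ∈ IsManifold.maximalAtlas (𝓡 4) ∞ M) :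
    OpenPartialHomeomorph.MDifferentiable (𝓡 4) (𝓡 4) e :=
  ⟨(contMDiffOn_of_mem_maximalAtlas he).mdifferentiableOn (by simp),
    (contMDiffOn_symm_of_mem_maximalAtlas he).mdifferentiableOn (by simp)⟩

theorem mfderiv_symm_ne_zero (he : e ∈ IsManifold.maximalAtlas (𝓡 4) ∞ M) {z v : E4}
    (hz : z ∈ e.target) (hv : v ≠ 0) : mfderiv (𝓡 4) (𝓡 4) e.symm z v ≠ 0 := by
  intro h
  have h2 := (mdifferentiable_of_mem_maximalAtlas he).comp_symm_deriv hz
  have h3 := DFunLike.congr_fun h2 v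
  apply hv
  refine h3.symm.trans ?_
  refine (congrArg (mfderiv (𝓡 4) (𝓡 4) e (e.symm z)) h).trans ?_
  exact map_zero _

theorem exists_mfderiv_symm_eq (he : e ∈ IsManifold.maximalAtlas (𝓡 4) ∞ M) {z : E4}
    (hz : z ∈ e.target) (w : TangentSpace (𝓡 4) (e.symm z)) :
    mfderiv (𝓡 4) (𝓡 4) e.symm z (mfderiv (𝓡 4) (𝓡 4) e (e.symm z) w) = w := by
  have h2 := (mdifferentiable_of_mem_maximalAtlas he).symm_comp_deriv (e.map_target hz)
  have h3 := DFunLike.congr_fun h2 w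
  rw [e.right_inv hz] at h3
  exact h3

/-- A vector orthogonal to everything is orthogonal to the time orientation, hence spacelike if
nonzero, but it is also orthogonal to itself. -/
theorem chartMetric_injective (he : e ∈ IsManifold.maximalAtlas (𝓡 4) ∞ M) {z : E4}
    (hz : z ∈ e.target) : Function.Injective (S.chartMetric e z) := by
  rw [injective_iff_map_eq_zero]
  intro v hv
  by_contra hv0
  have hw := mfderiv_symm_ne_zero he hz hv0
  have key : ∀ V : TangentSpace (𝓡 4) (e.symm z),
      S.g (e.symm z) (mfderiv (𝓡 4) (𝓡 4) e.symm z v) V = 0 := by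
    intro V
    have := DFunLike.congr_fun hv (mfderiv (𝓡 4) (𝓡 4) e (e.symm z) V)
    rw [← exists_mfderiv_symm_eq he hz V]
    exact this
  have hpos := S.pos_of_orthogonal_timelike (S.timeField_timelike (e.symm z)) hw
    (by rw [S.symm]; exact key _)
  rw [key] at hpos
  exact lt_irrefl _ hpos

theorem exists_chartMetric_equiv (he : e ∈ IsManifold.maximalAtlas (𝓡 4) ∞ M) {z : E4}
    (hz : z ∈ e.target) : ∃ f : E4 ≃L[ℝ] (E4 →L[ℝ] ℝ), (f : E4 →L[ℝ] (E4 →L[ℝ] ℝ)) = S.chartMetric e z := by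
  have hfin : Module.finrank ℝ E4 = Module.finrank ℝ (E4 →L[ℝ] ℝ) := by
    rw [← (LinearMap.toContinuousLinearMap (𝕜 := ℝ) (E := E4) (F' := ℝ)).finrank_eq]
    exact (Subspace.dual_finrank_eq (K := ℝ) (V := E4)).symm
  exact ⟨(LinearEquiv.ofInjectiveOfFinrankEq (S.chartMetric e z).toLinearMap
    (chartMetric_injective he hz) hfin).toContinuousLinearEquiv, by ext; rfl⟩

/-- The right-hand side of the geodesic equation, with lowered index. -/
noncomputable def geodesicForm (S : Spacetime M) (e : OpenPartialHomeomorph M E4)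
    (q : E4 × E4) : E4 →L[ℝ] ℝ :=
  (1 / 2 : ℝ) • ((fderiv ℝ (S.chartMetric e) q.1).flip q.2).flip q.2
    - fderiv ℝ (S.chartMetric e) q.1 q.2 q.2

/-- The acceleration of the geodesic through `q.1` with velocity `q.2`. -/
noncomputable def acceleration (S : Spacetime M) (e : OpenPartialHomeomorph M E4)
    (q : E4 × E4) : E4 :=
  (S.chartMetric e q.1).inverse (S.geodesicForm e q)

theorem fderiv_chartMetric_apply (he : e ∈ IsManifold.maximalAtlas (𝓡 4) ∞ M) {z : E4}
    (hz : z ∈ e.target) (v w h : E4) :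
    fderiv ℝ (fun y => metricInChart S.g e y v w) z h = fderiv ℝ (S.chartMetric e) z h v w := by
  have hd := differentiableAt_chartMetric (S := S) he hz
  have h1 : HasFDerivAt (fun y => S.chartMetric e y v w)
      (((ContinuousLinearMap.apply ℝ ℝ w).comp
        (ContinuousLinearMap.apply ℝ (E4 →L[ℝ] ℝ) v)).comp (fderiv ℝ (S.chartMetric e) z)) z :=
    ((ContinuousLinearMap.apply ℝ ℝ w).comp
        (ContinuousLinearMap.apply ℝ (E4 →L[ℝ] ℝ) v)).hasFDerivAt.comp z hd.hasFDerivAt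
  exact DFunLike.congr_fun h1.fderiv h

theorem chartMetric_acceleration (he : e ∈ IsManifold.maximalAtlas (𝓡 4) ∞ M) {z : E4}
    (hz : z ∈ e.target) (v : E4) :
    S.chartMetric e z (S.acceleration e (z, v)) = S.geodesicForm e (z, v) := by
  obtain ⟨f, hf⟩ := exists_chartMetric_equiv (S := S) he hz
  simp only [acceleration]
  rw [← hf, ContinuousLinearMap.inverse_equiv]
  simp

/-- Nondegeneracy permits raising the index, which turns the weak equation into an ODE in normal
form. -/
theorem geodesicEquation_iff (he : e ∈ IsManifold.maximalAtlas (𝓡 4) ∞ M) {z : E4}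
    (hz : z ∈ e.target) (v a : E4) :
    (∀ w : E4, metricInChart S.g e z a w + fderiv ℝ (fun y => metricInChart S.g e y v w) z v
        - (1 / 2) * fderiv ℝ (fun y => metricInChart S.g e y v v) z w = 0)
      ↔ a = S.acceleration e (z, v) := by
  rw [← (chartMetric_injective (S := S) he hz).eq_iff, chartMetric_acceleration he hz,
    ContinuousLinearMap.ext_iff]
  refine forall_congr' fun w => ?_
  rw [fderiv_chartMetric_apply he hz, fderiv_chartMetric_apply he hz, chartMetric_apply]
  simp only [geodesicForm, sub_apply, smul_apply, ContinuousLinearMap.flip_apply, smul_eq_mul]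
  constructor <;> intro h <;> linarith

/-- Regularity is assumed for each component separately. The finitely many components on basis
vectors determine the trilinear form through an injective linear map; a linear left inverse recovers
it, and the Lipschitz bound with it. -/
theorem locallyLipschitzOn_fderiv_chartMetric (he : e ∈ IsManifold.maximalAtlas (𝓡 4) ∞ M)
    {z : E4} (hz : z ∈ e.target) :
    ∃ K, ∃ s ∈ 𝓝 z, LipschitzOnWith K (fderiv ℝ (S.chartMetric e)) s := by
  let b := EuclideanSpace.basisFun (Fin 4) ℝ
  let L : (E4 →L[ℝ] E4 →L[ℝ] E4 →L[ℝ] ℝ) →ₗ[ℝ] (Fin 4 → Fin 4 → (E4 →L[ℝ] ℝ)) :=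
    { toFun := fun A i j => (A.flip (b i)).flip (b j)
      map_add' := fun A A' => by ext; simp
      map_smul' := fun c A => by ext; simp }
  have hL : LinearMap.ker L = ⊥ := by
    rw [LinearMap.ker_eq_bot, injective_iff_map_eq_zero]
    intro A hA
    ext h v w
    have key : ∀ i j, A h (b i) (b j) = 0 := fun i j =>
      DFunLike.congr_fun (congrFun (congrFun hA i) j) h
    have h1 : ∀ i, A h (b i) = 0 := by
      intro i
      refine ContinuousLinearMap.coe_injective (b.toBasis.ext fun j => ?_)
      simpa using key i j
    have h2 : A h = 0 := by
      refine ContinuousLinearMap.coe_injective (b.toBasis.ext fun j => ?_)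
      simpa using h1 j
    rw [h2]
    rfl
  obtain ⟨Linv, hLinv⟩ := L.exists_leftInverse_of_injective hL
  have hcomp : ∀ i j, ∃ K, ∃ s ∈ 𝓝 z,
      LipschitzOnWith K (fun y => L (fderiv ℝ (S.chartMetric e) y) i j) s := by
    intro i j
    obtain ⟨K, t, ht, hK⟩ := (S.regular e he (b i) (b j)).2 hz
    rw [e.open_target.nhdsWithin_eq hz] at ht
    refine ⟨K, t ∩ e.target, inter_mem ht (e.open_target.mem_nhds hz), ?_⟩
    intro y hy y' hy'
    have : ∀ y ∈ t ∩ e.target, L (fderiv ℝ (S.chartMetric e) y) i j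
        = fderiv ℝ (fun x => metricInChart S.g e x (b i) (b j)) y := by
      intro y hy
      ext h
      rw [fderiv_chartMetric_apply he hy.2]
      rfl
    simp only [this y hy, this y' hy']
    exact hK hy.1 hy'.1
  choose K s hs hK using hcomp
  have h1 : LipschitzOnWith (Finset.univ.sup fun i => Finset.univ.sup fun j => K i j)
      (fun y => L (fderiv ℝ (S.chartMetric e) y)) (⋂ i, ⋂ j, s i j) := by
    intro y hy y' hy'
    simp only [mem_iInter] at hy hy'
    rw [edist_pi_le_iff]
    intro i
    rw [edist_pi_le_iff]
    intro j
    refine (hK i j (hy i j) (hy' i j)).trans ?_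
    gcongr
    exact (Finset.le_sup (f := fun j => K i j) (Finset.mem_univ j)).trans
      (Finset.le_sup (f := fun i => Finset.univ.sup fun j => K i j) (Finset.mem_univ i))
  have h2 := (LinearMap.toContinuousLinearMap Linv).lipschitz.comp_lipschitzOnWith h1
  have h3 : (LinearMap.toContinuousLinearMap Linv) ∘ (fun y => L (fderiv ℝ (S.chartMetric e) y))
      = fderiv ℝ (S.chartMetric e) := by
    funext y
    exact DFunLike.congr_fun hLinv _
  rw [h3] at h2
  refine ⟨_, ⋂ i, ⋂ j, s i j, ?_, h2⟩
  simp only [Filter.iInter_mem]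
  exact hs

-- This is where the class `C^{1,1}` is needed: the acceleration is a smooth function `Ψ` of the
-- inverse metric, which is `C¹`, of the first derivatives of the metric, which are Lipschitz, and
-- of the velocity.
set_option maxHeartbeats 1000000 in
theorem exists_lipschitzOnWith_acceleration (he : e ∈ IsManifold.maximalAtlas (𝓡 4) ∞ M)
    {q : E4 × E4} (hz : q.1 ∈ e.target) :
    ∃ K, ∃ s ∈ 𝓝 q, LipschitzOnWith K (fun q => (q.2, S.acceleration e q)) s := by
  obtain ⟨K, s, hs, hK⟩ := locallyLipschitzOn_fderiv_chartMetric (S := S) he hz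
  obtain ⟨f, hf⟩ := exists_chartMetric_equiv (S := S) he hz
  have hinv : ContDiffAt ℝ 1 (fun z => (S.chartMetric e z).inverse) q.1 := by
    refine ContDiffAt.comp q.1 (g := ContinuousLinearMap.inverse) ?_
      ((contDiffOn_chartMetric he).contDiffAt (e.open_target.mem_nhds hz))
    rw [← hf]
    exact contDiffAt_map_inverse f
  obtain ⟨K', s', hs', hK'⟩ := hinv.exists_lipschitzOnWith
  let Ψ : ((E4 →L[ℝ] ℝ) →L[ℝ] E4) × (E4 →L[ℝ] E4 →L[ℝ] E4 →L[ℝ] ℝ) × E4 → E4 × E4 :=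
    fun a => (a.2.2, a.1 ((1 / 2 : ℝ) • (a.2.1.flip a.2.2).flip a.2.2 - a.2.1 a.2.2 a.2.2))
  have hΨ : ContDiff ℝ 1 Ψ := by
    have hflip : ContDiff ℝ 1 (fun A : E4 →L[ℝ] E4 →L[ℝ] ℝ => A.flip) :=
      (ContinuousLinearMap.flipₗᵢ ℝ E4 E4 ℝ).contDiff
    have hflip' : ContDiff ℝ 1 (fun A : E4 →L[ℝ] E4 →L[ℝ] E4 →L[ℝ] ℝ => A.flip) :=
      (ContinuousLinearMap.flipₗᵢ ℝ E4 E4 (E4 →L[ℝ] ℝ)).contDiff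
    have h1 : ContDiff ℝ 1 (fun a : ((E4 →L[ℝ] ℝ) →L[ℝ] E4) ×
        (E4 →L[ℝ] E4 →L[ℝ] E4 →L[ℝ] ℝ) × E4 => a.2.1.flip a.2.2) :=
      (hflip'.comp contDiff_snd.fst).clm_apply contDiff_snd.snd
    refine contDiff_snd.snd.prodMk (contDiff_fst.clm_apply (ContDiff.sub ?_ ?_))
    · exact ((hflip.comp h1).clm_apply contDiff_snd.snd).const_smul _
    · exact (contDiff_snd.fst.clm_apply contDiff_snd.snd).clm_apply contDiff_snd.snd
  let h : E4 × E4 → ((E4 →L[ℝ] ℝ) →L[ℝ] E4) × (E4 →L[ℝ] E4 →L[ℝ] E4 →L[ℝ] ℝ) × E4 :=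
    fun q => ((S.chartMetric e q.1).inverse, fderiv ℝ (S.chartMetric e) q.1, q.2)
  let U : Set (E4 × E4) := Prod.fst ⁻¹' (s ∩ s')
  have hU : U ∈ 𝓝 q := continuous_fst.continuousAt.preimage_mem_nhds (inter_mem hs hs')
  have hfst : LipschitzOnWith 1 (Prod.fst : E4 × E4 → E4) U :=
    LipschitzWith.prod_fst.lipschitzOnWith
  have hh : LipschitzOnWith (max K' (max K 1)) h U := by
    refine LipschitzOnWith.prodMk ?_ (LipschitzOnWith.prodMk ?_ ?_)
    · have h3 := hK'.comp hfst (fun a ha => ha.2)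
      rw [mul_one] at h3
      exact h3
    · have h3 := hK.comp hfst (fun a ha => ha.1)
      rw [mul_one] at h3
      exact h3
    · exact LipschitzWith.prod_snd.lipschitzOnWith
  obtain ⟨K'', s'', hs'', hK''⟩ := (hΨ.contDiffAt (x := h q)).exists_lipschitzOnWith
  have hcont : ContinuousAt h q := hh.continuousOn.continuousAt hU
  have hcomp := hK''.comp (hh.mono inter_subset_left) (s := U ∩ h ⁻¹' s'') (fun a ha => ha.2)
  have heq : (fun q : E4 × E4 => (q.2, S.acceleration e q)) = Ψ ∘ h := rfl
  rw [heq]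
  exact ⟨_, U ∩ h ⁻¹' s'', inter_mem hU (hcont.preimage_mem_nhds hs''), hcomp⟩

/-- Local existence of geodesics in a chart. -/
theorem exists_local_geodesic (he : e ∈ IsManifold.maximalAtlas (𝓡 4) ∞ M)
    {z₀ : E4} (hz : z₀ ∈ e.target) (v₀ : E4) (t₀ : ℝ) :
    ∃ (z v : ℝ → E4), z t₀ = z₀ ∧ v t₀ = v₀ ∧ ∃ ε > (0 : ℝ), ∀ t ∈ Ioo (t₀ - ε) (t₀ + ε),
      z t ∈ e.target ∧ HasDerivAt z (v t) t ∧ HasDerivAt v (S.acceleration e (z t, v t)) t := by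
  obtain ⟨K, s, hs, hK⟩ := exists_lipschitzOnWith_acceleration (S := S) he (q := (z₀, v₀)) hz
  obtain ⟨α, hα, ε, hε, h⟩ := exists_hasDerivAt_of_lipschitzOnWith hs hK t₀
  have hcont : ContinuousAt (fun t => (α t).1) t₀ :=
    ((h t₀ ⟨by linarith, by linarith⟩).continuousAt).fst
  have hmem : ∀ᶠ t in 𝓝 t₀, (α t).1 ∈ e.target := by
    apply hcont.eventually_mem
    rw [hα]
    exact e.open_target.mem_nhds hz
  obtain ⟨ε', hε', h'⟩ := Metric.eventually_nhds_iff.1 hmem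
  refine ⟨fun t => (α t).1, fun t => (α t).2, by simp [hα], by simp [hα], min ε ε',
    lt_min hε hε', fun t ht => ?_⟩
  have h1 : |t - t₀| < min ε ε' := by
    rw [abs_lt]; constructor <;> linarith [ht.1, ht.2]
  have h2 := abs_lt.1 (h1.trans_le (min_le_left _ _))
  have h3 := h t ⟨by linarith [h2.1], by linarith [h2.2]⟩
  exact ⟨h' (by rw [Real.dist_eq]; exact h1.trans_le (min_le_right _ _)), h3.fst, h3.snd⟩

end Spacetime

/-! ### Covariance of the geodesic equation. -/

namespace Spacetime

variable {M : Type*} [TopologicalSpace M] [ChartedSpace E4 M] [IsManifold (𝓡 4) ∞ M]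
variable {S : Spacetime M} {e e' : OpenPartialHomeomorph M E4}

theorem g_congr (S : Spacetime M) {p q : M} (h : p = q) {v w v' w' : E4} (hv : v = v')
    (hw : w = w') :
    S.g p (v : TangentSpace (𝓡 4) p) (w : TangentSpace (𝓡 4) p)
      = S.g q (v' : TangentSpace (𝓡 4) q) (w' : TangentSpace (𝓡 4) q) := by
  subst h hv hw; rfl

theorem FutureCausal.congr {p q : M} (h : p = q) {v v' : E4} (hv : v = v')
    (H : S.FutureCausal p (v : TangentSpace (𝓡 4) p)) :
    S.FutureCausal q (v' : TangentSpace (𝓡 4) q) := by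
  subst h hv; exact H

/-! ### Change of charts -/

section transition

variable (he : e ∈ IsManifold.maximalAtlas (𝓡 4) ∞ M) (he' : e' ∈ IsManifold.maximalAtlas (𝓡 4) ∞ M)

include he he' in
theorem contDiffAt_transition {z : E4} (hz : z ∈ e.target) (hz' : e.symm z ∈ e'.source) :
    ContDiffAt ℝ ∞ (e' ∘ e.symm) z := by
  have h1 : ContMDiffAt (𝓡 4) (𝓡 4) ∞ e.symm z :=
    (contMDiffOn_symm_of_mem_maximalAtlas he).contMDiffAt (e.open_target.mem_nhds hz)
  have h2 : ContMDiffAt (𝓡 4) (𝓡 4) ∞ e' (e.symm z) :=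
    (contMDiffOn_of_mem_maximalAtlas he').contMDiffAt (e'.open_source.mem_nhds hz')
  exact (h2.comp z h1).contDiffAt

theorem eventually_mem_transition {z : E4} (hz : z ∈ e.target) (hz' : e.symm z ∈ e'.source) :
    ∀ᶠ y in 𝓝 z, y ∈ e.target ∧ e.symm y ∈ e'.source :=
  (e.open_target.eventually_mem hz).and
    ((e.continuousAt_symm hz).eventually_mem (e'.open_source.mem_nhds hz'))

include he he' in
theorem chartMetric_transition {z : E4} (hz : z ∈ e.target) (hz' : e.symm z ∈ e'.source)
    (v w : E4) :
    S.chartMetric e z v w = S.chartMetric e' ((e' ∘ e.symm) z) (fderiv ℝ (e' ∘ e.symm) z v)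
      (fderiv ℝ (e' ∘ e.symm) z w) := by
  have h1 : e.symm =ᶠ[𝓝 z] e'.symm ∘ (e' ∘ e.symm) := by
    filter_upwards [eventually_mem_transition hz hz'] with y hy
    exact (e'.left_inv hy.2).symm
  have h2 := h1.mfderiv_eq (I := 𝓡 4) (I' := 𝓡 4)
  have hφ : MDifferentiableAt (𝓡 4) (𝓡 4) (e' ∘ e.symm) z :=
    ((contDiffAt_transition he he' hz hz').differentiableAt (by simp)).mdifferentiableAt
  have hs : MDifferentiableAt (𝓡 4) (𝓡 4) e'.symm ((e' ∘ e.symm) z) :=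
    (mdifferentiable_of_mem_maximalAtlas he').mdifferentiableAt_symm (e'.map_source hz')
  have h3 := mfderiv_comp z hs hφ
  have h4 : ∀ v : E4, (mfderiv (𝓡 4) (𝓡 4) e.symm z v : E4)
      = mfderiv (𝓡 4) (𝓡 4) e'.symm ((e' ∘ e.symm) z) (fderiv ℝ (e' ∘ e.symm) z v) := by
    intro v
    rw [← mfderiv_eq_fderiv]
    exact (DFunLike.congr_fun h2 v).trans (DFunLike.congr_fun h3 v)
  exact S.g_congr (e'.left_inv hz').symm (h4 v) (h4 w)

-- The transition map pulls one nondegenerate metric back to another, so its derivative has no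
-- kernel; dimensions agree.
include he he' in
theorem fderiv_transition_surjective (S : Spacetime M) {z : E4} (hz : z ∈ e.target) (hz' : e.symm z ∈ e'.source) :
    Function.Surjective (fderiv ℝ (e' ∘ e.symm) z) := by
  have hfin : Function.Injective (fderiv ℝ (e' ∘ e.symm) z) := by
    rw [injective_iff_map_eq_zero]
    intro v hv
    apply chartMetric_injective (S := S) he hz
    ext w
    rw [chartMetric_transition he he' hz hz', hv]
    simp
  exact (LinearMap.injective_iff_surjective
    (f := (fderiv ℝ (e' ∘ e.symm) z).toLinearMap)).1 hfin

-- The transformation law of the Christoffel symbols. It follows by differentiating the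
-- transformation law of the metric, and the terms in second derivatives of the transition map
-- combine by their symmetry.
include he he' in
theorem acceleration_transition {z : E4} (hz : z ∈ e.target) (hz' : e.symm z ∈ e'.source)
    (v : E4) :
    S.acceleration e' ((e' ∘ e.symm) z, fderiv ℝ (e' ∘ e.symm) z v)
      = fderiv ℝ (fderiv ℝ (e' ∘ e.symm)) z v v
        + fderiv ℝ (e' ∘ e.symm) z (S.acceleration e (z, v)) := by
  set φ := e' ∘ e.symm with hφ
  have hφ2 : ContDiffAt ℝ 2 φ z := (contDiffAt_transition he he' hz hz').of_le ENat.LEInfty.out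
  have hφd : DifferentiableAt ℝ φ z := hφ2.differentiableAt two_ne_zero
  have hφd2 : DifferentiableAt ℝ (fderiv ℝ φ) z :=
    (hφ2.fderiv_right (m := 1) (by norm_num)).differentiableAt one_ne_zero
  have hsymm : ∀ a b, fderiv ℝ (fderiv ℝ φ) z a b = fderiv ℝ (fderiv ℝ φ) z b a :=
    fun a b => (hφ2.isSymmSndFDerivAt (by simp)).eq a b
  have hz2 : φ z ∈ e'.target := e'.map_source hz'
  have hG : DifferentiableAt ℝ (S.chartMetric e') (φ z) := differentiableAt_chartMetric he' hz2
  have key : ∀ v w h, fderiv ℝ (S.chartMetric e) z h v w =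
      fderiv ℝ (S.chartMetric e') (φ z) (fderiv ℝ φ z h) (fderiv ℝ φ z v) (fderiv ℝ φ z w)
      + S.chartMetric e' (φ z) (fderiv ℝ (fderiv ℝ φ) z h v) (fderiv ℝ φ z w)
      + S.chartMetric e' (φ z) (fderiv ℝ φ z v) (fderiv ℝ (fderiv ℝ φ) z h w) := by
    intro v w h
    rw [← fderiv_chartMetric_apply he hz]
    have h1 : (fun y => metricInChart S.g e y v w) =ᶠ[𝓝 z]
        fun y => S.chartMetric e' (φ y) (fderiv ℝ φ y v) (fderiv ℝ φ y w) := by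
      filter_upwards [eventually_mem_transition hz hz'] with y hy
      exact chartMetric_transition he he' hy.1 hy.2 v w
    rw [h1.fderiv_eq]
    have hA := (hG.hasFDerivAt.comp z hφd.hasFDerivAt)
    have hv := hφd2.hasFDerivAt.clm_apply (hasFDerivAt_const v z)
    have hw := hφd2.hasFDerivAt.clm_apply (hasFDerivAt_const w z)
    have := (hA.clm_apply hv).clm_apply hw
    erw [this.fderiv]
    simp
    ring
  symm
  rw [← geodesicEquation_iff he' hz2]
  intro w'
  -- Test vectors in the new chart are images of test vectors in the old one, so the old equation
  -- can be used.
  obtain ⟨w, rfl⟩ := fderiv_transition_surjective he he' S hz hz' w'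
  have h0 := (geodesicEquation_iff (S := S) he hz v (S.acceleration e (z, v))).2 rfl w
  rw [fderiv_chartMetric_apply he hz, fderiv_chartMetric_apply he hz, key, key,
    ← chartMetric_apply, chartMetric_transition he he' hz hz', ← hφ] at h0
  rw [fderiv_chartMetric_apply he' hz2, fderiv_chartMetric_apply he' hz2, ← chartMetric_apply]
  simp only [map_add, add_apply]
  rw [hsymm w v, S.chartMetric_symm e' (φ z) (fderiv ℝ (fderiv ℝ φ) z v w)] at h0
  linarith

end transition

end Spacetime

/-! ### Parameter intervals. -/

theorem parameterInterval_coe (b : ℝ) : parameterInterval b = Ico 0 b := by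
  ext t; simp [parameterInterval]

theorem parameterInterval_top : parameterInterval ⊤ = Ici 0 := by
  ext t; simp [parameterInterval]

theorem isOpen_setOf_coe_lt (b : EReal) : IsOpen {t : ℝ | (t : EReal) < b} :=
  isOpen_lt continuous_coe_real_ereal continuous_const

theorem parameterInterval_mono {b b' : EReal} (h : b ≤ b') :
    parameterInterval b ⊆ parameterInterval b' := fun _ ht => ⟨ht.1, ht.2.trans_le h⟩

theorem parameterInterval_eventuallyEq {b b' : EReal} {t : ℝ} (hb : (t : EReal) < b)
    (hb' : (t : EReal) < b') : parameterInterval b =ᶠ[𝓝 t] parameterInterval b' := by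
  filter_upwards [(isOpen_setOf_coe_lt b).mem_nhds hb, (isOpen_setOf_coe_lt b').mem_nhds hb']
    with s hs hs'
  have h1 : (s : EReal) < b := hs
  have h2 : (s : EReal) < b' := hs'
  change (0 ≤ s ∧ _) = (0 ≤ s ∧ _)
  simp [h1, h2]

theorem parameterInterval_mem_nhds {b : EReal} {t : ℝ} (ht : 0 < t) (hb : (t : EReal) < b) :
    parameterInterval b ∈ 𝓝 t := by
  filter_upwards [(isOpen_setOf_coe_lt b).mem_nhds hb, Ioi_mem_nhds ht] with s hs hs'
  exact ⟨le_of_lt hs', hs⟩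

theorem uniqueDiffOn_parameterInterval {b : EReal} (hb : 0 < b) :
    UniqueDiffOn ℝ (parameterInterval b) := by
  induction b with
  | bot => simp at hb
  | coe b =>
    rw [parameterInterval_coe]
    exact uniqueDiffOn_Ico 0 b
  | top =>
    rw [parameterInterval_top]
    exact uniqueDiffOn_Ici 0

/-! ### Null geodesics on the manifold and in charts. -/

namespace Spacetime

variable {M : Type*} [TopologicalSpace M] [ChartedSpace E4 M] [IsManifold (𝓡 4) ∞ M]
variable {S : Spacetime M} {e e' : OpenPartialHomeomorph M E4}

/-- The curve `γ` on `[0, b)` satisfies the conditions of a future-directed null geodesic at the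
parameter `t`. -/
def IsNullGeodesicAt (S : Spacetime M) (γ : ℝ → M) (b : EReal) (t : ℝ) : Prop :=
  ContMDiffWithinAt 𝓘(ℝ, ℝ) (𝓡 4) 2 γ (parameterInterval b) t ∧
  (∀ e ∈ IsManifold.maximalAtlas (𝓡 4) ∞ M, γ t ∈ e.source →
    derivWithin (derivWithin (fun s => e (γ s)) (parameterInterval b)) (parameterInterval b) t
      = S.acceleration e (e (γ t), derivWithin (fun s => e (γ s)) (parameterInterval b) t)) ∧
  S.FutureCausal (γ t) (velocity γ b t) ∧ S.g (γ t) (velocity γ b t) (velocity γ b t) = 0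

theorem isNullGeodesicOn_iff {γ : ℝ → M} {b : EReal} :
    S.IsNullGeodesicOn γ b ↔ 0 < b ∧ ∀ t ∈ parameterInterval b, S.IsNullGeodesicAt γ b t := by
  constructor
  · rintro ⟨hb, ⟨hC, hg⟩, hn⟩
    refine ⟨hb, fun t ht => ⟨hC t ht, fun e he hes => ?_, hn t ht⟩⟩
    rw [← geodesicEquation_iff he (e.map_source hes)]
    exact hg t ht e he hes
  · rintro ⟨hb, h⟩
    refine ⟨hb, ⟨fun t ht => (h t ht).1, fun t ht e he hes => ?_⟩, fun t ht => (h t ht).2.2⟩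
    exact (geodesicEquation_iff he (e.map_source hes) _ _).2 ((h t ht).2.1 e he hes)

theorem velocity_congr {γ γ' : ℝ → M} {b b' : EReal} {t : ℝ} (ht : t ∈ parameterInterval b)
    (hbb' : b ≤ b') (hγ : EqOn γ' γ (parameterInterval b)) :
    (velocity γ' b' t : E4) = velocity γ b t := by
  have hset : parameterInterval b' =ᶠ[𝓝 t] parameterInterval b :=
    parameterInterval_eventuallyEq (ht.2.trans_le hbb') ht.2
  have heq : γ' =ᶠ[𝓝[parameterInterval b] t] γ := hγ.eventuallyEq_of_mem self_mem_nhdsWithin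
  have h5 := mfderivWithin_congr_set (I := 𝓘(ℝ, ℝ)) (I' := 𝓡 4) (f := γ') hset
  have h6 := heq.mfderivWithin_eq (I := 𝓘(ℝ, ℝ)) (I' := 𝓡 4) (hγ ht)
  exact (DFunLike.congr_fun h5 (1 : ℝ)).trans (DFunLike.congr_fun h6 (1 : ℝ))

/-- The conditions are local in `t`. Since `t < b`, both parameter intervals have the same germ at
`t`, one-sided at `t = 0` in either case, so within-derivatives agree. -/
theorem IsNullGeodesicAt.congr {γ γ' : ℝ → M} {b b' : EReal} {t : ℝ}
    (h : S.IsNullGeodesicAt γ b t) (ht : t ∈ parameterInterval b) (hbb' : b ≤ b')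
    (hγ : EqOn γ' γ (parameterInterval b)) : S.IsNullGeodesicAt γ' b' t := by
  obtain ⟨h1, h2, h3, h4⟩ := h
  have hset : parameterInterval b' =ᶠ[𝓝 t] parameterInterval b :=
    parameterInterval_eventuallyEq (ht.2.trans_le hbb') ht.2
  have hnhds : 𝓝[parameterInterval b'] t = 𝓝[parameterInterval b] t :=
    nhdsWithin_eq_iff_eventuallyEq.2 hset
  have heq : γ' =ᶠ[𝓝[parameterInterval b] t] γ := hγ.eventuallyEq_of_mem self_mem_nhdsWithin
  have hvel := velocity_congr ht hbb' hγ
  refine ⟨?_, fun e he hes => ?_, h3.congr (hγ ht).symm hvel.symm,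
    (S.g_congr (hγ ht) hvel hvel).trans h4⟩
  · refine ContMDiffWithinAt.mono_of_mem_nhdsWithin (h1.congr_of_eventuallyEq heq (hγ ht)) ?_
    rw [hnhds]
    exact self_mem_nhdsWithin
  · have hc : (fun s => e (γ' s)) =ᶠ[𝓝[parameterInterval b] t] fun s => e (γ s) := by
      filter_upwards [heq] with s hs
      rw [hs]
    have hd : derivWithin (fun s => e (γ' s)) (parameterInterval b')
        =ᶠ[𝓝[parameterInterval b] t] derivWithin (fun s => e (γ s)) (parameterInterval b) := by
      refine EventuallyEq.trans ?_ hc.derivWithin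
      refine Filter.EventuallyEq.filter_mono ?_ nhdsWithin_le_nhds
      filter_upwards [hset.eventuallyEq_nhds] with s hs
      exact derivWithin_congr_set hs
    rw [derivWithin_congr_set hset, hd.derivWithin_eq_of_mem ht, hd.self_of_nhdsWithin ht,
      hγ ht]
    exact h2 e he (hγ ht ▸ hes)

theorem velocity_eq_of_chart (he : e ∈ IsManifold.maximalAtlas (𝓡 4) ∞ M) {γ : ℝ → M}
    {b : EReal} {t : ℝ} (hb : 0 < b) (ht : t ∈ parameterInterval b) {z : ℝ → E4} {v : E4}
    (hz : z t ∈ e.target) (hz' : HasDerivAt z v t)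
    (hγ : ∀ᶠ s in 𝓝[parameterInterval b] t, γ s = e.symm (z s)) :
    (velocity γ b t : E4) = mfderiv (𝓡 4) (𝓡 4) e.symm (z t) v := by
  have hγt : γ t = e.symm (z t) := hγ.self_of_nhdsWithin ht
  have huniq := uniqueDiffOn_parameterInterval hb
  have hsymm2 : ContMDiffAt (𝓡 4) (𝓡 4) 2 e.symm (z t) :=
    ((contMDiffOn_symm_of_mem_maximalAtlas he).contMDiffAt
      (e.open_target.mem_nhds hz)).of_le ENat.LEInfty.out
  have h6 := Filter.EventuallyEq.mfderivWithin_eq (I := 𝓘(ℝ, ℝ)) (I' := 𝓡 4)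
    (f := e.symm ∘ z) hγ hγt
  have hzm : MDifferentiableAt 𝓘(ℝ, ℝ) (𝓡 4) z t :=
    hz'.differentiableAt.mdifferentiableAt
  have hu : UniqueMDiffWithinAt 𝓘(ℝ, ℝ) (parameterInterval b) t :=
    (huniq t ht).uniqueMDiffWithinAt
  have hcomp : MDifferentiableAt 𝓘(ℝ, ℝ) (𝓡 4) (e.symm ∘ z) t :=
    (hsymm2.mdifferentiableAt two_ne_zero).comp t hzm
  have h7 := mfderivWithin_eq_mfderiv hu hcomp
  have h8 := mfderiv_comp t (hsymm2.mdifferentiableAt two_ne_zero) hzm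
  have h9 : mfderiv 𝓘(ℝ, ℝ) (𝓡 4) z t (1 : ℝ) = v := by
    rw [mfderiv_eq_fderiv]
    exact hz'.deriv
  refine (DFunLike.congr_fun h6 (1 : ℝ)).trans ((DFunLike.congr_fun h7 (1 : ℝ)).trans
    ((DFunLike.congr_fun h8 (1 : ℝ)).trans ?_))
  exact congrArg (mfderiv (𝓡 4) (𝓡 4) e.symm (z t)) h9

/-- A solution of the geodesic equation in one chart is a geodesic. -/
theorem isNullGeodesicAt_of_chart (he : e ∈ IsManifold.maximalAtlas (𝓡 4) ∞ M)
    {γ : ℝ → M} {b : EReal} {t : ℝ} (hb : 0 < b) (ht : t ∈ parameterInterval b) {z v : ℝ → E4}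
    (hz : ∀ᶠ s in 𝓝 t, z s ∈ e.target ∧ HasDerivAt z (v s) s ∧
      HasDerivAt v (S.acceleration e (z s, v s)) s)
    (hγ : ∀ᶠ s in 𝓝[parameterInterval b] t, γ s = e.symm (z s))
    (hfut : S.FutureCausal (e.symm (z t)) (mfderiv (𝓡 4) (𝓡 4) e.symm (z t) (v t)))
    (hnull : S.chartMetric e (z t) (v t) (v t) = 0) : S.IsNullGeodesicAt γ b t := by
  have hzt := hz.self_of_nhds
  have hγt : γ t = e.symm (z t) := hγ.self_of_nhdsWithin ht
  -- The acceleration depends continuously on position and velocity, so a differentiable solution of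
  -- the first-order system is automatically `C²` in position.
  have hz2 : ContDiffAt ℝ 2 z t := by
    obtain ⟨U, hU, hUo, htU⟩ := eventually_nhds_iff.1 hz
    have hacc : ContinuousOn (fun s => S.acceleration e (z s, v s)) U := by
      intro s hs
      obtain ⟨K, O, hO, hK⟩ := exists_lipschitzOnWith_acceleration (S := S) he
        (q := (z s, v s)) (hU s hs).1
      have h1 : ContinuousAt (fun q : E4 × E4 => S.acceleration e q) (z s, v s) :=
        (hK.continuousOn.continuousAt hO).snd
      exact (ContinuousAt.comp (f := fun s => (z s, v s)) h1 ((hU s hs).2.1.continuousAt.prodMk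
        (hU s hs).2.2.continuousAt)).continuousWithinAt
    have hv1 : ContDiffOn ℝ 1 v U := by
      rw [show (1 : ℕ∞ω) = 0 + 1 by norm_num, contDiffOn_succ_iff_deriv_of_isOpen hUo]
      refine ⟨fun s hs => (hU s hs).2.2.differentiableAt.differentiableWithinAt, by simp, ?_⟩
      rw [contDiffOn_zero]
      exact hacc.congr fun s hs => (hU s hs).2.2.deriv
    have hz2 : ContDiffOn ℝ 2 z U := by
      rw [show (2 : ℕ∞ω) = 1 + 1 by norm_num, contDiffOn_succ_iff_deriv_of_isOpen hUo]
      refine ⟨fun s hs => (hU s hs).2.1.differentiableAt.differentiableWithinAt, by simp, ?_⟩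
      exact hv1.congr fun s hs => (hU s hs).2.1.deriv
    exact hz2.contDiffAt (hUo.mem_nhds htU)
  have hsymm2 : ContMDiffAt (𝓡 4) (𝓡 4) 2 e.symm (z t) :=
    ((contMDiffOn_symm_of_mem_maximalAtlas he).contMDiffAt
      (e.open_target.mem_nhds hzt.1)).of_le ENat.LEInfty.out
  have huniq := uniqueDiffOn_parameterInterval hb
  have hvel := velocity_eq_of_chart he hb ht hzt.1 hzt.2.1 hγ
  refine ⟨?_, fun e' he' hes => ?_, hfut.congr hγt.symm hvel.symm,
    (S.g_congr hγt hvel hvel).trans hnull⟩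
  · have h1 : ContMDiffAt 𝓘(ℝ, ℝ) (𝓡 4) 2 (e.symm ∘ z) t := hsymm2.comp t hz2.contMDiffAt
    exact h1.contMDiffWithinAt.congr_of_eventuallyEq hγ hγt
  · set φ := e' ∘ e.symm with hφ
    rw [hγt] at hes
    have hφc : ContDiffAt ℝ ∞ φ (z t) := contDiffAt_transition he he' hzt.1 hes
    have hφ2 : ∀ᶠ y in 𝓝 (z t), ContDiffAt ℝ 2 φ y :=
      (hφc.of_le ENat.LEInfty.out : ContDiffAt ℝ 2 φ (z t)).eventually (by simp)
    have hc : (fun s => e' (γ s)) =ᶠ[𝓝[parameterInterval b] t] fun s => φ (z s) := by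
      filter_upwards [hγ] with s hs
      rw [hs]; rfl
    have hd1 : ∀ᶠ s in 𝓝 t, HasDerivAt (fun s => φ (z s)) (fderiv ℝ φ (z s) (v s)) s := by
      filter_upwards [hz, hzt.2.1.continuousAt.eventually hφ2] with s hs hs'
      exact (hs'.differentiableAt two_ne_zero).hasFDerivAt.comp_hasDerivAt s hs.2.1
    have hd1' : derivWithin (fun s => e' (γ s)) (parameterInterval b)
        =ᶠ[𝓝[parameterInterval b] t] fun s => fderiv ℝ φ (z s) (v s) := by
      refine hc.derivWithin.trans ?_
      filter_upwards [nhdsWithin_le_nhds hd1, self_mem_nhdsWithin] with s hs hs'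
      exact hs.hasDerivWithinAt.derivWithin (huniq s hs')
    -- The second derivative of the transformed curve is exactly the right-hand side of the law for
    -- the acceleration in `acceleration_transition`.
    have hd2 : HasDerivAt (fun s => fderiv ℝ φ (z s) (v s))
        (fderiv ℝ (fderiv ℝ φ) (z t) (v t) (v t)
          + fderiv ℝ φ (z t) (S.acceleration e (z t, v t))) t := by
      have h1 : DifferentiableAt ℝ (fderiv ℝ φ) (z t) :=
        (hφ2.self_of_nhds.fderiv_right (m := 1) (by norm_num)).differentiableAt one_ne_zero
      exact (h1.hasFDerivAt.comp_hasDerivAt t hzt.2.1).clm_apply hzt.2.2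
    rw [hd1'.derivWithin_eq_of_mem ht, hd2.hasDerivWithinAt.derivWithin (huniq t ht),
      hd1'.self_of_nhdsWithin ht, hγt]
    exact (acceleration_transition he he' hzt.1 hes (v t)).symm

/-- In a chart, a null geodesic solves the geodesic equation. -/
theorem IsNullGeodesicOn.chart_hasDerivAt (he : e ∈ IsManifold.maximalAtlas (𝓡 4) ∞ M)
    {γ : ℝ → M} {b : EReal} (h : S.IsNullGeodesicOn γ b) {t : ℝ} (ht : 0 < t)
    (htb : (t : EReal) < b) (hes : γ t ∈ e.source) :
    HasDerivAt (fun s => e (γ s)) (derivWithin (fun s => e (γ s)) (parameterInterval b) t) t ∧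
    HasDerivAt (derivWithin (fun s => e (γ s)) (parameterInterval b))
      (S.acceleration e (e (γ t), derivWithin (fun s => e (γ s)) (parameterInterval b) t)) t := by
  obtain ⟨hb, h⟩ := isNullGeodesicOn_iff.1 h
  have hmem : t ∈ parameterInterval b := ⟨ht.le, htb⟩
  have hn := parameterInterval_mem_nhds ht htb
  obtain ⟨h1, h2, -⟩ := h t hmem
  have hc : ContDiffAt ℝ 2 (fun s => e (γ s)) t := by
    have h3 : ContMDiffAt (𝓡 4) (𝓡 4) 2 e (γ t) :=
      ((contMDiffOn_of_mem_maximalAtlas he).contMDiffAt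
        (e.open_source.mem_nhds hes)).of_le ENat.LEInfty.out
    exact (h3.comp t (h1.contMDiffAt hn)).contDiffAt
  have hev : derivWithin (fun s => e (γ s)) (parameterInterval b)
      =ᶠ[𝓝 t] deriv (fun s => e (γ s)) := by
    filter_upwards [eventually_mem_nhds_iff.2 hn] with s hs
    exact derivWithin_of_mem_nhds hs
  refine ⟨?_, ?_⟩
  · rw [hev.self_of_nhds]
    exact (hc.differentiableAt two_ne_zero).hasDerivAt
  · rw [← h2 e he hes]
    rw [derivWithin_of_mem_nhds hn]
    have h3 : ContDiffAt ℝ 1 (deriv fun s => e (γ s)) t :=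
      (hc.fderiv_right (m := 1) (by norm_num)).clm_apply contDiffAt_const
    exact ((h3.differentiableAt one_ne_zero).congr_of_eventuallyEq hev).hasDerivAt

end Spacetime

/-! ### Existence and maximal extension of null geodesics. -/

namespace Spacetime

variable {M : Type*} [TopologicalSpace M] [ChartedSpace E4 M] [IsManifold (𝓡 4) ∞ M]
variable {S : Spacetime M} {e e' : OpenPartialHomeomorph M E4}

theorem tangentBundle_mk_eq {p q : M} (h : p = q) {v w : E4} (hv : v = w) :
    (⟨p, (v : TangentSpace (𝓡 4) p)⟩ : TangentBundle (𝓡 4) M)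
      = ⟨q, (w : TangentSpace (𝓡 4) q)⟩ := by
  subst h hv; rfl

theorem continuousOn_acceleration (he : e ∈ IsManifold.maximalAtlas (𝓡 4) ∞ M) {q : E4 × E4}
    (hq : q.1 ∈ e.target) : ContinuousAt (fun q : E4 × E4 => (q.2, S.acceleration e q)) q := by
  obtain ⟨K, O, hO, hK⟩ := exists_lipschitzOnWith_acceleration (S := S) he hq
  exact hK.continuousOn.continuousAt hO

/-- The time orientation in the chart `e`. -/
noncomputable def chartTime (S : Spacetime M) (e : OpenPartialHomeomorph M E4) (z : E4) : E4 :=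
  mfderiv (𝓡 4) (𝓡 4) e (e.symm z) (S.timeField (e.symm z))

/-- The time orientation is a continuous section of the tangent bundle; composing it with the
tangent map of the chart gives continuous components. -/
theorem continuousOn_chartTime (he : e ∈ IsManifold.maximalAtlas (𝓡 4) ∞ M) :
    ContinuousOn (S.chartTime e) e.target := by
  have : IsManifold (𝓡 4) 1 M := IsManifold.of_le (n := ∞) (by simp)
  have h1 : ContinuousOn (tangentMapWithin (𝓡 4) (𝓡 4) e e.source)
      (Bundle.TotalSpace.proj ⁻¹' e.source) :=
    (contMDiffOn_of_mem_maximalAtlas he).continuousOn_tangentMapWithin (by simp)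
      e.open_source.uniqueMDiffOn
  have h2 : ContinuousOn (fun z => (⟨e.symm z, S.timeField (e.symm z)⟩ : TangentBundle (𝓡 4) M))
      e.target := S.timeField_continuous.comp_continuousOn e.continuousOn_symm
  have h3 := (tangentBundleModelSpaceHomeomorph (𝓡 4)).continuous.comp_continuousOn
    (h1.comp h2 (fun z hz => e.map_target hz))
  refine (continuous_snd.comp_continuousOn h3).congr fun z hz => ?_
  change _ = mfderivWithin (𝓡 4) (𝓡 4) e e.source (e.symm z) (S.timeField (e.symm z))
  rw [mfderivWithin_of_isOpen e.open_source (e.map_target hz)]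
  rfl

theorem futureCausal_iff_chart (he : e ∈ IsManifold.maximalAtlas (𝓡 4) ∞ M) {z v : E4}
    (hz : z ∈ e.target) :
    S.FutureCausal (e.symm z) (mfderiv (𝓡 4) (𝓡 4) e.symm z v) ↔
      v ≠ 0 ∧ S.chartMetric e z v v ≤ 0 ∧ S.chartMetric e z (S.chartTime e z) v < 0 := by
  have h1 : S.chartMetric e z (S.chartTime e z) v
      = S.g (e.symm z) (S.timeField (e.symm z)) (mfderiv (𝓡 4) (𝓡 4) e.symm z v) :=
    S.g_congr rfl (exists_mfderiv_symm_eq he hz _) rfl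
  rw [h1]
  refine and_congr ?_ Iff.rfl
  refine not_congr ⟨fun h => ?_, fun h => ?_⟩
  · by_contra hv
    exact mfderiv_symm_ne_zero he hz hv h
  · rw [h]; exact map_zero _

/-- A nonzero null vector is never orthogonal to a timelike one. Thus the weak inequality that
survives a limit is strict again. -/
theorem chartMetric_chartTime_neg (he : e ∈ IsManifold.maximalAtlas (𝓡 4) ∞ M) {z v : E4}
    (hz : z ∈ e.target) (hv : v ≠ 0) (hvv : S.chartMetric e z v v = 0)
    (h : S.chartMetric e z (S.chartTime e z) v ≤ 0) :
    S.chartMetric e z (S.chartTime e z) v < 0 := by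
  refine lt_of_le_of_ne h ?_
  have h1 : S.chartMetric e z (S.chartTime e z) v
      = S.g (e.symm z) (S.timeField (e.symm z)) (mfderiv (𝓡 4) (𝓡 4) e.symm z v) :=
    S.g_congr rfl (exists_mfderiv_symm_eq he hz _) rfl
  rw [h1]
  exact S.ne_zero_of_timelike_causal (S.timeField_timelike _) (mfderiv_symm_ne_zero he hz hv)
    (le_of_eq hvv)

/-- `z` solves the geodesic equation in the chart `e` near `t`, with velocity `v`. -/
def SolvesAt (S : Spacetime M) (e : OpenPartialHomeomorph M E4) (z v : ℝ → E4) (t : ℝ) : Prop :=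
  z t ∈ e.target ∧ HasDerivAt z (v t) t ∧ HasDerivAt v (S.acceleration e (z t, v t)) t

/-- Inserting the geodesic equation with lowered index cancels the derivative of the metric along
the curve and leaves half of its derivative along `w`. For `w` a vector field along the curve this
measures the failure of `w` to be Killing; it yields all approximate conservation laws below. -/
theorem SolvesAt.hasDerivAt_inner (he : e ∈ IsManifold.maximalAtlas (𝓡 4) ∞ M) {z v : ℝ → E4}
    {t : ℝ} (h : S.SolvesAt e z v t) {w : ℝ → E4} {w' : E4} (hw : HasDerivAt w w' t) :
    HasDerivAt (fun s => S.chartMetric e (z s) (v s) (w s))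
      (1 / 2 * fderiv ℝ (S.chartMetric e) (z t) (w t) (v t) (v t)
        + S.chartMetric e (z t) (v t) w') t := by
  obtain ⟨h1, h2, h3⟩ := h
  have hG := (differentiableAt_chartMetric (S := S) he h1).hasFDerivAt.comp_hasDerivAt t h2
  have h4 := DFunLike.congr_fun (chartMetric_acceleration (S := S) he h1 (v t)) (w t)
  simp only [geodesicForm, sub_apply, smul_apply, ContinuousLinearMap.flip_apply,
    smul_eq_mul] at h4
  refine ((hG.clm_apply h3).clm_apply hw).congr_deriv ?_
  simp only [add_apply, Function.comp_apply]
  rw [h4]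
  ring

theorem chartMetric_self_const (he : e ∈ IsManifold.maximalAtlas (𝓡 4) ∞ M) {z v : ℝ → E4}
    {a b : ℝ} (h : ∀ t ∈ Ioo a b, S.SolvesAt e z v t) {s t : ℝ} (hs : s ∈ Ioo a b)
    (ht : t ∈ Ioo a b) :
    S.chartMetric e (z s) (v s) (v s) = S.chartMetric e (z t) (v t) (v t) := by
  have key : ∀ t ∈ Ioo a b,
      HasDerivAt (fun s => S.chartMetric e (z s) (v s) (v s)) 0 t := by
    intro t ht
    refine ((h t ht).hasDerivAt_inner he (h t ht).2.2).congr_deriv ?_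
    rw [S.chartMetric_symm, chartMetric_acceleration he (h t ht).1]
    simp only [geodesicForm, sub_apply, smul_apply, ContinuousLinearMap.flip_apply, smul_eq_mul]
    ring
  exact isOpen_Ioo.is_const_of_deriv_eq_zero isPreconnected_Ioo
    (f := fun s => S.chartMetric e (z s) (v s) (v s))
    (fun t ht => (key t ht).differentiableAt.differentiableWithinAt)
    (fun t ht => (key t ht).deriv) hs ht

theorem eventually_chartTime_neg (he : e ∈ IsManifold.maximalAtlas (𝓡 4) ∞ M) {z v : ℝ → E4}
    {t : ℝ} (h : S.SolvesAt e z v t)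
    (ht : S.chartMetric e (z t) (S.chartTime e (z t)) (v t) < 0) :
    ∀ᶠ s in 𝓝 t, S.chartMetric e (z s) (S.chartTime e (z s)) (v s) < 0 := by
  have h1 := (differentiableAt_chartMetric (S := S) he h.1).continuousAt.comp h.2.1.continuousAt
  have h2 : ContinuousAt (fun s => S.chartTime e (z s)) t :=
    ((continuousOn_chartTime he).continuousAt (e.open_target.mem_nhds h.1)).comp
      h.2.1.continuousAt
  exact ((h1.clm_apply h2).clm_apply h.2.2.continuousAt).eventually_lt continuousAt_const ht

/-- Null geodesics exist for a short time. -/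
theorem exists_isNullGeodesicOn (S : Spacetime M) {p : M} {k : TangentSpace (𝓡 4) p}
    (hk : S.FutureCausal p k) (hkk : S.g p k k = 0) :
    ∃ (γ : ℝ → M) (b : EReal), S.IsNullGeodesicOn γ b ∧ γ 0 = p ∧
      (velocity γ b 0 : E4) = k := by
  set e := chartAt E4 p
  have he : e ∈ IsManifold.maximalAtlas (𝓡 4) ∞ M := IsManifold.chart_mem_maximalAtlas p
  have hp : p ∈ e.source := mem_chart_source E4 p
  have hpe : e.symm (e p) = p := e.left_inv hp
  have hz0 : e p ∈ e.target := e.map_source hp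
  set v0 : E4 := mfderiv (𝓡 4) (𝓡 4) e p k with hv0
  have hkv : (mfderiv (𝓡 4) (𝓡 4) e.symm (e p) v0 : E4) = k :=
    DFunLike.congr_fun ((mdifferentiable_of_mem_maximalAtlas he).symm_comp_deriv hp) k
  obtain ⟨z, v, hz, hv, ε, hε, hsol⟩ := exists_local_geodesic (S := S) he hz0 v0 0
  have hsol : ∀ t ∈ Ioo (0 - ε) (0 + ε), S.SolvesAt e z v t := hsol
  have h0mem : (0 : ℝ) ∈ Ioo (0 - ε) (0 + ε) := ⟨by linarith, by linarith⟩
  have hfut0 : S.FutureCausal (e.symm (z 0)) (mfderiv (𝓡 4) (𝓡 4) e.symm (z 0) (v 0)) := by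
    rw [hz, hv]
    exact hk.congr hpe.symm hkv.symm
  have hnull0 : S.chartMetric e (z 0) (v 0) (v 0) = 0 := by
    rw [hz, hv]
    exact (S.g_congr hpe hkv hkv).trans hkk
  have hfutev := eventually_chartTime_neg he (hsol 0 h0mem)
    ((futureCausal_iff_chart he (hsol 0 h0mem).1).1 hfut0).2.2
  obtain ⟨δ, hδ, hfut⟩ := Metric.eventually_nhds_iff.1 hfutev
  set b : ℝ := min δ ε with hb
  have hb0 : 0 < b := lt_min hδ hε
  have hb0' : (0 : EReal) < (b : EReal) := by exact_mod_cast hb0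
  refine ⟨fun t => e.symm (z t), b, isNullGeodesicOn_iff.2 ⟨hb0', fun t ht => ?_⟩,
    by simp only [hz, hpe], ?_⟩
  · rw [parameterInterval_coe] at ht
    have htε : t ∈ Ioo (0 - ε) (0 + ε) :=
      ⟨by linarith [ht.1], by linarith [ht.2, min_le_right δ ε]⟩
    have hnull : S.chartMetric e (z t) (v t) (v t) = 0 :=
      (chartMetric_self_const he hsol htε h0mem).trans hnull0
    have hneg := hfut (y := t) (by
      rw [Real.dist_eq, sub_zero, abs_of_nonneg ht.1]; exact ht.2.trans_le (min_le_left _ _))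
    refine isNullGeodesicAt_of_chart he hb0' (by rwa [parameterInterval_coe]) (z := z) (v := v)
      ?_ (Eventually.of_forall fun _ => rfl) ?_ hnull
    · filter_upwards [isOpen_Ioo.mem_nhds htε] with s hs using hsol s hs
    · refine (futureCausal_iff_chart he (hsol t htε).1).2 ⟨?_, hnull.le, hneg⟩
      intro h0
      rw [h0, map_zero] at hneg
      exact lt_irrefl _ hneg
  · have := velocity_eq_of_chart he (γ := fun t => e.symm (z t)) hb0'
      (t := 0) ⟨le_rfl, hb0'⟩ (hsol 0 h0mem).1 (hsol 0 h0mem).2.1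
      (Eventually.of_forall fun _ => rfl)
    rw [this, hz, hv]
    exact hkv

/-- Every null geodesic extends to a maximal one. -/
theorem IsNullGeodesicOn.exists_maximal {γ₀ : ℝ → M} {b₀ : EReal}
    (h₀ : S.IsNullGeodesicOn γ₀ b₀) :
    ∃ (γ : ℝ → M) (b : EReal), S.IsMaximalNullGeodesicOn γ b ∧ b₀ ≤ b ∧
      EqOn γ γ₀ (parameterInterval b₀) := by
  let α := {x : (ℝ → M) × EReal // S.IsNullGeodesicOn x.1 x.2 ∧ b₀ ≤ x.2 ∧
    EqOn x.1 γ₀ (parameterInterval b₀)}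
  -- Zorn's lemma for the order by extension.
  let r : α → α → Prop := fun x y => x.1.2 ≤ y.1.2 ∧ EqOn y.1.1 x.1.1 (parameterInterval x.1.2)
  have htrans : ∀ {x y z : α}, r x y → r y z → r x z := fun hxy hyz =>
    ⟨hxy.1.trans hyz.1, fun t ht => (hyz.2 (parameterInterval_mono hxy.1 ht)).trans (hxy.2 ht)⟩
  have hchain : ∀ c : Set α, IsChain r c → ∃ ub, ∀ a ∈ c, r a ub := by
    intro c hc
    rcases c.eq_empty_or_nonempty with rfl | ⟨x₀, hx₀⟩
    · exact ⟨⟨(γ₀, b₀), h₀, le_rfl, fun _ _ => rfl⟩, by simp⟩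
    classical
    let B : EReal := sSup ((fun x : α => x.1.2) '' c)
    have hB : ∀ x ∈ c, x.1.2 ≤ B := fun x hx => le_sSup ⟨x, hx, rfl⟩
    -- The union of the chain: any member defined at `t` may be chosen, because comparable members
    -- agree on the smaller interval.
    let Γ : ℝ → M := fun t => if h : ∃ x ∈ c, (t : EReal) < x.1.2 then h.choose.1.1 t else γ₀ t
    have hΓ : ∀ x ∈ c, EqOn Γ x.1.1 (parameterInterval x.1.2) := by
      intro x hx t ht
      have h : ∃ x ∈ c, (t : EReal) < x.1.2 := ⟨x, hx, ht.2⟩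
      have hΓt : Γ t = h.choose.1.1 t := dif_pos h
      rw [hΓt]
      by_cases hxy : h.choose = x
      · rw [hxy]
      rcases hc h.choose_spec.1 hx hxy with h1 | h1
      · exact (h1.2 ⟨ht.1, h.choose_spec.2⟩).symm
      · exact h1.2 ht
    have hgeo : S.IsNullGeodesicOn Γ B := by
      refine isNullGeodesicOn_iff.2 ⟨h₀.1.trans_le (x₀.2.2.1.trans (hB x₀ hx₀)), fun t ht => ?_⟩
      obtain ⟨_, ⟨x, hx, rfl⟩, hxt⟩ := lt_sSup_iff.1 ht.2
      have htx : t ∈ parameterInterval x.1.2 := ⟨ht.1, hxt⟩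
      exact ((isNullGeodesicOn_iff.1 x.2.1).2 t htx).congr htx (hB x hx) (hΓ x hx)
    exact ⟨⟨(Γ, B), hgeo, x₀.2.2.1.trans (hB x₀ hx₀), fun t ht =>
      (hΓ x₀ hx₀ (parameterInterval_mono x₀.2.2.1 ht)).trans (x₀.2.2.2 ht)⟩,
      fun x hx => ⟨hB x hx, hΓ x hx⟩⟩
  obtain ⟨m, hm⟩ := exists_maximal_of_chains_bounded hchain htrans
  refine ⟨m.1.1, m.1.2, ⟨m.2.1, ?_⟩, m.2.2.1, m.2.2.2⟩
  rintro ⟨γ', b', hb', hγ', heq⟩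
  have := hm ⟨(γ', b'), hγ', m.2.2.1.trans hb'.le,
    fun t ht => (heq (parameterInterval_mono m.2.2.1 ht)).trans (m.2.2.2 ht)⟩ ⟨hb'.le, heq⟩
  exact this.1.not_gt hb'

theorem exists_isMaximalNullGeodesicOn (S : Spacetime M) {p : M} {k : TangentSpace (𝓡 4) p}
    (hk : S.FutureCausal p k) (hkk : S.g p k k = 0) :
    ∃ (γ : ℝ → M) (b : EReal), S.IsMaximalNullGeodesicOn γ b ∧ γ 0 = p ∧
      (velocity γ b 0 : E4) = k := by
  obtain ⟨γ₀, b₀, h₀, hp, hv⟩ := S.exists_isNullGeodesicOn hk hkk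
  obtain ⟨γ, b, h, hb, heq⟩ := h₀.exists_maximal
  have h0 : (0 : ℝ) ∈ parameterInterval b₀ := ⟨le_rfl, h₀.1⟩
  exact ⟨γ, b, h, (heq h0).trans hp, (velocity_congr h0 hb heq).trans hv⟩

theorem IsNullGeodesicOn.isCausalCurveOn {γ : ℝ → M} {b : EReal} (h : S.IsNullGeodesicOn γ b) :
    S.IsCausalCurveOn γ b :=
  ⟨h.1, h.2.1.1.of_le one_le_two, fun t ht => (h.2.2 t ht).1⟩

/-- The black hole is contained in every outer dark domain. -/
theorem BondiChart.blackHole_subset_outerDarkDomain (B : S.BondiChart)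
    {T : (p : M) → TangentSpace (𝓡 4) p} (hT : ∀ p : M, S.g p (T p) (T p) = -1) :
    B.blackHole ⊆ B.outerDarkDomain T := by
  intro p hp n _ hnT
  obtain ⟨k, hkk, hk, hkn⟩ := S.exists_futureNull_orthogonal (n := n) (hT p)
  obtain ⟨γ, b, hγ, hγ0, hv⟩ := S.exists_isMaximalNullGeodesicOn hk hkk
  exact ⟨k, γ, b, hγ, tangentBundle_mk_eq hγ0 hv, hkn hnT,
    fun hr => hp ⟨γ, b, hγ.1.isCausalCurveOn, hγ0, hr⟩⟩

end Spacetime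

/-! ### Extension of null geodesics beyond a finite parameter. -/

/-- An integral curve on `(a, b)` that stays in a compact set converges at `b`. -/
theorem exists_tendsto_of_hasDerivAt_of_isCompact {E : Type*} [NormedAddCommGroup E]
    [NormedSpace ℝ E] [CompleteSpace E] {F : E → E} {K : Set E} (hK : IsCompact K)
    (hF : ContinuousOn F K) {y : ℝ → E} {a b : ℝ} (hab : a < b)
    (hy : ∀ t ∈ Ioo a b, y t ∈ K ∧ HasDerivAt y (F (y t)) t) :
    ∃ q ∈ K, Tendsto y (𝓝[<] b) (𝓝 q) := by
  obtain ⟨C, hC⟩ := (hK.image_of_continuousOn hF).isBounded.exists_norm_le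
  have hC0 : ∀ t ∈ Ioo a b, ‖F (y t)‖₊ ≤ C.toNNReal := fun t ht => by
    rw [← NNReal.coe_le_coe, coe_nnnorm]
    exact (hC _ ⟨y t, (hy t ht).1, rfl⟩).trans (Real.le_coe_toNNReal C)
  -- The field is bounded on the compact set, so the curve is Lipschitz and hence Cauchy at the
  -- endpoint.
  have hlip : LipschitzOnWith C.toNNReal y (Ioo a b) :=
    (convex_Ioo a b).lipschitzOnWith_of_nnnorm_hasDerivWithin_le
      (fun t ht => (hy t ht).2.hasDerivWithinAt) hC0
  have hmem : Ioo a b ∈ 𝓝[<] b := Ioo_mem_nhdsLT hab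
  have hcau : Cauchy (map y (𝓝[<] b)) :=
    (cauchy_nhds.mono nhdsWithin_le_nhds).map_of_le hlip.uniformContinuousOn
      (le_principal_iff.2 hmem)
  obtain ⟨q, hq⟩ := CompleteSpace.complete hcau
  refine ⟨q, hK.isClosed.mem_of_tendsto hq ?_, hq⟩
  filter_upwards [hmem] with t ht using (hy t ht).1

/-- Two integral curves that fit together form an integral curve. -/
theorem hasDerivAt_ite_of_tendsto {E : Type*} [NormedAddCommGroup E] [NormedSpace ℝ E]
    {F : E → E} {y α : ℝ → E} {a b ε : ℝ} (hab : a < b) (hε : 0 < ε)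
    (hy : ∀ t ∈ Ioo a b, HasDerivAt y (F (y t)) t)
    (hα : ∀ t ∈ Ioo (b - ε) (b + ε), HasDerivAt α (F (α t)) t)
    (hlim : Tendsto y (𝓝[<] b) (𝓝 (α b))) (hF : ContinuousAt F (α b)) {t : ℝ}
    (ht : t ∈ Ioo a (b + ε)) :
    HasDerivAt (fun s => if s < b then y s else α s) (F (if t < b then y t else α t)) t := by
  set Y : ℝ → E := fun s => if s < b then y s else α s with hY
  rcases lt_trichotomy t b with h | rfl | h
  · have : Y =ᶠ[𝓝 t] y := by
      filter_upwards [Iio_mem_nhds h] with s hs using if_pos hs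
    rw [if_pos h]
    exact (hy t ⟨ht.1, h⟩).congr_of_eventuallyEq this
  · rw [if_neg (lt_irrefl t)]
    have hYt : Y t = α t := if_neg (lt_irrefl t)
    have hYl : Y =ᶠ[𝓝[<] t] y := by
      filter_upwards [self_mem_nhdsWithin] with s hs using if_pos hs
    have hYlim : Tendsto Y (𝓝[<] t) (𝓝 (α t)) := hlim.congr' hYl.symm
    have hmem : Ioo a t ∈ 𝓝[<] t := Ioo_mem_nhdsLT hab
    have hYd : ∀ s ∈ Ioo a t, HasDerivAt Y (F (y s)) s := fun s hs =>
      (hy s hs).congr_of_eventuallyEq (by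
        filter_upwards [Iio_mem_nhds hs.2] with r hr using if_pos hr)
    -- At the junction the left derivative is the limit of the derivatives, which exists by
    -- continuity of `F`; the right derivative comes from `α`, and the two coincide.
    have hleft : HasDerivWithinAt Y (F (α t)) (Iic t) t := by
      refine hasDerivWithinAt_Iic_of_tendsto_deriv (s := Ioo a t)
        (fun s hs => (hYd s hs).differentiableAt.differentiableWithinAt) ?_ hmem ?_
      · change Tendsto Y (𝓝[Ioo a t] t) (𝓝 (Y t))
        rw [hYt]
        exact hYlim.mono_left (nhdsWithin_mono _ fun s hs => hs.2)
      · refine Tendsto.congr' ?_ (hF.tendsto.comp hlim)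
        filter_upwards [hmem] with s hs using (hYd s hs).deriv.symm
    have hright : HasDerivWithinAt Y (F (α t)) (Ici t) t := by
      refine ((hα t ⟨by linarith, by linarith⟩).hasDerivWithinAt).congr (fun s hs => ?_) hYt
      exact if_neg (not_lt.2 hs)
    have := hleft.union hright
    rwa [Iic_union_Ici, hasDerivWithinAt_univ] at this
  · have : Y =ᶠ[𝓝 t] α := by
      filter_upwards [Ioi_mem_nhds h] with s hs using if_neg (not_lt.2 (le_of_lt hs))
    rw [if_neg (not_lt.2 h.le)]
    exact (hα t ⟨by linarith, ht.2⟩).congr_of_eventuallyEq this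

namespace Spacetime

variable {M : Type*} [TopologicalSpace M] [ChartedSpace E4 M] [IsManifold (𝓡 4) ∞ M]
variable {S : Spacetime M} {e e' : OpenPartialHomeomorph M E4}

theorem IsNullGeodesicOn.solvesAt (he : e ∈ IsManifold.maximalAtlas (𝓡 4) ∞ M)
    {γ : ℝ → M} {b : EReal} (h : S.IsNullGeodesicOn γ b) {t : ℝ} (ht : 0 < t)
    (htb : (t : EReal) < b) (hes : γ t ∈ e.source) :
    S.SolvesAt e (fun s => e (γ s)) (derivWithin (fun s => e (γ s)) (parameterInterval b)) t :=
  ⟨e.map_source hes, h.chart_hasDerivAt he ht htb hes⟩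

/-- In a chart, the velocity of a null geodesic is null and future-directed. -/
theorem IsNullGeodesicOn.chart_null (he : e ∈ IsManifold.maximalAtlas (𝓡 4) ∞ M)
    {γ : ℝ → M} {b : EReal} (h : S.IsNullGeodesicOn γ b) {t : ℝ}
    (ht : t ∈ parameterInterval b) (hes : γ t ∈ e.source) :
    let v := derivWithin (fun s => e (γ s)) (parameterInterval b) t
    (velocity γ b t : E4) = mfderiv (𝓡 4) (𝓡 4) e.symm (e (γ t)) v ∧
    S.FutureCausal (e.symm (e (γ t))) (mfderiv (𝓡 4) (𝓡 4) e.symm (e (γ t)) v) ∧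
      S.chartMetric e (e (γ t)) v v = 0 := by
  intro v
  have hγ : MDifferentiableWithinAt 𝓘(ℝ, ℝ) (𝓡 4) γ (parameterInterval b) t :=
    (h.2.1.1 t ht).mdifferentiableWithinAt two_ne_zero
  have heγ : MDifferentiableAt (𝓡 4) (𝓡 4) e (γ t) :=
    (mdifferentiable_of_mem_maximalAtlas he).mdifferentiableAt hes
  have hu : UniqueMDiffWithinAt 𝓘(ℝ, ℝ) (parameterInterval b) t :=
    (uniqueDiffOn_parameterInterval h.1 t ht).uniqueMDiffWithinAt
  have hv : v = mfderiv (𝓡 4) (𝓡 4) e (γ t) (velocity γ b t) := by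
    have h1 := mfderiv_comp_mfderivWithin t heγ hγ hu
    have h2 : mfderivWithin 𝓘(ℝ, ℝ) (𝓡 4) (e ∘ γ) (parameterInterval b) t (1 : ℝ) = v := by
      rw [mfderivWithin_eq_fderivWithin]
      rfl
    rw [← h2]
    exact DFunLike.congr_fun h1 (1 : ℝ)
  have hvel : (velocity γ b t : E4) = mfderiv (𝓡 4) (𝓡 4) e.symm (e (γ t)) v := by
    rw [hv]
    exact (DFunLike.congr_fun
      ((mdifferentiable_of_mem_maximalAtlas he).symm_comp_deriv hes) _).symm
  exact ⟨hvel, (h.2.2 t ht).1.congr (e.left_inv hes).symm hvel,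
    (S.g_congr (e.left_inv hes) hvel.symm hvel.symm).trans (h.2.2 t ht).2⟩

/-- A null geodesic with a bounded parameter whose position and velocity stay in a compact set
of a chart can be extended. -/
theorem IsNullGeodesicOn.not_isMaximal_of_isCompact
    (he : e ∈ IsManifold.maximalAtlas (𝓡 4) ∞ M) {γ : ℝ → M} {b : ℝ}
    (h : S.IsNullGeodesicOn γ b) {K : Set (E4 × E4)} (hK : IsCompact K)
    (hKe : ∀ q ∈ K, q.1 ∈ e.target ∧ q.2 ≠ 0) {a : ℝ} (ha : 0 ≤ a) (hab : a < b)
    (hmem : ∀ t ∈ Ioo a b, γ t ∈ e.source ∧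
      (e (γ t), derivWithin (fun s => e (γ s)) (parameterInterval b) t) ∈ K) :
    ¬ S.IsMaximalNullGeodesicOn γ b := by
  set v := derivWithin (fun s => e (γ s)) (parameterInterval b) with hv
  set F : E4 × E4 → E4 × E4 := fun q => (q.2, S.acceleration e q)
  have hF : ∀ q ∈ K, ContinuousAt F q := fun q hq => continuousOn_acceleration he (hKe q hq).1
  have hmemPI : ∀ t ∈ Ioo a b, t ∈ parameterInterval b := fun t ht => by
    rw [parameterInterval_coe]; exact ⟨ha.trans ht.1.le, ht.2⟩
  have hsol : ∀ t ∈ Ioo a b, S.SolvesAt e (fun s => e (γ s)) v t := fun t ht =>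
    h.solvesAt he (ha.trans_lt ht.1) (EReal.coe_lt_coe_iff.2 ht.2) (hmem t ht).1
  have hy : ∀ t ∈ Ioo a b, HasDerivAt (fun s => (e (γ s), v s)) (F (e (γ t), v t)) t :=
    fun t ht => (hsol t ht).2.1.prodMk (hsol t ht).2.2
  obtain ⟨q, hq, hlim⟩ := exists_tendsto_of_hasDerivAt_of_isCompact hK
    (fun q hq => (hF q hq).continuousWithinAt) hab fun t ht => ⟨(hmem t ht).2, hy t ht⟩
  -- The continuation is the geodesic whose data at `b` are the limiting position and velocity.
  obtain ⟨z, w, hz, hw, ε, hε, hzw⟩ := exists_local_geodesic (S := S) he (hKe q hq).1 q.2 b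
  set Z : ℝ → E4 := fun s => if s < b then e (γ s) else z s with hZ
  set V : ℝ → E4 := fun s => if s < b then v s else w s with hV
  have hZb : Z b = q.1 := by simp [hZ, hz]
  have hVb : V b = q.2 := by simp [hV, hw]
  have hq' : (z b, w b) = q := by simp [hz, hw]
  have hsol' : ∀ t ∈ Ioo a (b + ε), S.SolvesAt e Z V t := by
    intro t ht
    have h1 := hasDerivAt_ite_of_tendsto (F := F) (y := fun s => (e (γ s), v s))
      (α := fun s => (z s, w s)) hab hε hy (fun t ht => (hzw t ht).2.1.prodMk (hzw t ht).2.2)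
      (by rw [hq']; exact hlim) (by rw [hq']; exact hF q hq) ht
    have h2 : (fun s => if s < b then (e (γ s), v s) else (z s, w s)) = fun s => (Z s, V s) := by
      funext s
      by_cases hs : s < b <;> simp [hZ, hV, hs]
    have h3 : (if t < b then (e (γ t), v t) else (z t, w t)) = (Z t, V t) := congrFun h2 t
    rw [h3, h2] at h1
    refine ⟨?_, h1.fst, h1.snd⟩
    by_cases hs : t < b
    · simpa [hZ, hs] using (hsol t ⟨ht.1, hs⟩).1
    · simpa [hZ, hs] using (hzw t ⟨by linarith [not_lt.1 hs], ht.2⟩).1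
  have hbmem : b ∈ Ioo a (b + ε) := ⟨hab, by linarith⟩
  -- Nullity is known before `b`; constancy of the norm carries it from any such parameter past `b`.
  set m := (a + b) / 2 with hm
  have hmm : m ∈ Ioo a b := ⟨by linarith, by linarith⟩
  have hnull : ∀ t ∈ Ioo a (b + ε), S.chartMetric e (Z t) (V t) (V t) = 0 := by
    intro t ht
    rw [chartMetric_self_const he hsol' ht (⟨hmm.1, by linarith [hmm.2]⟩ : m ∈ Ioo a (b + ε))]
    have := (h.chart_null he (hmemPI m hmm) (hmem m hmm).1).2.2
    simpa only [hZ, hV, if_pos hmm.2] using this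
  have hfutb : S.chartMetric e (Z b) (S.chartTime e (Z b)) (V b) < 0 := by
    refine chartMetric_chartTime_neg he (hsol' b hbmem).1 (by rw [hVb]; exact (hKe q hq).2)
      (hnull b hbmem) ?_
    have hZc : ContinuousAt Z b := (hsol' b hbmem).2.1.continuousAt
    have h1 := (differentiableAt_chartMetric (S := S) he (hsol' b hbmem).1).continuousAt.comp hZc
    have h2 : ContinuousAt (fun s => S.chartTime e (Z s)) b :=
      ((continuousOn_chartTime he).continuousAt (e.open_target.mem_nhds (hsol' b hbmem).1)).comp
        hZc
    have h3 := (h1.clm_apply h2).clm_apply (hsol' b hbmem).2.2.continuousAt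
    refine le_of_tendsto (h3.tendsto.mono_left (nhdsWithin_le_nhds (s := Iio b))) ?_
    filter_upwards [Ioo_mem_nhdsLT hab] with t ht
    have h4 := (h.chart_null he (hmemPI t ht) (hmem t ht).1).2.1
    have h5 := ((futureCausal_iff_chart he (hsol t ht).1).1 h4).2.2
    simpa only [Function.comp, hZ, hV, if_pos ht.2] using h5.le
  obtain ⟨δ, hδ, hfut⟩ := Metric.eventually_nhds_iff.1
    (eventually_chartTime_neg he (hsol' b hbmem) hfutb)
  -- Within `ε` the continuation exists, and within `δ` it is still future-directed.
  set b' : ℝ := b + min δ ε with hb'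
  have hbb' : b < b' := by have := lt_min hδ hε; linarith
  have hbb'' : (b : EReal) < b' := EReal.coe_lt_coe_iff.2 hbb'
  rintro ⟨-, hmax⟩
  refine hmax ⟨fun t => if t < b then γ t else e.symm (z t), b', hbb'', ?_, ?_⟩
  · refine isNullGeodesicOn_iff.2 ⟨h.1.trans hbb'', fun t ht => ?_⟩
    by_cases htb : t < b
    · have ht' : t ∈ parameterInterval b := ⟨ht.1, EReal.coe_lt_coe_iff.2 htb⟩
      refine ((isNullGeodesicOn_iff.1 h).2 t ht').congr ht' hbb''.le fun s hs => ?_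
      exact if_pos (EReal.coe_lt_coe_iff.1 hs.2)
    · have hbt := not_lt.1 htb
      have htb' : t < b' := EReal.coe_lt_coe_iff.1 ht.2
      have htε : t ∈ Ioo a (b + ε) := ⟨by linarith, by linarith [min_le_right δ ε]⟩
      have hneg := hfut (y := t) (by
        rw [Real.dist_eq, abs_of_nonneg (by linarith)]; linarith [min_le_left δ ε])
      refine isNullGeodesicAt_of_chart he (h.1.trans hbb'') ht (z := Z) (v := V) ?_ ?_ ?_
        (hnull t htε)
      · filter_upwards [isOpen_Ioo.mem_nhds htε] with s hs using hsol' s hs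
      · have : ∀ᶠ s in 𝓝 t, s ∈ Ioo a (b + ε) := isOpen_Ioo.mem_nhds htε
        filter_upwards [nhdsWithin_le_nhds this] with s hs
        by_cases hsb : s < b
        · simp only [hZ, if_pos hsb]
          exact (e.left_inv (hmem s ⟨hs.1, hsb⟩).1).symm
        · simp only [hZ, if_neg hsb]
      · refine (futureCausal_iff_chart he (hsol' t htε).1).2 ⟨?_, (hnull t htε).le, hneg⟩
        intro h0
        rw [h0, map_zero] at hneg
        exact lt_irrefl _ hneg
  · intro t ht
    exact if_pos (EReal.coe_lt_coe_iff.1 ht.2)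

end Spacetime

/-! ### Polar coordinates -/

@[simp] theorem bondiPoint_zero_apply (u : ℝ) (X : E3) : bondiPoint u X 0 = u := rfl

@[simp] theorem spatialPart_bondiPoint (u : ℝ) (X : E3) : spatialPart (bondiPoint u X) = X := by
  ext i; fin_cases i <;> rfl

theorem bondiPoint_spatialPart (z : E4) : bondiPoint (z 0) (spatialPart z) = z := by
  ext i; fin_cases i <;> rfl

theorem spatialPart_apply (z : E4) (i : Fin 3) : spatialPart z i = z i.succ := by
  fin_cases i <;> rfl

/-- `spatialPart` as a continuous linear map. -/
noncomputable def spatialCLM : E4 →L[ℝ] E3 :=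
  LinearMap.toContinuousLinearMap
    { toFun := spatialPart
      map_add' := fun z w => by ext i; simp [spatialPart_apply]
      map_smul' := fun a z => by ext i; simp [spatialPart_apply] }

theorem spatialCLM_apply (z : E4) : spatialCLM z = spatialPart z := rfl

theorem spatialPart_add (z w : E4) : spatialPart (z + w) = spatialPart z + spatialPart w :=
  spatialCLM.map_add z w

theorem spatialPart_smul (a : ℝ) (z : E4) : spatialPart (a • z) = a • spatialPart z :=
  spatialCLM.map_smul a z

theorem E4_ext {z w : E4} (h0 : z 0 = w 0) (h : spatialPart z = spatialPart w) : z = w := by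
  rw [← bondiPoint_spatialPart z, ← bondiPoint_spatialPart w, h0, h]

/-- The inclusion of the spatial vectors, as a continuous linear map. -/
noncomputable def spaceCLM : E3 →L[ℝ] E4 :=
  LinearMap.toContinuousLinearMap
    { toFun := fun X => bondiPoint 0 X
      map_add' := fun X Y => E4_ext (by simp) (by simp [spatialPart_add])
      map_smul' := fun a X => E4_ext (by simp) (by simp [spatialPart_smul]) }

theorem spaceCLM_apply (X : E3) : spaceCLM X = bondiPoint 0 X := rfl

theorem bondiPoint_eq (u : ℝ) (X : E3) :
    bondiPoint u X = u • bondiPoint 1 0 + bondiPoint 0 X :=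
  E4_ext (by simp) (by simp [spatialPart_add, spatialPart_smul])

theorem norm_sq_eq_spatialPart (z : E4) : ‖z‖ ^ 2 = z 0 ^ 2 + ‖spatialPart z‖ ^ 2 := by
  simp only [EuclideanSpace.norm_sq_eq, Fin.sum_univ_succ, spatialPart_apply, Real.norm_eq_abs,
    sq_abs]

/-- The radius. -/
noncomputable def polarR (z : E4) : ℝ := ‖spatialPart z‖

/-- The angular position. -/
noncomputable def polarX (z : E4) : E3 := (polarR z)⁻¹ • spatialPart z

/-- The radial component of the vector `v` at `z`. -/
noncomputable def polarRho (z v : E4) : ℝ := inner ℝ (polarX z) (spatialPart v)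

/-- The angular component of the vector `v` at `z`. -/
noncomputable def polarXi (z v : E4) : E3 :=
  (polarR z)⁻¹ • (spatialPart v - polarRho z v • polarX z)

section polar

variable {z : E4} (hz : 0 < polarR z)

include hz

theorem norm_polarX : ‖polarX z‖ = 1 := by
  rw [polarX, norm_smul, norm_inv, Real.norm_of_nonneg hz.le]
  exact inv_mul_cancel₀ hz.ne'

theorem polarR_smul_polarX : polarR z • polarX z = spatialPart z := by
  rw [polarX, smul_smul, mul_inv_cancel₀ hz.ne', one_smul]

theorem inner_polarX_self : inner ℝ (polarX z) (polarX z) = 1 := by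
  rw [real_inner_self_eq_norm_sq, norm_polarX hz, one_pow]

theorem inner_polarX_polarXi (v : E4) : inner ℝ (polarX z) (polarXi z v) = 0 := by
  rw [polarXi, inner_smul_right, inner_sub_right, inner_smul_right, inner_polarX_self hz, mul_one]
  simp [polarRho]

theorem spatialPart_eq_polar (v : E4) :
    spatialPart v = polarRho z v • polarX z + polarR z • polarXi z v := by
  rw [polarXi, smul_smul, mul_inv_cancel₀ hz.ne', one_smul]
  abel

theorem bondiPoint_polar : bondiPoint (z 0) (polarR z • polarX z) = z := by
  rw [polarR_smul_polarX hz, bondiPoint_spatialPart]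

theorem norm_spatialPart_sq_polar (v : E4) :
    ‖spatialPart v‖ ^ 2 = polarRho z v ^ 2 + (polarR z * ‖polarXi z v‖) ^ 2 := by
  rw [spatialPart_eq_polar hz v, ← real_inner_self_eq_norm_sq]
  simp only [inner_add_left, inner_add_right, inner_smul_left, inner_smul_right,
    inner_polarX_self hz, inner_polarX_polarXi hz, real_inner_comm (polarX z),
    real_inner_self_eq_norm_sq, conj_trivial]
  ring

theorem polarRho_tangent {X : E3} (hX : inner ℝ (polarX z) X = 0) (u : ℝ) :
    polarRho z (bondiPoint u X) = 0 := by
  rw [polarRho, spatialPart_bondiPoint, hX]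

theorem polarXi_tangent {X : E3} (hX : inner ℝ (polarX z) X = 0) (u : ℝ) :
    polarXi z (bondiPoint u X) = (polarR z)⁻¹ • X := by
  rw [polarXi, polarRho_tangent hz hX, spatialPart_bondiPoint, zero_smul, sub_zero]

theorem polarRho_radial (u : ℝ) : polarRho z (bondiPoint u (polarX z)) = 1 := by
  rw [polarRho, spatialPart_bondiPoint, inner_polarX_self hz]

theorem polarXi_radial (u : ℝ) : polarXi z (bondiPoint u (polarX z)) = 0 := by
  rw [polarXi, polarRho_radial hz, spatialPart_bondiPoint, one_smul, sub_self, smul_zero]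

end polar

section polarDeriv

variable {Z V : ℝ → E4} {Z' V' : E4} {s : ℝ} (hr : 0 < polarR (Z s)) (hZ : HasDerivAt Z Z' s)
  (hV : HasDerivAt V V' s)

include hZ in
theorem HasDerivAt.spatialPart : HasDerivAt (fun t => spatialPart (Z t)) (spatialPart Z') s :=
  spatialCLM.hasFDerivAt.comp_hasDerivAt s hZ

include hZ in
theorem HasDerivAt.timePart : HasDerivAt (fun t => Z t 0) (Z' 0) s :=
  (EuclideanSpace.proj (0 : Fin 4) : E4 →L[ℝ] ℝ).hasFDerivAt.comp_hasDerivAt s hZ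

include hr hZ

theorem hasDerivAt_polarR : HasDerivAt (fun t => polarR (Z t)) (polarRho (Z s) Z') s := by
  have h1 : HasDerivAt (fun t => ‖spatialPart (Z t)‖ ^ 2)
      (2 * inner ℝ (spatialPart (Z s)) (spatialPart Z')) s := hZ.spatialPart.norm_sq
  have h2 := h1.sqrt (by have := hr.ne'; unfold polarR at this; positivity)
  have h3 : (fun t => Real.sqrt (‖spatialPart (Z t)‖ ^ 2)) = fun t => polarR (Z t) := by
    funext t; exact Real.sqrt_sq (norm_nonneg _)
  rw [h3] at h2
  refine h2.congr_deriv ?_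
  rw [Real.sqrt_sq (norm_nonneg _), polarRho, polarX, inner_smul_left]
  change 2 * _ / (2 * polarR (Z s)) = _
  simp only [conj_trivial]
  field_simp

theorem hasDerivAt_polarX : HasDerivAt (fun t => polarX (Z t)) (polarXi (Z s) Z') s := by
  have h1 := ((hasDerivAt_polarR hr hZ).inv hr.ne').smul hZ.spatialPart
  refine h1.congr_deriv ?_
  rw [polarXi, ← polarR_smul_polarX hr, smul_smul, smul_sub, smul_smul, Pi.inv_apply,
    sub_eq_add_neg, ← neg_smul]
  congr 2
  field_simp

include hV

theorem hasDerivAt_polarRho : HasDerivAt (fun t => polarRho (Z t) (V t))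
    (polarRho (Z s) V' + inner ℝ (polarXi (Z s) Z') (spatialPart (V s))) s :=
  (hasDerivAt_polarX hr hZ).inner ℝ hV.spatialPart

/-- The second-order formula in polar coordinates. Its last two terms are those by which
`abs_variation_le` identifies the change of the angular velocity under a variation. -/
theorem hasDerivAt_polarXi : HasDerivAt (fun t => polarXi (Z t) (V t))
    ((polarR (Z s))⁻¹ • (spatialPart V'
      - (polarRho (Z s) V' + inner ℝ (polarXi (Z s) Z') (spatialPart (V s))) • polarX (Z s)
      - polarRho (Z s) (V s) • polarXi (Z s) Z'
      - polarRho (Z s) Z' • polarXi (Z s) (V s))) s := by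
  have h1 := ((hasDerivAt_polarR hr hZ).inv hr.ne').smul
    (hV.spatialPart.sub ((hasDerivAt_polarRho hr hZ hV).smul (hasDerivAt_polarX hr hZ)))
  refine h1.congr_deriv ?_
  simp only [Pi.inv_apply, Pi.sub_apply, Pi.smul_apply']
  rw [show spatialPart (V s) - polarRho (Z s) (V s) • polarX (Z s)
      = polarR (Z s) • polarXi (Z s) (V s) by
    rw [polarXi, smul_smul, mul_inv_cancel₀ hr.ne', one_smul]]
  rw [smul_smul, show -polarRho (Z s) Z' / polarR (Z s) ^ 2 * polarR (Z s)
    = -((polarR (Z s))⁻¹ * polarRho (Z s) Z') by field_simp]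
  module

end polarDeriv

/-! ### Calculus of Bondi fall-off conditions. -/

/-- The bounds of `IsBondiO`, with explicit constants and for all directions at once. -/
def BondiBound (u₀ R C : ℝ) (n : ℤ) (F : ℝ → ℝ → E3 → ℝ) : Prop :=
  ∀ u r : ℝ, u₀ ≤ u → R < r → ∀ x : E3, ‖x‖ = 1 →
    DifferentiableAt ℝ (radialExtension F) (u, r, x) ∧
    |F u r x| ≤ C * r ^ n ∧
    ∀ (a b : ℝ) (v : E3), |fderiv ℝ (radialExtension F) (u, r, x) (a, b, v)|
      ≤ C * r ^ n * (|a| + |b| / r + ‖v‖)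

/-- `F = O(r^n)` uniformly on `u ≥ u₀`, with one derivative. -/
def BondiBounded (u₀ : ℝ) (n : ℤ) (F : ℝ → ℝ → E3 → ℝ) : Prop :=
  ∃ C R : ℝ, 0 ≤ C ∧ 1 ≤ R ∧ BondiBound u₀ R C n F

theorem radialExtension_of_norm_eq_one (F : ℝ → ℝ → E3 → ℝ) (u r : ℝ) {x : E3} (hx : ‖x‖ = 1) :
    radialExtension F (u, r, x) = F u r x := by
  simp [radialExtension, hx]

theorem BondiBound.mono {u₀ R C R' C' : ℝ} {n : ℤ} {F : ℝ → ℝ → E3 → ℝ}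
    (h : BondiBound u₀ R C n F) (hR0 : 0 ≤ R) (hR : R ≤ R') (hC : C ≤ C') :
    BondiBound u₀ R' C' n F := by
  intro u r hu hr x hx
  obtain ⟨h1, h2, h3⟩ := h u r hu (hR.trans_lt hr) x hx
  have hr0 : 0 < r := hR0.trans_lt (hR.trans_lt hr)
  refine ⟨h1, h2.trans (by gcongr), fun a b v => (h3 a b v).trans ?_⟩
  gcongr

/-- The weight `|b| / r` in the derivative bound encodes that a radial derivative gains one power of
`r`. -/
theorem IsBondiO.bondiBounded {n : ℤ} {F : ℝ → ℝ → E3 → ℝ} (h : IsBondiO n F) (u₀ : ℝ) :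
    BondiBounded u₀ n F := by
  obtain ⟨C, R, hR, h⟩ := h u₀
  refine ⟨max C 0, max R 1, le_max_right _ _, le_max_right _ _, fun u r hu hr x hx => ?_⟩
  obtain ⟨h1, h2, h3, h4, h5⟩ := h u r hu ((le_max_left _ _).trans_lt hr) x hx
  have hr0 : 0 < r := hR.trans ((le_max_left _ _).trans_lt hr)
  have hC := le_max_left C 0
  refine ⟨h1.differentiableAt one_ne_zero, h2.trans (by gcongr), fun a b v => ?_⟩
  set L := fderiv ℝ (radialExtension F) (u, r, x)
  have hdec : (a, b, v) = a • ((1, 0, 0) : ℝ × ℝ × E3) + b • ((0, 1, 0) : ℝ × ℝ × E3)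
      + (0, 0, v) := by simp
  rw [hdec, map_add, map_add, map_smul, map_smul, smul_eq_mul, smul_eq_mul]
  rw [zpow_sub_one₀ hr0.ne'] at h4
  have hp : 0 < r ^ n := zpow_pos hr0 n
  calc |a * L (1, 0, 0) + b * L (0, 1, 0) + L (0, 0, v)|
      ≤ |a| * |L (1, 0, 0)| + |b| * |L (0, 1, 0)| + |L (0, 0, v)| := by
        rw [← abs_mul, ← abs_mul]
        exact (abs_add_le _ _).trans (by gcongr; exact abs_add_le _ _)
    _ ≤ |a| * (C * r ^ n) + |b| * (C * (r ^ n * r⁻¹)) + C * r ^ n * ‖v‖ := by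
        gcongr
        exact h5 v
    _ = C * (r ^ n * (|a| + |b| / r + ‖v‖)) := by rw [div_eq_mul_inv]; ring
    _ ≤ max C 0 * (r ^ n * (|a| + |b| / r + ‖v‖)) := by gcongr
    _ = _ := by ring

theorem BondiBounded.add {u₀ : ℝ} {n : ℤ} {F G : ℝ → ℝ → E3 → ℝ} (hF : BondiBounded u₀ n F)
    (hG : BondiBounded u₀ n G) : BondiBounded u₀ n fun u r x => F u r x + G u r x := by
  obtain ⟨C, R, hC, hR, hF⟩ := hF
  obtain ⟨C', R', hC', hR', hG⟩ := hG
  refine ⟨C + C', max R R', by positivity, hR.trans (le_max_left _ _), fun u r hu hr x hx => ?_⟩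
  obtain ⟨h1, h2, h3⟩ := hF u r hu ((le_max_left _ _).trans_lt hr) x hx
  obtain ⟨h1', h2', h3'⟩ := hG u r hu ((le_max_right _ _).trans_lt hr) x hx
  refine ⟨h1.add h1', ?_, fun a b v => ?_⟩
  · refine (abs_add_le _ _).trans ?_
    rw [add_mul]
    gcongr
  · have : fderiv ℝ (radialExtension fun u r x => F u r x + G u r x) (u, r, x)
        = fderiv ℝ (radialExtension F) (u, r, x) + fderiv ℝ (radialExtension G) (u, r, x) :=
      fderiv_add h1 h1'
    rw [this, add_apply]
    refine (abs_add_le _ _).trans ?_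
    rw [add_mul, add_mul]
    gcongr
    · exact h3 a b v
    · exact h3' a b v

theorem BondiBounded.mul {u₀ : ℝ} {n m : ℤ} {F G : ℝ → ℝ → E3 → ℝ} (hF : BondiBounded u₀ n F)
    (hG : BondiBounded u₀ m G) : BondiBounded u₀ (n + m) fun u r x => F u r x * G u r x := by
  obtain ⟨C, R, hC, hR, hF⟩ := hF
  obtain ⟨C', R', hC', hR', hG⟩ := hG
  refine ⟨2 * (C * C'), max R R', by positivity, hR.trans (le_max_left _ _),
    fun u r hu hr x hx => ?_⟩
  obtain ⟨h1, h2, h3⟩ := hF u r hu ((le_max_left _ _).trans_lt hr) x hx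
  obtain ⟨h1', h2', h3'⟩ := hG u r hu ((le_max_right _ _).trans_lt hr) x hx
  have hr0 : 0 < r := by linarith [(le_max_left R R').trans_lt hr]
  have hn : 0 < r ^ n := zpow_pos hr0 n
  have hm : 0 < r ^ m := zpow_pos hr0 m
  rw [zpow_add₀ hr0.ne']
  refine ⟨h1.mul h1', ?_, fun a b v => ?_⟩
  · rw [abs_mul]
    calc |F u r x| * |G u r x| ≤ (C * r ^ n) * (C' * r ^ m) := by gcongr
      _ = 1 * (C * C') * (r ^ n * r ^ m) := by ring
      _ ≤ 2 * (C * C') * (r ^ n * r ^ m) := by gcongr; norm_num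
  · have : fderiv ℝ (radialExtension fun u r x => F u r x * G u r x) (u, r, x)
        = radialExtension F (u, r, x) • fderiv ℝ (radialExtension G) (u, r, x)
          + radialExtension G (u, r, x) • fderiv ℝ (radialExtension F) (u, r, x) :=
      fderiv_mul h1 h1'
    rw [this, add_apply, smul_apply, smul_apply, smul_eq_mul, smul_eq_mul,
      radialExtension_of_norm_eq_one _ _ _ hx, radialExtension_of_norm_eq_one _ _ _ hx]
    set κ := |a| + |b| / r + ‖v‖
    have hκ : 0 ≤ κ := by positivity
    calc _ ≤ |F u r x| * |fderiv ℝ (radialExtension G) (u, r, x) (a, b, v)|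
          + |G u r x| * |fderiv ℝ (radialExtension F) (u, r, x) (a, b, v)| := by
          rw [← abs_mul, ← abs_mul]; exact abs_add_le _ _
      _ ≤ (C * r ^ n) * (C' * r ^ m * κ) + (C' * r ^ m) * (C * r ^ n * κ) := by
          gcongr
          · exact h3' a b v
          · exact h3 a b v
      _ = _ := by ring

theorem BondiBounded.mono {u₀ : ℝ} {n m : ℤ} {F : ℝ → ℝ → E3 → ℝ} (hF : BondiBounded u₀ n F)
    (h : n ≤ m) : BondiBounded u₀ m F := by
  obtain ⟨C, R, hC, hR, hF⟩ := hF
  refine ⟨C, R, hC, hR, fun u r hu hr x hx => ?_⟩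
  obtain ⟨h1, h2, h3⟩ := hF u r hu hr x hx
  have hr1 : 1 ≤ r := hR.trans hr.le
  have hr0 : 0 < r := by linarith
  have hp : r ^ n ≤ r ^ m := zpow_le_zpow_right₀ hr1 h
  refine ⟨h1, h2.trans (by gcongr), fun a b v => (h3 a b v).trans ?_⟩
  gcongr

/-- Together with products this allows the terms `m / r` and `r h1` of the expansions to be treated
as errors. -/
theorem bondiBounded_zpow (u₀ : ℝ) (k : ℤ) : BondiBounded u₀ k fun _ r _ => r ^ k := by
  refine ⟨max 1 |(k : ℝ)|, 1, le_max_of_le_left zero_le_one, le_rfl, fun u r _ hr x _ => ?_⟩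
  have hr0 : 0 < r := by linarith
  have hp : 0 < r ^ k := zpow_pos hr0 k
  have hd : HasFDerivAt (radialExtension fun _ r _ => r ^ k)
      ((k * r ^ (k - 1)) • (ContinuousLinearMap.fst ℝ ℝ E3 ∘L
        ContinuousLinearMap.snd ℝ ℝ (ℝ × E3))) (u, r, x) := by
    have hp0 : HasDerivAt (fun t : ℝ => t ^ k) (k * r ^ (k - 1))
        ((ContinuousLinearMap.fst ℝ ℝ E3 ∘L ContinuousLinearMap.snd ℝ ℝ (ℝ × E3)) (u, r, x)) :=
      hasDerivAt_zpow k r (Or.inl hr0.ne')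
    exact hp0.comp_hasFDerivAt (u, r, x)
      ((ContinuousLinearMap.fst ℝ ℝ E3 ∘L ContinuousLinearMap.snd ℝ ℝ (ℝ × E3)).hasFDerivAt)
  refine ⟨hd.differentiableAt, ?_, fun a b v => ?_⟩
  · rw [abs_of_pos hp]
    exact le_mul_of_one_le_left hp.le (le_max_left _ _)
  · rw [hd.fderiv]
    simp only [smul_apply, ContinuousLinearMap.comp_apply, ContinuousLinearMap.coe_snd',
      ContinuousLinearMap.coe_fst', smul_eq_mul]
    rw [zpow_sub_one₀ hr0.ne', abs_mul, abs_mul, abs_mul, abs_of_pos hp, abs_of_pos (inv_pos.2 hr0)]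
    calc |(k : ℝ)| * (r ^ k * r⁻¹) * |b| = |(k : ℝ)| * r ^ k * (|b| / r) := by
          rw [div_eq_mul_inv]; ring
      _ ≤ max 1 |(k : ℝ)| * r ^ k * (|a| + |b| / r + ‖v‖) := by
          gcongr
          · exact le_max_right _ _
          · linarith [abs_nonneg a, norm_nonneg v]

/-- Differentiation along a curve of a function with Bondi bounds. -/
theorem BondiBound.hasDerivAt {u₀ R C : ℝ} {n : ℤ} {F : ℝ → ℝ → E3 → ℝ}
    (h : BondiBound u₀ R C n F) {us rs : ℝ → ℝ} {xs : ℝ → E3} {u' r' : ℝ} {x' : E3} {s : ℝ}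
    (hus : HasDerivAt us u' s) (hrs : HasDerivAt rs r' s) (hxs : HasDerivAt xs x' s)
    (hx : ∀ᶠ t in 𝓝 s, ‖xs t‖ = 1) (hu : u₀ ≤ us s) (hr : R < rs s) :
    ∃ d, HasDerivAt (fun t => F (us t) (rs t) (xs t)) d s ∧
      |d| ≤ C * rs s ^ n * (|u'| + |r'| / rs s + ‖x'‖) := by
  obtain ⟨h1, -, h3⟩ := h (us s) (rs s) hu hr (xs s) hx.self_of_nhds
  refine ⟨_, ?_, h3 u' r' x'⟩
  have h4 := h1.hasFDerivAt.comp_hasDerivAt s (hus.prodMk (hrs.prodMk hxs))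
  refine h4.congr_of_eventuallyEq ?_
  filter_upwards [hx] with t ht
  exact (radialExtension_of_norm_eq_one _ _ _ ht).symm

theorem tangentialPart_of_inner_eq_zero {x a : E3} (h : inner ℝ x a = 0) :
    tangentialPart x a = a := by
  simp [tangentialPart, h]

/-- The projections of the three basis vectors span each tangent plane redundantly but globally,
which avoids frames or charts on the sphere. -/
theorem sum_smul_tangentialPart {x v : E3} (h : inner ℝ x v = 0) :
    ∑ i, v i • tangentialPart x (EuclideanSpace.single i 1) = v := by
  have h1 : ∑ i, v i • (EuclideanSpace.single i (1 : ℝ) : E3) = v := by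
    have := (EuclideanSpace.basisFun (Fin 3) ℝ).sum_repr v
    simpa using this
  have h2 : ∑ i, v i • tangentialPart x (EuclideanSpace.single i 1)
      = tangentialPart x (∑ i, v i • (EuclideanSpace.single i (1 : ℝ) : E3)) := by
    simp only [tangentialPart, smul_sub, Finset.sum_sub_distrib, inner_sum, inner_smul_right,
      Finset.sum_smul, smul_smul]
  rw [h2, h1, tangentialPart_of_inner_eq_zero h]

/-- The standard basis vectors. -/
noncomputable abbrev basisE3 (i : Fin 3) : E3 := EuclideanSpace.single i 1

theorem sum_sum_mul_mul_inner_tangentialPart {x v w : E3} (hv : inner ℝ x v = 0)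
    (hw : inner ℝ x w = 0) :
    ∑ i, ∑ j, v i * w j * inner ℝ (tangentialPart x (basisE3 i)) (tangentialPart x (basisE3 j))
      = inner ℝ v w := by
  conv_rhs => rw [← sum_smul_tangentialPart hv, ← sum_smul_tangentialPart hw]
  rw [sum_inner]
  refine Finset.sum_congr rfl fun i _ => ?_
  rw [inner_sum]
  refine Finset.sum_congr rfl fun j _ => ?_
  rw [inner_smul_left, inner_smul_right, conj_trivial, mul_assoc]

/-! ### The metric near future null infinity in polar components. -/

namespace Spacetime

variable {M : Type*} [TopologicalSpace M] [ChartedSpace E4 M] [IsManifold (𝓡 4) ∞ M]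
variable {S : Spacetime M}

namespace BondiChart

/-- Uniform bounds on the deviation of the metric from the flat one, for `u ≥ u₀`, `r > R`. -/
structure ScriBounds (B : S.BondiChart) (u₀ R C : ℝ) : Prop where
  one_le : 1 ≤ R
  nonneg : 0 ≤ C
  mem : ∀ u r : ℝ, u₀ ≤ u → R < r → ∀ x : E3, ‖x‖ = 1 → bondiPoint u (r • x) ∈ B.chart.target
  future : ∀ u r : ℝ, u₀ ≤ u → R < r → ∀ x : E3, ‖x‖ = 1 →
    S.FutureCausal (B.chart.symm (bondiPoint u (r • x)))
      (mfderiv (𝓡 4) (𝓡 4) B.chart.symm (bondiPoint u (r • x)) (bondiPoint 1 0))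
  grr : ∀ u r : ℝ, u₀ ≤ u → R < r → ∀ x : E3, ‖x‖ = 1 → S.grr B.chart u r x = 0
  grA : ∀ u r : ℝ, u₀ ≤ u → R < r → ∀ x : E3, ‖x‖ = 1 → ∀ v : E3, inner ℝ x v = 0 →
    S.grA B.chart u r x v = 0
  guu : BondiBound u₀ R C (-1) fun u r x => S.guu B.chart u r x + 1
  gur : BondiBound u₀ R C (-2) fun u r x => S.gur B.chart u r x + 1
  guA : ∀ i : Fin 3, BondiBound u₀ R C 0 fun u r x =>
    S.guA B.chart u r x (tangentialPart x (basisE3 i))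
  gAB : ∀ i j : Fin 3, BondiBound u₀ R C 1 fun u r x =>
    S.gAB B.chart u r x (tangentialPart x (basisE3 i)) (tangentialPart x (basisE3 j))
      - inner ℝ (tangentialPart x (basisE3 i)) (tangentialPart x (basisE3 j)) * r ^ 2

/-- Only the leading behaviour matters for the estimates: `m / r` is absorbed into an error of order
`-1` in `g_uu`, and `r h1` into one of order `1` in `g_AB`. Finitely many nonnegative constants are
merged by adding them. -/
theorem exists_scriBounds (B : S.BondiChart) (u₀ : ℝ) : ∃ R C, B.ScriBounds u₀ R C := by
  obtain ⟨R₁, h1, mem⟩ := B.domain u₀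
  obtain ⟨R₂, h2, fut⟩ := B.future u₀
  obtain ⟨R₃, h3, grr⟩ := B.grr_zero u₀
  obtain ⟨R₄, h4, grA⟩ := B.grA_zero u₀
  obtain ⟨C₅, R₅, hC5, h5, guu⟩ : BondiBounded u₀ (-1) fun u r x => S.guu B.chart u r x + 1 := by
    have := ((B.guu_expansion.bondiBounded u₀).mono (by norm_num : (-2 : ℤ) ≤ 0 + (-1))).add
      ((B.m_regular.bondiBounded u₀).mul (bondiBounded_zpow u₀ (-1)))
    rw [zero_add] at this
    refine (congrArg (BondiBounded u₀ (-1)) ?_).mp this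
    funext u r x
    rw [zpow_neg_one]; ring
  obtain ⟨C₆, R₆, hC6, h6, gur⟩ : BondiBounded u₀ (-2) fun u r x => S.gur B.chart u r x + 1 := by
    simpa using B.gur_expansion.bondiBounded u₀
  choose C₇ R₇ hC7 h7 guA using fun i : Fin 3 =>
    (B.guA_expansion (basisE3 i)).bondiBounded u₀
  have hAB : ∀ i j : Fin 3, BondiBounded u₀ 1 fun u r x =>
      S.gAB B.chart u r x (tangentialPart x (basisE3 i)) (tangentialPart x (basisE3 j))
      - inner ℝ (tangentialPart x (basisE3 i)) (tangentialPart x (basisE3 j)) * r ^ 2 := by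
    intro i j
    have := (((B.gAB_expansion (basisE3 i) (basisE3 j)).bondiBounded u₀).mono
      (by norm_num : (0 : ℤ) ≤ 0 + 1)).add
      (((B.h1_regular (basisE3 i) (basisE3 j)).bondiBounded u₀).mul (bondiBounded_zpow u₀ 1))
    rw [zero_add] at this
    refine (congrArg (BondiBounded u₀ 1) ?_).mp this
    funext u r x
    rw [zpow_one]; ring
  choose C₈ R₈ hC8 h8 gAB using hAB
  have s7 : ∀ i, C₇ i ≤ ∑ i, C₇ i := fun i =>
    Finset.single_le_sum (fun j _ => hC7 j) (Finset.mem_univ i)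
  have s7' : ∀ i, R₇ i ≤ ∑ i, R₇ i := fun i =>
    Finset.single_le_sum (fun j _ => zero_le_one.trans (h7 j)) (Finset.mem_univ i)
  have s8 : ∀ i j, C₈ i j ≤ ∑ i, ∑ j, C₈ i j := fun i j =>
    (Finset.single_le_sum (fun j _ => hC8 i j) (Finset.mem_univ j)).trans
      (Finset.single_le_sum (f := fun i => ∑ j, C₈ i j)
        (fun i _ => Finset.sum_nonneg fun j _ => hC8 i j) (Finset.mem_univ i))
  have s8' : ∀ i j, R₈ i j ≤ ∑ i, ∑ j, R₈ i j := fun i j =>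
    (Finset.single_le_sum (fun j _ => zero_le_one.trans (h8 i j)) (Finset.mem_univ j)).trans
      (Finset.single_le_sum (f := fun i => ∑ j, R₈ i j)
        (fun i _ => Finset.sum_nonneg fun j _ => zero_le_one.trans (h8 i j)) (Finset.mem_univ i))
  have n7 := (hC7 0).trans (s7 0)
  have n7' := (zero_le_one.trans (h7 0)).trans (s7' 0)
  have n8 := (hC8 0 0).trans (s8 0 0)
  have n8' := (zero_le_one.trans (h8 0 0)).trans (s8' 0 0)
  set R := R₁ + R₂ + R₃ + R₄ + R₅ + R₆ + (∑ i, R₇ i) + ∑ i, ∑ j, R₈ i j with hR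
  set C := C₅ + C₆ + (∑ i, C₇ i) + ∑ i, ∑ j, C₈ i j with hC
  refine ⟨R, C, by linarith, by linarith,
    fun u r hu hr => mem u r hu (by linarith), fun u r hu hr => fut u r hu (by linarith),
    fun u r hu hr => grr u r hu (by linarith), fun u r hu hr => grA u r hu (by linarith),
    guu.mono (by linarith) (by linarith) (by linarith),
    gur.mono (by linarith) (by linarith) (by linarith),
    fun i => (guA i).mono (by linarith [h7 i]) (by linarith [s7' i]) (by linarith [s7 i]),
    fun i j => (gAB i j).mono (by linarith [h8 i j]) (by linarith [s8' i j])
      (by linarith [s8 i j])⟩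

/-- The deviation of the metric from the flat one, in terms of polar components. -/
noncomputable def deviation (B : S.BondiChart) (z v w : E4) : ℝ :=
  (S.guu B.chart (z 0) (polarR z) (polarX z) + 1) * (v 0 * w 0)
    + (S.gur B.chart (z 0) (polarR z) (polarX z) + 1) * (v 0 * polarRho z w + polarRho z v * w 0)
    + (∑ i, S.guA B.chart (z 0) (polarR z) (polarX z) (tangentialPart (polarX z) (basisE3 i))
        * (v 0 * polarXi z w i + polarXi z v i * w 0))
    + ∑ i, ∑ j, (S.gAB B.chart (z 0) (polarR z) (polarX z)
          (tangentialPart (polarX z) (basisE3 i)) (tangentialPart (polarX z) (basisE3 j))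
        - inner ℝ (tangentialPart (polarX z) (basisE3 i)) (tangentialPart (polarX z) (basisE3 j))
          * polarR z ^ 2) * (polarXi z v i * polarXi z w j)

/-- The region near future null infinity where the bounds hold. -/
def region (u₀ R : ℝ) : Set E4 := {z | u₀ < z 0 ∧ R < polarR z}

theorem isOpen_region (u₀ R : ℝ) : IsOpen (region u₀ R) := by
  have h1 : Continuous fun z : E4 => z 0 := (EuclideanSpace.proj (0 : Fin 4)).continuous
  have h2 : Continuous fun z : E4 => polarR z := spatialCLM.continuous.norm
  exact (isOpen_lt continuous_const h1).inter (isOpen_lt continuous_const h2)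

variable {B : S.BondiChart} {u₀ R C : ℝ}

namespace ScriBounds

theorem polarR_pos (hB : B.ScriBounds u₀ R C) {z : E4} (hz : z ∈ region u₀ R) : 0 < polarR z := by
  linarith [hB.one_le, hz.2]

theorem mem_target (hB : B.ScriBounds u₀ R C) {z : E4} (hz : z ∈ region u₀ R) :
    z ∈ B.chart.target := by
  have h0 := hB.polarR_pos hz
  rw [← bondiPoint_polar h0]
  exact hB.mem _ _ hz.1.le hz.2 _ (norm_polarX h0)

theorem future_mem (hB : B.ScriBounds u₀ R C) {z : E4} (hz : z ∈ region u₀ R) :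
    S.FutureCausal (B.chart.symm z)
      (mfderiv (𝓡 4) (𝓡 4) B.chart.symm z (bondiPoint 1 0)) := by
  have h0 := hB.polarR_pos hz
  have h := hB.future _ _ hz.1.le hz.2 _ (norm_polarX h0)
  rwa [bondiPoint_polar h0] at h

/-- The explicit part is the flat metric `-du² - 2 du dr + r² ω`. Because `g_rr = g_rA = 0`, the
deviation contains neither a square of the radial component nor a radial-angular product; such terms
could not be controlled by `errorSize`. -/
theorem chartMetric_eq (hB : B.ScriBounds u₀ R C) {z : E4} (hz : z ∈ region u₀ R) (v w : E4) :
    S.chartMetric B.chart z v w = -(v 0 * w 0) - (v 0 * polarRho z w + polarRho z v * w 0)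
      + polarR z ^ 2 * inner ℝ (polarXi z v) (polarXi z w) + B.deviation z v w := by
  have h0 := hB.polarR_pos hz
  have hx := norm_polarX h0
  set G := S.chartMetric B.chart z with hG
  set x := polarX z with hxdef
  set r := polarR z with hr
  have hz' : bondiPoint (z 0) (r • x) = z := bondiPoint_polar h0
  have hdec : ∀ v : E4, v = v 0 • bondiPoint 1 0 + polarRho z v • spaceCLM x
      + spaceCLM (r • polarXi z v) := by
    intro v
    conv_lhs => rw [← bondiPoint_spatialPart v, bondiPoint_eq, spatialPart_eq_polar h0 v]
    rw [← spaceCLM_apply, map_add, map_smul, add_assoc]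
  have hsum : ∀ v : E4, spaceCLM (r • polarXi z v)
      = ∑ i, polarXi z v i • spaceCLM (r • tangentialPart x (basisE3 i)) := by
    intro v
    conv_lhs => rw [← sum_smul_tangentialPart (inner_polarX_polarXi h0 v)]
    rw [Finset.smul_sum, map_sum]
    refine Finset.sum_congr rfl fun i _ => ?_
    rw [smul_comm, map_smul]
  have hguu : G (bondiPoint 1 0) (bondiPoint 1 0) = S.guu B.chart (z 0) r x := by
    rw [Spacetime.guu, hz']; rfl
  have hgur : G (bondiPoint 1 0) (spaceCLM x) = S.gur B.chart (z 0) r x := by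
    rw [Spacetime.gur, hz']; rfl
  have hgru : G (spaceCLM x) (bondiPoint 1 0) = S.gur B.chart (z 0) r x := by
    rw [hG, S.chartMetric_symm]; exact hgur
  have hgrr : G (spaceCLM x) (spaceCLM x) = 0 := by
    rw [← hB.grr (z 0) r hz.1.le hz.2 x hx, Spacetime.grr, hz']; rfl
  have hguA : ∀ a, G (bondiPoint 1 0) (spaceCLM (r • a)) = S.guA B.chart (z 0) r x a := by
    intro a; rw [Spacetime.guA, hz']; rfl
  have hgAu : ∀ a, G (spaceCLM (r • a)) (bondiPoint 1 0) = S.guA B.chart (z 0) r x a := by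
    intro a; rw [hG, S.chartMetric_symm]; exact hguA a
  have hgrA : ∀ v, G (spaceCLM x) (spaceCLM (r • polarXi z v)) = 0 := by
    intro v
    rw [← hB.grA (z 0) r hz.1.le hz.2 x hx _ (inner_polarX_polarXi h0 v), Spacetime.grA, hz']; rfl
  have hgAr : ∀ v, G (spaceCLM (r • polarXi z v)) (spaceCLM x) = 0 := by
    intro v; rw [hG, S.chartMetric_symm]; exact hgrA v
  have hgAB : ∀ a b, G (spaceCLM (r • a)) (spaceCLM (r • b)) = S.gAB B.chart (z 0) r x a b := by
    intro a b; rw [Spacetime.gAB, hz']; rfl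
  have hguA' : ∀ v, G (bondiPoint 1 0) (spaceCLM (r • polarXi z v))
      = ∑ i, polarXi z v i * S.guA B.chart (z 0) r x (tangentialPart x (basisE3 i)) := by
    intro v
    rw [hsum v, map_sum]
    refine Finset.sum_congr rfl fun i _ => ?_
    rw [map_smul, smul_eq_mul, hguA]
  have hgAu' : ∀ v, G (spaceCLM (r • polarXi z v)) (bondiPoint 1 0)
      = ∑ i, polarXi z v i * S.guA B.chart (z 0) r x (tangentialPart x (basisE3 i)) := by
    intro v; rw [hG, S.chartMetric_symm]; exact hguA' v
  have hgAB' : G (spaceCLM (r • polarXi z v)) (spaceCLM (r • polarXi z w))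
      = ∑ i, ∑ j, S.gAB B.chart (z 0) r x (tangentialPart x (basisE3 i))
          (tangentialPart x (basisE3 j)) * (polarXi z v i * polarXi z w j) := by
    rw [hsum v, map_sum, sum_apply]
    refine Finset.sum_congr rfl fun i _ => ?_
    rw [hsum w, map_sum]
    refine Finset.sum_congr rfl fun j _ => ?_
    rw [map_smul, map_smul, smul_apply, hgAB, smul_eq_mul, smul_eq_mul]
    ring
  have hinner : r ^ 2 * inner ℝ (polarXi z v) (polarXi z w)
      = ∑ i, ∑ j, inner ℝ (tangentialPart x (basisE3 i)) (tangentialPart x (basisE3 j))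
          * r ^ 2 * (polarXi z v i * polarXi z w j) := by
    rw [← sum_sum_mul_mul_inner_tangentialPart (inner_polarX_polarXi h0 v)
      (inner_polarX_polarXi h0 w), Finset.mul_sum]
    refine Finset.sum_congr rfl fun i _ => ?_
    rw [Finset.mul_sum]
    refine Finset.sum_congr rfl fun j _ => ?_
    ring
  have hrv := hgrA w
  have hvr := hgAr v
  have huw := hguA' w
  have hvu := hgAu' v
  have hv := hdec v
  have hw := hdec w
  generalize spaceCLM (r • polarXi z v) = a at hrv hvr huw hvu hgAB' hv hw
  generalize spaceCLM (r • polarXi z w) = b at hrv hvr huw hvu hgAB' hv hw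
  conv_lhs => rw [hv, hw]
  simp only [map_add, add_apply, map_smul, smul_apply, smul_eq_mul, hguu, hgur, hgru, hgrr, hrv,
    hvr, huw, hvu, hgAB']
  rw [hinner, deviation]
  simp only [sub_mul, Finset.sum_sub_distrib, mul_add, Finset.sum_add_distrib]
  have e1 : ∀ w : E4, ∀ c : ℝ, c * ∑ i, polarXi z w i
        * S.guA B.chart (z 0) r x (tangentialPart x (basisE3 i))
      = ∑ i, S.guA B.chart (z 0) r x (tangentialPart x (basisE3 i)) * (c * polarXi z w i) := by
    intro w c
    rw [Finset.mul_sum]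
    exact Finset.sum_congr rfl fun i _ => by ring
  rw [e1 w, e1 v]
  have e2 : ∑ i, S.guA B.chart (z 0) r x (tangentialPart x (basisE3 i)) * (w 0 * polarXi z v i)
      = ∑ i, S.guA B.chart (z 0) r x (tangentialPart x (basisE3 i)) * (polarXi z v i * w 0) :=
    Finset.sum_congr rfl fun i _ => by ring
  rw [e2]
  ring

end ScriBounds

end BondiChart

end Spacetime

/-! ### Infinitesimal rotations. -/

theorem abs_sum_fin_three_le {f : Fin 3 → ℝ} {c : ℝ} (h : ∀ i, |f i| ≤ c) :
    |∑ i, f i| ≤ 3 * c := by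
  rw [Fin.sum_univ_three]
  have h1 := abs_add_le (f 0 + f 1) (f 2)
  have h2 := abs_add_le (f 0) (f 1)
  linarith [h 0, h 1, h 2]

theorem abs_apply_le_norm (v : E3) (i : Fin 3) : |v i| ≤ ‖v‖ := by
  simpa using PiLp.norm_apply_le v i

/-- The infinitesimal rotation about the `k`-th axis. -/
noncomputable def axisRotation (k : Fin 3) : E3 →L[ℝ] E3 :=
  (EuclideanSpace.proj (k + 2) : E3 →L[ℝ] ℝ).smulRight (basisE3 (k + 1))
    - (EuclideanSpace.proj (k + 1) : E3 →L[ℝ] ℝ).smulRight (basisE3 (k + 2))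

theorem axisRotation_apply (k : Fin 3) (v : E3) :
    axisRotation k v = v (k + 2) • basisE3 (k + 1) - v (k + 1) • basisE3 (k + 2) := rfl

theorem inner_axisRotation (k : Fin 3) (v w : E3) :
    inner ℝ v (axisRotation k w) = w (k + 2) * v (k + 1) - w (k + 1) * v (k + 2) := by
  rw [axisRotation_apply, inner_sub_right, inner_smul_right, inner_smul_right]
  simp [EuclideanSpace.inner_single_right]

theorem inner_axisRotation_self (k : Fin 3) (v : E3) : inner ℝ v (axisRotation k v) = 0 := by
  rw [inner_axisRotation]; ring

theorem inner_axisRotation_skew (k : Fin 3) (v w : E3) :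
    inner ℝ (axisRotation k v) w = -inner ℝ v (axisRotation k w) := by
  rw [real_inner_comm, inner_axisRotation, inner_axisRotation]; ring

/-- Lagrange's identity: up to sign the summands are the squared components of the cross product of
`v` and `w`. -/
theorem sum_inner_axisRotation_sq {v w : E3} (h : inner ℝ v w = 0) :
    ∑ k, inner ℝ v (axisRotation k w) ^ 2 = ‖v‖ ^ 2 * ‖w‖ ^ 2 := by
  have h1 : inner ℝ v w = v 0 * w 0 + v 1 * w 1 + v 2 * w 2 := by
    simp [PiLp.inner_apply, Fin.sum_univ_three]; ring
  rw [h1] at h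
  simp only [inner_axisRotation, EuclideanSpace.norm_sq_eq, Fin.sum_univ_three, Real.norm_eq_abs,
    sq_abs]
  simp only [Fin.isValue, zero_add, show (1 : Fin 3) + 2 = 0 from rfl,
    show (1 : Fin 3) + 1 = 2 from rfl, show (2 : Fin 3) + 2 = 1 from rfl,
    show (2 : Fin 3) + 1 = 0 from rfl]
  linear_combination (-(v 0 * w 0 + v 1 * w 1 + v 2 * w 2)) * h

theorem norm_axisRotation_le (k : Fin 3) (v : E3) : ‖axisRotation k v‖ ≤ ‖v‖ := by
  refine (sq_le_sq₀ (norm_nonneg _) (norm_nonneg _)).1 ?_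
  rw [← real_inner_self_eq_norm_sq, inner_axisRotation, axisRotation_apply]
  simp only [EuclideanSpace.norm_sq_eq, Fin.sum_univ_three, Real.norm_eq_abs, sq_abs]
  fin_cases k <;> simp <;>
    nlinarith [sq_nonneg (v 0), sq_nonneg (v 1), sq_nonneg (v 2)]

/-! ### Error estimates for the metric and its variations. -/

namespace Spacetime

variable {M : Type*} [TopologicalSpace M] [ChartedSpace E4 M] [IsManifold (𝓡 4) ∞ M]
variable {S : Spacetime M}

namespace BondiChart

variable {B : S.BondiChart} {u₀ R C : ℝ}

namespace ScriBounds

theorem coefficient_bounds (hB : B.ScriBounds u₀ R C) {z : E4} (hz : z ∈ region u₀ R) :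
    |S.guu B.chart (z 0) (polarR z) (polarX z) + 1| ≤ C / polarR z ∧
    |S.gur B.chart (z 0) (polarR z) (polarX z) + 1| ≤ C / polarR z ^ 2 ∧
    (∀ i, |S.guA B.chart (z 0) (polarR z) (polarX z)
      (tangentialPart (polarX z) (basisE3 i))| ≤ C) ∧
    (∀ i j, |S.gAB B.chart (z 0) (polarR z) (polarX z)
          (tangentialPart (polarX z) (basisE3 i)) (tangentialPart (polarX z) (basisE3 j))
        - inner ℝ (tangentialPart (polarX z) (basisE3 i)) (tangentialPart (polarX z) (basisE3 j))
          * polarR z ^ 2| ≤ C * polarR z) := by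
  have h0 := hB.polarR_pos hz
  have hx := norm_polarX h0
  refine ⟨?_, ?_, fun i => ?_, fun i j => ?_⟩
  · have := (hB.guu _ _ hz.1.le hz.2 _ hx).2.1
    rwa [zpow_neg_one, ← div_eq_mul_inv] at this
  · have := (hB.gur _ _ hz.1.le hz.2 _ hx).2.1
    rwa [zpow_neg, ← div_eq_mul_inv, zpow_ofNat] at this
  · have := (hB.guA i _ _ hz.1.le hz.2 _ hx).2.1
    rwa [zpow_zero, mul_one] at this
  · have := (hB.gAB i j _ _ hz.1.le hz.2 _ hx).2.1
    rwa [zpow_one] at this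

/-- Only `g_ur` contributes, since `∂_r` is orthogonal to itself and to the sphere. This makes the
radial momentum agree with the `u`-component to second order in `1/r`. -/
theorem abs_chartMetric_radial (hB : B.ScriBounds u₀ R C) {z : E4} (hz : z ∈ region u₀ R)
    (v : E4) :
    |S.chartMetric B.chart z v (bondiPoint 0 (polarX z)) + v 0| ≤ C / polarR z ^ 2 * |v 0| := by
  have h0 := hB.polarR_pos hz
  rw [hB.chartMetric_eq hz, deviation, polarRho_radial h0, polarXi_radial h0]
  simp only [bondiPoint_zero_apply, inner_zero_right, PiLp.zero_apply, mul_zero, mul_one,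
    Finset.sum_const_zero, add_zero]
  have : ∀ a : ℝ, -0 - v 0 + (0 + a * v 0) + v 0 = a * v 0 := fun a => by ring
  rw [this, abs_mul]
  gcongr
  exact (hB.coefficient_bounds hz).2.1

theorem abs_chartMetric_time (hB : B.ScriBounds u₀ R C) {z : E4} (hz : z ∈ region u₀ R)
    (v : E4) :
    |S.chartMetric B.chart z v (bondiPoint 1 0) + v 0 + polarRho z v|
      ≤ C / polarR z * |v 0| + C / polarR z ^ 2 * |polarRho z v| + 3 * (C * ‖polarXi z v‖) := by
  have h0 := hB.polarR_pos hz
  have hin : inner ℝ (polarX z) (0 : E3) = 0 := inner_zero_right _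
  obtain ⟨h1, h2, h3, -⟩ := hB.coefficient_bounds hz
  rw [hB.chartMetric_eq hz, deviation, polarRho_tangent h0 hin, polarXi_tangent h0 hin]
  simp only [bondiPoint_zero_apply, inner_zero_right, PiLp.zero_apply, mul_zero, mul_one,
    Finset.sum_const_zero, add_zero, smul_zero, zero_add]
  have : ∀ a b c : ℝ, -v 0 - polarRho z v + (a * v 0 + b * polarRho z v + c) + v 0 + polarRho z v
    = a * v 0 + b * polarRho z v + c := fun a b c => by ring
  rw [this]
  refine (abs_add_le _ _).trans (add_le_add ((abs_add_le _ _).trans (add_le_add ?_ ?_)) ?_)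
  · rw [abs_mul]; gcongr
  · rw [abs_mul]; gcongr
  · refine abs_sum_fin_three_le fun i => ?_
    rw [abs_mul]
    have hC := hB.nonneg
    gcongr
    · exact h3 i
    · exact abs_apply_le_norm _ i

theorem abs_chartMetric_tangent (hB : B.ScriBounds u₀ R C) {z : E4} (hz : z ∈ region u₀ R)
    (v : E4) {a : E3} (ha : inner ℝ (polarX z) a = 0) (ha1 : ‖a‖ ≤ 1) :
    |S.chartMetric B.chart z v (bondiPoint 0 (polarR z • a))
        - polarR z ^ 2 * inner ℝ (polarXi z v) a|
      ≤ 3 * (C * |v 0|) + 9 * (C * (polarR z * ‖polarXi z v‖)) := by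
  have h0 := hB.polarR_pos hz
  have hC := hB.nonneg
  have hin : inner ℝ (polarX z) (polarR z • a) = 0 := by rw [inner_smul_right, ha, mul_zero]
  obtain ⟨-, -, h3, h4⟩ := hB.coefficient_bounds hz
  rw [hB.chartMetric_eq hz, deviation, polarRho_tangent h0 hin, polarXi_tangent h0 hin,
    smul_smul, inv_mul_cancel₀ h0.ne', one_smul]
  simp only [bondiPoint_zero_apply, mul_zero, add_zero, zero_add, sub_zero, neg_zero]
  rw [add_sub_cancel_left]
  refine (abs_add_le _ _).trans (add_le_add ?_ ?_)
  · refine abs_sum_fin_three_le fun i => ?_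
    rw [abs_mul, abs_mul]
    calc _ ≤ C * (|v 0| * 1) := by
          gcongr
          · exact h3 i
          · exact (abs_apply_le_norm _ i).trans ha1
      _ = _ := by ring
  · rw [show (9 : ℝ) = 3 * 3 by norm_num, mul_assoc]
    refine abs_sum_fin_three_le fun i => abs_sum_fin_three_le fun j => ?_
    rw [abs_mul, abs_mul]
    calc _ ≤ (C * polarR z) * (‖polarXi z v‖ * 1) := by
          gcongr
          · exact h4 i j
          · exact abs_apply_le_norm _ i
          · exact (abs_apply_le_norm _ j).trans ha1
      _ = _ := by ring

/-- The quadratic expression that controls all errors. -/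
noncomputable def errorSize (z v : E4) : ℝ :=
  v 0 ^ 2 + |v 0 * polarRho z v| / polarR z + |v 0| * (polarR z * ‖polarXi z v‖)
    + (polarR z * ‖polarXi z v‖) ^ 2

/-- The factor `9` counts the pairs of angular indices, which give the largest contribution. -/
theorem abs_chartMetric_self (hB : B.ScriBounds u₀ R C) {z : E4} (hz : z ∈ region u₀ R)
    (v : E4) :
    |S.chartMetric B.chart z v v
        - (-(v 0 ^ 2) - 2 * (v 0 * polarRho z v) + (polarR z * ‖polarXi z v‖) ^ 2)|
      ≤ 9 * C / polarR z * errorSize z v := by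
  have h0 := hB.polarR_pos hz
  have hC := hB.nonneg
  obtain ⟨h1, h2, h3, h4⟩ := hB.coefficient_bounds hz
  rw [hB.chartMetric_eq hz, deviation, real_inner_self_eq_norm_sq]
  set y := v 0
  set ρ := polarRho z v
  set r := polarR z
  set m := ‖polarXi z v‖
  have hm : 0 ≤ m := norm_nonneg _
  have hξ : ∀ i, |polarXi z v i| ≤ m := fun i => abs_apply_le_norm _ i
  have : ∀ a b c d : ℝ, -(y * y) - (y * ρ + ρ * y) + r ^ 2 * m ^ 2 + (a + b + c + d)
      - (-(y ^ 2) - 2 * (y * ρ) + (r * m) ^ 2) = a + b + c + d := fun a b c d => by ring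
  rw [this]
  have e1 : |(S.guu B.chart (z 0) r (polarX z) + 1) * (y * y)| ≤ C / r * y ^ 2 := by
    rw [abs_mul, abs_mul_self, ← sq]; gcongr
  have e2 : |(S.gur B.chart (z 0) r (polarX z) + 1) * (y * ρ + ρ * y)|
      ≤ C / r ^ 2 * (2 * |y * ρ|) := by
    rw [abs_mul, show y * ρ + ρ * y = 2 * (y * ρ) by ring, abs_mul 2, abs_two]; gcongr
  have e3 : |∑ i, S.guA B.chart (z 0) r (polarX z) (tangentialPart (polarX z) (basisE3 i))
        * (y * polarXi z v i + polarXi z v i * y)| ≤ 3 * (C * (2 * (|y| * m))) := by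
    refine abs_sum_fin_three_le fun i => ?_
    rw [abs_mul, show y * polarXi z v i + polarXi z v i * y = 2 * (y * polarXi z v i) by ring,
      abs_mul 2, abs_two, abs_mul y]
    gcongr
    · exact h3 i
    · exact hξ i
  have e4 : |∑ i, ∑ j, (S.gAB B.chart (z 0) r (polarX z)
          (tangentialPart (polarX z) (basisE3 i)) (tangentialPart (polarX z) (basisE3 j))
        - inner ℝ (tangentialPart (polarX z) (basisE3 i)) (tangentialPart (polarX z) (basisE3 j))
          * r ^ 2) * (polarXi z v i * polarXi z v j)| ≤ 3 * (3 * (C * r * (m * m))) := by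
    refine abs_sum_fin_three_le fun i => abs_sum_fin_three_le fun j => ?_
    rw [abs_mul, abs_mul]
    gcongr
    · exact h4 i j
    · exact hξ i
    · exact hξ j
  refine ((abs_add_le _ _).trans (add_le_add ((abs_add_le _ _).trans
    (add_le_add ((abs_add_le _ _).trans (add_le_add e1 e2)) e3)) e4)).trans ?_
  have hexp : 9 * C / r * errorSize z v
      = 9 * (C / r * y ^ 2) + 9 / 2 * (C / r ^ 2 * (2 * |y * ρ|)) + 9 * (C * (|y| * m))
        + 3 * (3 * (C * r * (m * m))) := by
    have e : errorSize z v = y ^ 2 + |y * ρ| / r + |y| * (r * m) + (r * m) ^ 2 := rfl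
    rw [e]
    field_simp
    ring
  rw [hexp]
  have p1 : 0 ≤ C / r * y ^ 2 := by positivity
  have p2 : 0 ≤ C / r ^ 2 * (2 * |y * ρ|) := by positivity
  have p3 : 0 ≤ C * (|y| * m) := by positivity
  linarith

/-- The derivative of the metric along a variation that keeps the `u`- and `r`-components of the
velocity fixed to first order. -/
theorem abs_variation_le (hB : B.ScriBounds u₀ R C) {z : E4} (hz : z ∈ region u₀ R)
    {v W W' : E4} {ξ' : E3} {κ : ℝ} (hκ : 0 ≤ κ) (hW' : W' 0 = 0)
    (hρ : polarRho z W' + inner ℝ (polarXi z W) (spatialPart v) = 0)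
    (hξ : (polarR z)⁻¹ • (spatialPart W' - polarRho z v • polarXi z W
      - polarRho z W • polarXi z v) = ξ')
    (hu : |W 0| ≤ κ) (hr : |polarRho z W| ≤ κ * polarR z) (hx : ‖polarXi z W‖ ≤ κ)
    (hξ' : ‖ξ'‖ ≤ κ * ‖polarXi z v‖) :
    |fderiv ℝ (S.chartMetric B.chart) z W v v + 2 * S.chartMetric B.chart z v W'
        - (2 * polarR z * polarRho z W * ‖polarXi z v‖ ^ 2
          + 2 * polarR z ^ 2 * inner ℝ (polarXi z v) ξ')|
      ≤ 45 * C * κ / polarR z * errorSize z v := by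
  have h0 := hB.polarR_pos hz
  have hC := hB.nonneg
  obtain ⟨h1, h2, h3, h4⟩ := hB.coefficient_bounds hz
  -- The quantity to be estimated is the derivative at `0` of the norm of `v + s W'` at the point `z
  -- + s W`. By the hypotheses on `W'` the `u`- and `r`-components are stationary there and the
  -- angular component changes at the rate `ξ'`.
  set Z : ℝ → E4 := fun s => z + s • W with hZdef
  set V : ℝ → E4 := fun s => v + s • W' with hVdef
  have hZ0 : Z 0 = z := by simp [hZdef]
  have hV0 : V 0 = v := by simp [hVdef]
  have hZ : HasDerivAt Z W 0 := by
    exact (((hasDerivAt_id' (0 : ℝ)).smul_const W).const_add z).congr_deriv (one_smul _ _)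
  have hV : HasDerivAt V W' 0 := by
    exact (((hasDerivAt_id' (0 : ℝ)).smul_const W').const_add v).congr_deriv (one_smul _ _)
  have h0' : 0 < polarR (Z 0) := by rw [hZ0]; exact h0
  have du := hZ.timePart
  have dr := hasDerivAt_polarR h0' hZ
  have dx := hasDerivAt_polarX h0' hZ
  have dy := hV.timePart
  have dρ := hasDerivAt_polarRho h0' hZ hV
  have dξ := hasDerivAt_polarXi h0' hZ hV
  rw [hZ0, hV0] at dρ dξ
  rw [hZ0] at dr dx
  rw [hρ] at dρ dξ
  rw [zero_smul, sub_zero, hξ] at dξ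
  rw [hW'] at dy
  have hZreg : ∀ᶠ s in 𝓝 (0 : ℝ), Z s ∈ region u₀ R :=
    hZ.continuousAt.eventually_mem ((isOpen_region u₀ R).mem_nhds (by rw [hZ0]; exact hz))
  have hxs : ∀ᶠ s in 𝓝 (0 : ℝ), ‖polarX (Z s)‖ = 1 := by
    filter_upwards [hZreg] with s hs using norm_polarX (hB.polarR_pos hs)
  have hu0 : u₀ ≤ Z 0 0 := by rw [hZ0]; exact hz.1.le
  have hr0 : R < polarR (Z 0) := by rw [hZ0]; exact hz.2
  obtain ⟨α', dα, bα⟩ := hB.guu.hasDerivAt du dr dx hxs hu0 hr0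
  obtain ⟨β', dβ, bβ⟩ := hB.gur.hasDerivAt du dr dx hxs hu0 hr0
  choose η' dη bη using fun i => (hB.guA i).hasDerivAt du dr dx hxs hu0 hr0
  choose χ' dχ bχ using fun i j => (hB.gAB i j).hasDerivAt du dr dx hxs hu0 hr0
  rw [hZ0] at bα bβ
  simp only [hZ0] at bη bχ
  have dξi : ∀ i, HasDerivAt (fun s => polarXi (Z s) (V s) i) (ξ' i) 0 := fun i =>
    (EuclideanSpace.proj i : E3 →L[ℝ] ℝ).hasFDerivAt.comp_hasDerivAt 0 dξ
  have ddev : HasDerivAt (fun s => B.deviation (Z s) (V s) (V s)) _ 0 :=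
    (((dα.mul (dy.mul dy)).add (dβ.mul ((dy.mul dρ).add (dρ.mul dy)))).add
      (HasDerivAt.fun_sum (u := Finset.univ) fun i _ =>
        (dη i).mul ((dy.mul (dξi i)).add ((dξi i).mul dy)))).add
      (HasDerivAt.fun_sum (u := Finset.univ) fun i _ =>
        HasDerivAt.fun_sum (u := Finset.univ) fun j _ =>
          (dχ i j).mul ((dξi i).mul (dξi j)))
  have dflat := (((dy.mul dy).neg.sub ((dy.mul dρ).add (dρ.mul dy))).add
      ((dr.pow 2).mul (dξ.inner ℝ dξ))).add ddev
  have dG : HasDerivAt (fun s => S.chartMetric B.chart (Z s) (V s) (V s))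
      (fderiv ℝ (S.chartMetric B.chart) z W v v + 2 * S.chartMetric B.chart z v W') 0 := by
    have hd : HasFDerivAt (S.chartMetric B.chart) (fderiv ℝ (S.chartMetric B.chart) z) (Z 0) := by
      rw [hZ0]
      exact (differentiableAt_chartMetric B.chart_mem (hB.mem_target hz)).hasFDerivAt
    refine (((hd.comp_hasDerivAt 0 hZ).clm_apply hV).clm_apply hV).congr_deriv ?_
    simp only [add_apply, Function.comp_apply, hZ0, hV0]
    rw [S.chartMetric_symm B.chart z W' v]
    ring
  -- The same derivative is computed twice: from the metric as a tensor, and from the flat part plus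
  -- deviation.
  have heq := dG.unique (dflat.congr_of_eventuallyEq (by
    filter_upwards [hZreg] with s hs
    exact hB.chartMetric_eq hs (V s) (V s)))
  rw [heq]
  simp only [hZ0, hV0, Pi.mul_apply, Pi.add_apply]
  set y := v 0
  set ρ := polarRho z v
  set r := polarR z
  set ξ := polarXi z v
  set m := ‖ξ‖
  have hm : 0 ≤ m := norm_nonneg _
  have hξi : ∀ i, |ξ i| ≤ m := fun i => abs_apply_le_norm _ i
  have hξi' : ∀ i, |ξ' i| ≤ κ * m := fun i => (abs_apply_le_norm _ i).trans hξ'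
  have hsum : |W 0| + |polarRho z W| / r + ‖polarXi z W‖ ≤ 3 * κ := by
    have : |polarRho z W| / r ≤ κ := by rw [div_le_iff₀ h0]; exact hr
    linarith
  have cα : |α'| ≤ C / r * (3 * κ) := by
    refine bα.trans ?_
    rw [zpow_neg_one, ← div_eq_mul_inv]; gcongr
  have cβ : |β'| ≤ C / r ^ 2 * (3 * κ) := by
    refine bβ.trans ?_
    rw [zpow_neg, ← div_eq_mul_inv, zpow_ofNat]; gcongr
  have cη : ∀ i, |η' i| ≤ C * (3 * κ) := fun i => by
    refine (bη i).trans ?_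
    rw [zpow_zero, mul_one]; gcongr
  have cχ : ∀ i j, |χ' i j| ≤ C * r * (3 * κ) := fun i j => by
    refine (bχ i j).trans ?_
    rw [zpow_one]; gcongr
  have hsq : ((fun t => polarR (Z t)) ^ 2) 0 = r ^ 2 := by simp [hZ0, r]
  rw [hsq, real_inner_self_eq_norm_sq, real_inner_comm ξ' ξ]
  have key : ∀ a b : ℝ, -(0 * y + y * 0) - (0 * ρ + y * 0 + (0 * y + ρ * 0))
      + (((2 : ℕ) : ℝ) * r ^ (2 - 1) * polarRho z W * m ^ 2
        + r ^ 2 * (inner ℝ ξ' ξ + inner ℝ ξ' ξ))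
      + (α' * (y * y) + (S.guu B.chart (z 0) r (polarX z) + 1) * (0 * y + y * 0)
        + (β' * (y * ρ + ρ * y)
          + (S.gur B.chart (z 0) r (polarX z) + 1) * (0 * ρ + y * 0 + (0 * y + ρ * 0))) + a + b)
      - (2 * r * polarRho z W * m ^ 2 + 2 * r ^ 2 * inner ℝ ξ' ξ)
      = α' * (y * y) + β' * (2 * (y * ρ)) + a + b := fun a b => by
    push_cast
    ring
  refine (congrArg (fun t : ℝ => |t|) (key _ _)).trans_le ?_
  have e1 : |α' * (y * y)| ≤ C / r * (3 * κ) * y ^ 2 := by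
    rw [abs_mul, abs_mul_self, ← sq]; gcongr
  have e2 : |β' * (2 * (y * ρ))| ≤ C / r ^ 2 * (3 * κ) * (2 * |y * ρ|) := by
    rw [abs_mul, abs_mul 2, abs_two]; gcongr
  refine ((abs_add_le _ _).trans (add_le_add ((abs_add_le _ _).trans
    (add_le_add ((abs_add_le _ _).trans (add_le_add e1 e2))
      (abs_sum_fin_three_le (c := 8 * (C * κ * (|y| * m))) fun i => ?_)))
      (abs_sum_fin_three_le (c := 3 * (5 * (C * r * κ * (m * m)))) fun i =>
        abs_sum_fin_three_le fun j => ?_))).trans ?_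
  · have a1 : |η' i * (y * ξ i + ξ i * y)| ≤ C * (3 * κ) * (2 * (|y| * m)) := by
      rw [abs_mul, show y * ξ i + ξ i * y = 2 * (y * ξ i) by ring, abs_mul 2, abs_two, abs_mul y]
      gcongr
      · exact cη i
      · exact hξi i
    have a2 : |S.guA B.chart (z 0) r (polarX z) (tangentialPart (polarX z) (basisE3 i))
        * (0 * ξ i + y * ξ' i + (ξ' i * y + ξ i * 0))| ≤ C * (2 * (|y| * (κ * m))) := by
      rw [abs_mul, show 0 * ξ i + y * ξ' i + (ξ' i * y + ξ i * 0) = 2 * (y * ξ' i) by ring,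
        abs_mul 2, abs_two, abs_mul y]
      gcongr
      · exact h3 i
      · exact hξi' i
    refine ((abs_add_le _ _).trans (add_le_add a1 a2)).trans (le_of_eq ?_)
    ring
  · have a1 : |χ' i j * (ξ i * ξ j)| ≤ C * r * (3 * κ) * (m * m) := by
      rw [abs_mul, abs_mul]
      gcongr
      · exact cχ i j
      · exact hξi i
      · exact hξi j
    have a2 : |(S.gAB B.chart (z 0) r (polarX z)
          (tangentialPart (polarX z) (basisE3 i)) (tangentialPart (polarX z) (basisE3 j))
        - inner ℝ (tangentialPart (polarX z) (basisE3 i)) (tangentialPart (polarX z) (basisE3 j))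
          * r ^ 2) * (ξ' i * ξ j + ξ i * ξ' j)| ≤ C * r * (2 * (κ * m * m)) := by
      rw [abs_mul]
      have b1 : |ξ' i * ξ j + ξ i * ξ' j| ≤ 2 * (κ * m * m) := by
        have c1 : |ξ' i * ξ j| ≤ κ * m * m := by
          rw [abs_mul]; gcongr
          · exact hξi' i
          · exact hξi j
        have c2 : |ξ i * ξ' j| ≤ m * (κ * m) := by
          rw [abs_mul]; gcongr
          · exact hξi i
          · exact hξi' j
        refine ((abs_add_le _ _).trans (add_le_add c1 c2)).trans (le_of_eq ?_)
        ring
      gcongr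
      exact h4 i j
    refine ((abs_add_le _ _).trans (add_le_add a1 a2)).trans (le_of_eq ?_)
    ring
  -- The constant `45` is attained by the angular block: nine index pairs, each with `3` from the
  -- coefficient and `2` from the two factors.
  · have hexp : 45 * C * κ / r * errorSize z v
        = 15 * (C / r * (3 * κ) * y ^ 2) + 15 / 2 * (C / r ^ 2 * (3 * κ) * (2 * |y * ρ|))
          + 45 * (C * κ * (|y| * m)) + 45 * (C * r * κ * (m * m)) := by
      have e : errorSize z v = y ^ 2 + |y * ρ| / r + |y| * (r * m) + (r * m) ^ 2 := rfl
      rw [e]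
      field_simp
      ring
    rw [hexp]
    have p1 : 0 ≤ C / r * (3 * κ) * y ^ 2 := by positivity
    have p2 : 0 ≤ C / r ^ 2 * (3 * κ) * (2 * |y * ρ|) := by positivity
    have p3 : 0 ≤ C * κ * (|y| * m) := by positivity
    linarith

end ScriBounds

end BondiChart

end Spacetime

/-! ### Approximate conservation laws along light rays. -/

/-- The algebraic relations between the components of a null vector at radius `r`, up to relative
errors `A / r`: `y` and `ρ` are the `u`- and `r`-components, `ℓ` the length of the angular part,
`j` the angular momentum, `p` and `Q` the products with `∂_r` and `∂_u`. -/
structure NullRelations (A r y ρ ℓ j p Q : ℝ) : Prop where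
  nonneg : 0 ≤ A
  one_le : 1 ≤ r
  small : A ≤ r / 10000
  angular_nonneg : 0 ≤ ℓ
  momentum_nonneg : 0 ≤ j
  null : |2 * (y * ρ) - (ℓ ^ 2 - y ^ 2)| ≤ A / r * (y ^ 2 + ℓ ^ 2)
  radial : |p - y| ≤ A / r * |y|
  momentum : |j - r * ℓ| ≤ A * (|y| + ℓ)
  energy : |2 * (y * Q) - (y ^ 2 + ℓ ^ 2)| ≤ A / r * (y ^ 2 + ℓ ^ 2)
  time : |Q - y - ρ| ≤ A / r * (|y| + |ρ| + ℓ)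

/-- The bounds on the derivatives of `j²`, `p` and `Q` along a null geodesic. -/
structure NullRates (A r y ℓ j n' p' Q' : ℝ) : Prop where
  momentum : |n'| ≤ 2 * (j * (A / r * (y ^ 2 + ℓ ^ 2)))
  radial : |p' + ℓ ^ 2 / r| ≤ A / r ^ 2 * (y ^ 2 + ℓ ^ 2)
  time : |Q'| ≤ A / r * (y ^ 2 + ℓ ^ 2)

theorem norm_le_three_mul {w : E3} {c : ℝ} (h : ∀ k, |w k| ≤ c) : ‖w‖ ≤ 3 * c := by
  have hc : 0 ≤ c := (abs_nonneg _).trans (h 0)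
  refine (sq_le_sq₀ (norm_nonneg _) (by positivity)).1 ?_
  rw [EuclideanSpace.norm_sq_eq, Fin.sum_univ_three]
  simp only [Real.norm_eq_abs]
  have := fun k => pow_le_pow_left₀ (abs_nonneg _) (h k) 2
  linarith [this 0, this 1, this 2, sq_nonneg c, mul_pow 3 c 2]

namespace Spacetime

variable {M : Type*} [TopologicalSpace M] [ChartedSpace E4 M] [IsManifold (𝓡 4) ∞ M]
variable {S : Spacetime M}

namespace BondiChart

/-- The product of `v` with `-∂_r`. -/
noncomputable def radialMomentum (B : S.BondiChart) (z v : E4) : ℝ :=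
  -S.chartMetric B.chart z v (bondiPoint 0 (polarX z))

/-- The product of `v` with `-∂_u`. -/
noncomputable def timeMomentum (B : S.BondiChart) (z v : E4) : ℝ :=
  -S.chartMetric B.chart z v (bondiPoint 1 0)

/-- The products of `v` with the infinitesimal rotations. -/
noncomputable def angularMomentum (B : S.BondiChart) (z v : E4) : E3 :=
  WithLp.toLp 2 fun k => S.chartMetric B.chart z v (bondiPoint 0 (axisRotation k (spatialPart z)))

variable {B : S.BondiChart} {u₀ R C : ℝ}

namespace ScriBounds

/-- Nullity expresses `yρ` through `y²` and `ℓ²` up to a small multiple of the error itself, which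
is then absorbed. All errors become multiples of `y² + ℓ²`. -/
theorem errorSize_le (hB : B.ScriBounds u₀ R C) {z v : E4} (hz : z ∈ region u₀ R)
    (hC : 300 * C ≤ polarR z / 10000) (hv : S.chartMetric B.chart z v v = 0) :
    errorSize z v ≤ 3 * (v 0 ^ 2 + (polarR z * ‖polarXi z v‖) ^ 2) ∧
    |v 0 * polarRho z v| ≤ v 0 ^ 2 + (polarR z * ‖polarXi z v‖) ^ 2 := by
  have h0 := hB.polarR_pos hz
  have h1 : 1 ≤ polarR z := hB.one_le.trans hz.2.le
  have h := hB.abs_chartMetric_self hz v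
  have e : errorSize z v = v 0 ^ 2 + |v 0 * polarRho z v| / polarR z
    + |v 0| * (polarR z * ‖polarXi z v‖) + (polarR z * ‖polarXi z v‖) ^ 2 := rfl
  rw [hv] at h
  set y := v 0
  set ρ := polarRho z v
  set r := polarR z
  set l := r * ‖polarXi z v‖
  have e1 : |y * ρ| / r ≤ |y * ρ| := div_le_self (abs_nonneg _) h1
  have e2 : |y| * l ≤ (y ^ 2 + l ^ 2) / 2 := by nlinarith [sq_nonneg (|y| - l), sq_abs y]
  have hE : 0 ≤ errorSize z v := by
    rw [e]
    have : 0 ≤ l := by positivity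
    positivity
  have e3 : 9 * C / r ≤ 1 / 10 := by
    rw [div_le_iff₀ h0]; linarith
  have e4 : 9 * C / r * errorSize z v ≤ 1 / 10 * errorSize z v := by gcongr
  have e5 := abs_le.1 (h.trans e4)
  have e6 : |y * ρ| * 2 ≤ y ^ 2 + l ^ 2 + 1 / 10 * errorSize z v := by
    rcases abs_cases (y * ρ) with ⟨h, -⟩ | ⟨h, -⟩ <;> rw [h] <;>
      nlinarith [sq_nonneg y, sq_nonneg l, e5.1, e5.2]
  constructor <;> nlinarith [sq_nonneg y, sq_nonneg l]

/-- From here on only these scalar relations are used, with the single constant `300 * C` for all of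
them. -/
theorem nullRelations (hB : B.ScriBounds u₀ R C) {z v : E4} (hz : z ∈ region u₀ R)
    (hC : 300 * C ≤ polarR z / 10000) (hv : S.chartMetric B.chart z v v = 0) :
    NullRelations (300 * C) (polarR z) (v 0) (polarRho z v) (polarR z * ‖polarXi z v‖)
      ‖B.angularMomentum z v‖ (B.radialMomentum z v) (B.timeMomentum z v) := by
  have h0 := hB.polarR_pos hz
  have hC0 := hB.nonneg
  have h1 : 1 ≤ polarR z := hB.one_le.trans hz.2.le
  obtain ⟨hE, hyρ⟩ := hB.errorSize_le hz hC hv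
  have hself := hB.abs_chartMetric_self hz v
  rw [hv] at hself
  have htime := hB.abs_chartMetric_time hz v
  have hrad := hB.abs_chartMetric_radial hz v
  have htan := fun k => hB.abs_chartMetric_tangent hz v
    (inner_axisRotation_self k (polarX z))
    ((norm_axisRotation_le k (polarX z)).trans (norm_polarX h0).le)
  have hJ : ∀ k, B.angularMomentum z v k
      = S.chartMetric B.chart z v (bondiPoint 0 (polarR z • axisRotation k (polarX z))) := by
    intro k
    rw [← map_smul, polarR_smul_polarX h0]; rfl
  set y := v 0
  set ρ := polarRho z v
  set r := polarR z
  set m := ‖polarXi z v‖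
  have hm : 0 ≤ m := norm_nonneg _
  set l := r * m with hl
  have hl0 : 0 ≤ l := by positivity
  have hrr : C / r ^ 2 ≤ C / r := by
    gcongr
    nlinarith
  have hCr : 0 ≤ C / r := by positivity
  have hmr : C * m = C / r * l := by rw [hl]; field_simp
  have hs : 0 ≤ y ^ 2 + l ^ 2 := by positivity
  have hA : 300 * C / r = 300 * (C / r) := by ring
  have hnull : |2 * (y * ρ) - (l ^ 2 - y ^ 2)| ≤ 27 * (C / r) * (y ^ 2 + l ^ 2) := by
    have h9 : 9 * C / r * errorSize z v ≤ 27 * (C / r) * (y ^ 2 + l ^ 2) := by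
      calc 9 * C / r * errorSize z v ≤ 9 * C / r * (3 * (y ^ 2 + l ^ 2)) := by gcongr
        _ = _ := by ring
    refine le_trans (le_of_eq ?_) (hself.trans h9)
    congr 1
    ring
  have hQ : |B.timeMomentum z v - y - ρ| ≤ C / r * (|y| + |ρ| + 3 * l) := by
    have : B.timeMomentum z v - y - ρ
        = -(S.chartMetric B.chart z v (bondiPoint 1 0) + y + ρ) := by
      rw [timeMomentum]; ring
    rw [this, abs_neg]
    refine htime.trans ?_
    rw [hmr]
    have := mul_le_mul_of_nonneg_right hrr (abs_nonneg ρ)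
    nlinarith
  refine ⟨by positivity, h1, hC, hl0, norm_nonneg _, ?_, ?_, ?_, ?_, ?_⟩
  · refine hnull.trans ?_
    rw [hA]
    gcongr
    norm_num
  · have : B.radialMomentum z v - y
        = -(S.chartMetric B.chart z v (bondiPoint 0 (polarX z)) + y) := by
      rw [radialMomentum]; ring
    rw [this, abs_neg]
    refine hrad.trans ?_
    rw [hA]
    gcongr
    nlinarith
  -- The flat angular momentum; its length is `r ℓ` by Lagrange's identity, since position and
  -- angular velocity are orthogonal.
  · set w : E3 := WithLp.toLp 2 fun k => r ^ 2 * inner ℝ (polarXi z v) (axisRotation k (polarX z))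
      with hw
    have hwn : ‖w‖ = r * l := by
      refine (sq_eq_sq₀ (norm_nonneg _) (by positivity)).1 ?_
      have hin : inner ℝ (polarXi z v) (polarX z) = 0 := by
        rw [real_inner_comm]; exact inner_polarX_polarXi h0 v
      have := sum_inner_axisRotation_sq hin
      rw [norm_polarX h0] at this
      rw [EuclideanSpace.norm_sq_eq]
      simp only [hw, Real.norm_eq_abs, sq_abs, mul_pow]
      rw [← Finset.mul_sum, this, hl]
      ring
    have hd : ‖B.angularMomentum z v - w‖ ≤ 3 * (3 * (C * |y|) + 9 * (C * l)) := by
      refine norm_le_three_mul fun k => ?_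
      rw [PiLp.sub_apply, hJ k]
      exact htan k
    rw [← hwn]
    refine (abs_norm_sub_norm_le _ _).trans (hd.trans ?_)
    linarith [mul_nonneg hC0 (abs_nonneg y), mul_nonneg hC0 hl0,
      mul_add (300 * C) |y| l]
  -- Multiply `Q ≈ y + ρ` by `2y` and eliminate `2yρ` with the null relation.
  · have e1 : |2 * (y * (B.timeMomentum z v - y - ρ))|
        ≤ 2 * (|y| * (C / r * (|y| + |ρ| + 3 * l))) := by
      rw [abs_mul, abs_two, abs_mul]; gcongr
    have e2 : |y| * (C / r * (|y| + |ρ| + 3 * l))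
        = C / r * (y ^ 2 + |y * ρ| + 3 * (|y| * l)) := by
      rw [abs_mul, ← sq_abs y]; ring
    have e3 : |y| * l ≤ (y ^ 2 + l ^ 2) / 2 := by nlinarith [sq_nonneg (|y| - l), sq_abs y]
    have e4 : C / r * (y ^ 2 + |y * ρ| + 3 * (|y| * l)) ≤ C / r * (4 * (y ^ 2 + l ^ 2)) := by
      gcongr
      nlinarith [sq_nonneg y, sq_nonneg l]
    have : 2 * (y * B.timeMomentum z v) - (y ^ 2 + l ^ 2)
        = 2 * (y * (B.timeMomentum z v - y - ρ)) + (2 * (y * ρ) - (l ^ 2 - y ^ 2)) := by ring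
    rw [this]
    refine ((abs_add_le _ _).trans (add_le_add e1 hnull)).trans ?_
    rw [e2, hA]
    linarith [mul_nonneg hCr hs]
  · refine hQ.trans ?_
    rw [hA]
    linarith [mul_nonneg hCr (abs_nonneg y), mul_nonneg hCr (abs_nonneg ρ), mul_nonneg hCr hl0]

/-- The left-hand side has the form of the derivative in `SolvesAt.hasDerivAt_inner`; the numerical
factor comes from `45 · 3 / 2 ≤ 100`. -/
theorem abs_half_variation_le (hB : B.ScriBounds u₀ R C) {z : E4} (hz : z ∈ region u₀ R)
    {v W W' : E4} {ξ' : E3} {κ : ℝ} (hC : 300 * C ≤ polarR z / 10000)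
    (hv : S.chartMetric B.chart z v v = 0) (hκ : 0 ≤ κ) (hW' : W' 0 = 0)
    (hρ : polarRho z W' + inner ℝ (polarXi z W) (spatialPart v) = 0)
    (hξ : (polarR z)⁻¹ • (spatialPart W' - polarRho z v • polarXi z W
      - polarRho z W • polarXi z v) = ξ')
    (hu : |W 0| ≤ κ) (hr : |polarRho z W| ≤ κ * polarR z) (hx : ‖polarXi z W‖ ≤ κ)
    (hξ' : ‖ξ'‖ ≤ κ * ‖polarXi z v‖) :
    |1 / 2 * fderiv ℝ (S.chartMetric B.chart) z W v v + S.chartMetric B.chart z v W'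
        - (polarR z * polarRho z W * ‖polarXi z v‖ ^ 2
          + polarR z ^ 2 * inner ℝ (polarXi z v) ξ')|
      ≤ 100 * C * κ / polarR z * (v 0 ^ 2 + (polarR z * ‖polarXi z v‖) ^ 2) := by
  have h0 := hB.polarR_pos hz
  have hC0 := hB.nonneg
  have h := hB.abs_variation_le hz hκ hW' hρ hξ hu hr hx hξ'
  have hE := (hB.errorSize_le hz hC hv).1
  set s := v 0 ^ 2 + (polarR z * ‖polarXi z v‖) ^ 2
  have hs : 0 ≤ s := by positivity
  have h2 : 45 * C * κ / polarR z * errorSize z v ≤ 45 * C * κ / polarR z * (3 * s) := by gcongr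
  have h3 : 0 ≤ C * κ / polarR z * s := by positivity
  have e : 45 * C * κ / polarR z * (3 * s) = 135 * (C * κ / polarR z * s) := by ring
  have e' : 100 * C * κ / polarR z * s = 100 * (C * κ / polarR z * s) := by ring
  rw [abs_le] at h ⊢
  constructor <;> nlinarith [h.1, h.2]

/-- The momenta are differentiable along a null geodesic, with small derivatives. -/
theorem exists_nullRates (hB : B.ScriBounds u₀ R C) {z v : ℝ → E4} {t : ℝ}
    (hzv : S.SolvesAt B.chart z v t) (hz : z t ∈ region u₀ R)
    (hC : 300 * C ≤ polarR (z t) / 10000) (hv : S.chartMetric B.chart (z t) (v t) (v t) = 0) :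
    ∃ n' p' Q', NullRates (300 * C) (polarR (z t)) (v t 0) (polarR (z t) * ‖polarXi (z t) (v t)‖)
        ‖B.angularMomentum (z t) (v t)‖ n' p' Q' ∧
      HasDerivAt (fun s => ‖B.angularMomentum (z s) (v s)‖ ^ 2) n' t ∧
      HasDerivAt (fun s => B.radialMomentum (z s) (v s)) p' t ∧
      HasDerivAt (fun s => B.timeMomentum (z s) (v s)) Q' t := by
  have h0 := hB.polarR_pos hz
  have hC0 := hB.nonneg
  have he := B.chart_mem
  have hV := hzv.2.1
  have dx : HasDerivAt (fun s => bondiPoint 0 (polarX (z s)))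
      (bondiPoint 0 (polarXi (z t) (v t))) t :=
    spaceCLM.hasFDerivAt.comp_hasDerivAt t (hasDerivAt_polarX h0 hV)
  have dA : ∀ k, HasDerivAt (fun s => bondiPoint 0 (axisRotation k (spatialPart (z s))))
      (bondiPoint 0 (axisRotation k (spatialPart (v t)))) t := fun k =>
    (spaceCLM.comp (axisRotation k)).hasFDerivAt.comp_hasDerivAt t hV.spatialPart
  have dp := (hzv.hasDerivAt_inner he dx).neg
  have dQ := (hzv.hasDerivAt_inner he (hasDerivAt_const t (bondiPoint 1 0))).neg
  have dJ := fun k => hzv.hasDerivAt_inner he (dA k)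
  set r := polarR (z t)
  set x := polarX (z t)
  set ξ := polarXi (z t) (v t)
  set l := r * ‖ξ‖ with hl
  set s := (v t 0) ^ 2 + l ^ 2 with hs
  have hs0 : 0 ≤ s := by positivity
  have hin0 : inner ℝ x (0 : E3) = 0 := inner_zero_right _
  have hxξ : inner ℝ x ξ = 0 := inner_polarX_polarXi h0 _
  -- For `∂_r` the scale `κ = 1/r` is admissible, which gives the extra power of `r` in the error of
  -- `p'`. The main term is the flat one, `ℓ² / r`.
  have kp := hB.abs_half_variation_le (W := bondiPoint 0 x) (W' := bondiPoint 0 ξ) (ξ' := 0)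
    (κ := r⁻¹) hz hC hv (by positivity) rfl
    (by rw [polarRho_tangent h0 hxξ, polarXi_radial h0, inner_zero_left, add_zero])
    (by rw [polarXi_radial h0, polarRho_radial h0, spatialPart_bondiPoint]; simp [ξ])
    (by simp [h0.le])
    (by rw [polarRho_radial h0, abs_one]; exact (inv_mul_cancel₀ h0.ne').ge)
    (by rw [polarXi_radial h0, norm_zero]; positivity)
    (by rw [norm_zero]; positivity)
  -- `∂_u` is a Killing field of the flat metric, so there is no main term.
  have kQ := hB.abs_half_variation_le (W := bondiPoint 1 0) (W' := 0) (ξ' := 0)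
    (κ := 1) hz hC hv zero_le_one rfl
    (by rw [polarXi_tangent h0 hin0]; simp [polarRho, ← spatialCLM_apply])
    (by rw [polarXi_tangent h0 hin0, polarRho_tangent h0 hin0]; simp [← spatialCLM_apply])
    (by simp)
    (by rw [polarRho_tangent h0 hin0, abs_zero]; positivity)
    (by rw [polarXi_tangent h0 hin0, smul_zero, norm_zero]; positivity)
    (by rw [norm_zero]; positivity)
  have hAx : ∀ k, r⁻¹ • axisRotation k (spatialPart (z t)) = axisRotation k x := fun k =>
    (map_smul (axisRotation k) _ _).symm
  have hxA : ∀ k, inner ℝ x (axisRotation k (spatialPart (z t))) = 0 := fun k => by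
    rw [← polarR_smul_polarX h0, map_smul, inner_smul_right, inner_axisRotation_self, mul_zero]
  -- Rotations are Killing fields of the flat metric: the main term is the product of the angular
  -- velocity with its own rotation, which vanishes.
  have kJ := fun k => hB.abs_half_variation_le
    (W := bondiPoint 0 (axisRotation k (spatialPart (z t))))
    (W' := bondiPoint 0 (axisRotation k (spatialPart (v t)))) (ξ' := axisRotation k ξ)
    (κ := 1) hz hC hv zero_le_one rfl
    (by
      rw [polarXi_tangent h0 (hxA k), hAx, inner_axisRotation_skew, polarRho,
        spatialPart_bondiPoint, add_neg_cancel])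
    (by
      rw [polarXi_tangent h0 (hxA k), polarRho_tangent h0 (hxA k), hAx, spatialPart_bondiPoint,
        zero_smul, sub_zero, ← map_smul, ← map_sub, ← map_smul]
      rfl)
    (by simp)
    (by rw [polarRho_tangent h0 (hxA k), abs_zero]; positivity)
    (by
      rw [polarXi_tangent h0 (hxA k), hAx]
      exact (norm_axisRotation_le k x).trans (norm_polarX h0).le)
    (by rw [one_mul]; exact norm_axisRotation_le k ξ)
  have dJv : HasDerivAt (fun s => B.angularMomentum (z s) (v s)) (WithLp.toLp 2 fun k =>
      1 / 2 * fderiv ℝ (S.chartMetric B.chart) (z t)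
          (bondiPoint 0 (axisRotation k (spatialPart (z t)))) (v t) (v t)
        + S.chartMetric B.chart (z t) (v t)
            (bondiPoint 0 (axisRotation k (spatialPart (v t))))) t := by
    exact ((PiLp.continuousLinearEquiv 2 ℝ fun _ : Fin 3 => ℝ).symm :
      (Fin 3 → ℝ) →L[ℝ] E3).hasFDerivAt |>.comp_hasDerivAt t (hasDerivAt_pi.2 dJ)
  refine ⟨_, _, _, ⟨?_, ?_, ?_⟩, dJv.norm_sq, dp, dQ⟩
  · rw [abs_mul, abs_two]
    refine mul_le_mul_of_nonneg_left ((abs_real_inner_le_norm _ _).trans ?_) zero_le_two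
    gcongr
    refine le_trans (b := 3 * (100 * C * 1 / r * s)) ?_ (le_of_eq (by ring))
    have hk : ∀ k, |1 / 2 * fderiv ℝ (S.chartMetric B.chart) (z t)
          (bondiPoint 0 (axisRotation k (spatialPart (z t)))) (v t) (v t)
        + S.chartMetric B.chart (z t) (v t)
            (bondiPoint 0 (axisRotation k (spatialPart (v t))))| ≤ 100 * C * 1 / r * s := by
      intro k
      have := kJ k
      rwa [polarRho_tangent h0 (hxA k), inner_axisRotation_self, mul_zero, mul_zero, zero_mul,
        add_zero, sub_zero] at this
    exact norm_le_three_mul hk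
  · have e1 : 300 * C / r ^ 2 * s = 3 * (100 * C * r⁻¹ / r * s) := by field_simp; ring
    have e2 : l ^ 2 / r = r * ‖ξ‖ ^ 2 := by rw [hl]; field_simp
    rw [polarRho_radial h0, inner_zero_right, mul_zero, add_zero, mul_one] at kp
    have e3 : 0 ≤ 100 * C * r⁻¹ / r * s := by positivity
    rw [e1, e2]
    rw [abs_le] at kp ⊢
    constructor <;> linarith [kp.1, kp.2]
  · have e1 : 300 * C / r * s = 3 * (100 * C * 1 / r * s) := by ring
    rw [polarRho_tangent h0 hin0, inner_zero_right, mul_zero, mul_zero, zero_mul, add_zero,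
      sub_zero] at kQ
    have e3 : 0 ≤ 100 * C * 1 / r * s := by positivity
    rw [abs_neg, e1]
    linarith

end ScriBounds

end BondiChart

end Spacetime

/-! ### Pointwise inequalities for nearly flat light rays. -/

namespace NullRelations

variable {A r y ρ ℓ j p Q : ℝ}

theorem pos (h : NullRelations A r y ρ ℓ j p Q) : 0 < r := by linarith [h.one_le]

theorem rate_nonneg (h : NullRelations A r y ρ ℓ j p Q) : 0 ≤ A / r := div_nonneg h.nonneg h.pos.le

theorem rate_le (h : NullRelations A r y ρ ℓ j p Q) : A / r ≤ 1 / 10000 := by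
  rw [div_le_iff₀ h.pos]; linarith [h.small]

theorem rate_mul_le (h : NullRelations A r y ρ ℓ j p Q) {s : ℝ} (hs : 0 ≤ s) :
    A / r * s ≤ 1 / 10000 * s := mul_le_mul_of_nonneg_right h.rate_le hs

theorem radial_bounds (h : NullRelations A r y ρ ℓ j p Q) (hy : 0 < y) :
    9999 / 10000 * y ≤ p ∧ p ≤ 10001 / 10000 * y := by
  have h1 := h.radial
  rw [abs_of_pos hy] at h1
  have h2 := abs_le.1 (h1.trans (h.rate_mul_le hy.le))
  constructor <;> linarith [h2.1, h2.2]

theorem momentum_bounds (h : NullRelations A r y ρ ℓ j p Q) (hy : 0 < y) :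
    |j - r * ℓ| ≤ r * (y + ℓ) / 10000 := by
  refine h.momentum.trans ?_
  rw [abs_of_pos hy]
  nlinarith [mul_le_mul_of_nonneg_right h.small (add_nonneg hy.le h.angular_nonneg)]

/-- The bound `j² ≥ (rp)² / 2` says that the angular part is not small compared with `y`. The error
in `j ≈ rℓ` is then also small relative to `rℓ` alone. The factor `7/10` is below `1/√2`. -/
theorem momentum_lower (h : NullRelations A r y ρ ℓ j p Q) (hy : 0 < y)
    (hK : (r * p) ^ 2 / 2 ≤ j ^ 2) : 7 / 10 * (r * p) ≤ j ∧ 2 / 3 * y ≤ ℓ ∧ 0 < j ∧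
      99 / 100 * (r * ℓ) ≤ j ∧ j ≤ 1001 / 1000 * (r * ℓ) := by
  have hr := h.pos
  have hp := h.radial_bounds hy
  have hp0 : 0 < p := by linarith [hp.1]
  have hj := abs_le.1 (h.momentum_bounds hy)
  have h1 : 7 / 10 * (r * p) ≤ j := by
    refine (sq_le_sq₀ (by positivity) h.momentum_nonneg).1 ?_
    nlinarith [sq_nonneg (r * p)]
  have h2 : r * (9999 / 10000 * y) ≤ r * p := mul_le_mul_of_nonneg_left hp.1 hr.le
  have h3 : 2 / 3 * y ≤ ℓ := by
    have : r * (2 / 3 * y) ≤ r * ℓ := by nlinarith [mul_pos hr hy, hj.1, hj.2]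
    exact le_of_mul_le_mul_left this hr
  have h4 : r * (2 / 3 * y) ≤ r * ℓ := mul_le_mul_of_nonneg_left h3 hr.le
  have h5 : 0 < r * p := mul_pos hr hp0
  refine ⟨h1, h3, by linarith, ?_, ?_⟩ <;> nlinarith [mul_pos hr hy, hj.1, hj.2]

theorem null_bounds (h : NullRelations A r y ρ ℓ j p Q) :
    ℓ ^ 2 - y ^ 2 - 1 / 10000 * (y ^ 2 + ℓ ^ 2) ≤ 2 * (y * ρ) ∧
    2 * (y * ρ) ≤ ℓ ^ 2 - y ^ 2 + 1 / 10000 * (y ^ 2 + ℓ ^ 2) := by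
  have := abs_le.1 (h.null.trans (h.rate_mul_le (by positivity)))
  constructor <;> linarith [this.1, this.2]

theorem energy_bounds (h : NullRelations A r y ρ ℓ j p Q) :
    9999 / 10000 * (y ^ 2 + ℓ ^ 2) ≤ 2 * (y * Q) ∧
    2 * (y * Q) ≤ 10001 / 10000 * (y ^ 2 + ℓ ^ 2) := by
  have := abs_le.1 (h.energy.trans (h.rate_mul_le (by positivity)))
  constructor <;> linarith [this.1, this.2]

theorem ratio_mul_le (h : NullRelations A r y ρ ℓ j p Q) (hy : 0 < y)
    (hK : (r * p) ^ 2 / 2 ≤ j ^ 2) :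
    j ^ 2 / (r * p) ^ 2 * y ^ 2 ≤ 102 / 100 * (y ^ 2 + ℓ ^ 2) := by
  have hr := h.pos
  have hp := h.radial_bounds hy
  have hp0 : 0 < p := by linarith [hp.1]
  obtain ⟨-, -, j3, -, j5⟩ := h.momentum_lower hy hK
  have e1 : j ^ 2 ≤ (1001 / 1000 * (r * ℓ)) ^ 2 := pow_le_pow_left₀ j3.le j5 2
  have e2 : (r * (9999 / 10000 * y)) ^ 2 ≤ (r * p) ^ 2 :=
    pow_le_pow_left₀ (by positivity) (mul_le_mul_of_nonneg_left hp.1 hr.le) 2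
  rw [div_mul_eq_mul_div, div_le_iff₀ (by positivity)]
  have e0 : 0 ≤ r ^ 2 * y ^ 2 * ℓ ^ 2 := by positivity
  calc j ^ 2 * y ^ 2 ≤ (1001 / 1000 * (r * ℓ)) ^ 2 * y ^ 2 :=
        mul_le_mul_of_nonneg_right e1 (sq_nonneg y)
    _ ≤ 102 / 100 * ℓ ^ 2 * (r * (9999 / 10000 * y)) ^ 2 := by linarith
    _ ≤ 102 / 100 * (y ^ 2 + ℓ ^ 2) * (r * p) ^ 2 := by
        gcongr
        linarith [sq_nonneg y]

/-- The derivative of `r p` along a null geodesic. -/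
theorem area_rate (h : NullRelations A r y ρ ℓ j p Q) (hy : 0 < y) {n' p' Q' : ℝ}
    (h' : NullRates A r y ℓ j n' p' Q') :
    ρ * p + r * p' ≤ -(49 / 100 * (y ^ 2 + ℓ ^ 2)) := by
  have hr := h.pos
  have hp := h.radial_bounds hy
  have hp0 : 0 < p := by linarith [hp.1]
  have hnull := h.null_bounds.2
  set s := y ^ 2 + ℓ ^ 2 with hs
  have hs0 : 0 < s := by positivity
  have hp' : r * p' ≤ -ℓ ^ 2 + s / 10000 := by
    have h1 := (abs_le.1 h'.radial).2
    have h2 : A / r ^ 2 * s ≤ 1 / 10000 * s / r := by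
      have := div_le_div_of_nonneg_right (h.rate_mul_le hs0.le) hr.le
      refine le_trans (le_of_eq ?_) this
      field_simp
    have h3 : p' ≤ (-ℓ ^ 2 + s / 10000) / r := by
      have : (-ℓ ^ 2 + s / 10000) / r = 1 / 10000 * s / r - ℓ ^ 2 / r := by ring
      linarith
    calc r * p' ≤ r * ((-ℓ ^ 2 + s / 10000) / r) := mul_le_mul_of_nonneg_left h3 hr.le
      _ = _ := by field_simp
  -- In the flat model `ρp + rp' = yρ - ℓ² = -(y² + ℓ²)/2`. After multiplication by `2y > 0` the
  -- null relation applies without division; `49/100` leaves room for the errors.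
  have e1 : p * (2 * (y * ρ)) ≤ p * (ℓ ^ 2 - y ^ 2 + 1 / 10000 * s) :=
    mul_le_mul_of_nonneg_left hnull hp0.le
  have e2 : p * (ℓ ^ 2 - y ^ 2 + 1 / 10000 * s) ≤ y * (ℓ ^ 2 - y ^ 2) + 3 / 10000 * (y * s) := by
    have k1 : (p - y) * (ℓ ^ 2 - y ^ 2) ≤ 1 / 10000 * y * s := by
      rcases le_total 0 (ℓ ^ 2 - y ^ 2) with hc | hc
      · calc (p - y) * (ℓ ^ 2 - y ^ 2) ≤ (1 / 10000 * y) * (ℓ ^ 2 - y ^ 2) :=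
              mul_le_mul_of_nonneg_right (by linarith [hp.2]) hc
          _ ≤ _ := by
              refine mul_le_mul_of_nonneg_left ?_ (by positivity)
              rw [hs]; nlinarith [sq_nonneg y]
      · calc (p - y) * (ℓ ^ 2 - y ^ 2) = (y - p) * (y ^ 2 - ℓ ^ 2) := by ring
          _ ≤ (1 / 10000 * y) * (y ^ 2 - ℓ ^ 2) :=
              mul_le_mul_of_nonneg_right (by linarith [hp.1]) (by linarith)
          _ ≤ _ := by
              refine mul_le_mul_of_nonneg_left ?_ (by positivity)
              rw [hs]; nlinarith [sq_nonneg ℓ]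
    have k2 : p * s ≤ 10001 / 10000 * y * s := mul_le_mul_of_nonneg_right hp.2 hs0.le
    nlinarith [mul_pos hy hs0]
  have e3 : 2 * y * (r * p') ≤ 2 * y * (-ℓ ^ 2 + s / 10000) :=
    mul_le_mul_of_nonneg_left hp' (by positivity)
  have e4 : 2 * y * (ρ * p + r * p') ≤ 2 * y * (-(49 / 100 * s)) := by
    have : y * s = y * y ^ 2 + y * ℓ ^ 2 := by rw [hs]; ring
    nlinarith [mul_pos hy hs0]
  exact le_of_mul_le_mul_left e4 (by positivity)

/-- Along a null geodesic the ratio `j² / (r p)²` increases while `r` divided by it decreases. -/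
theorem ratio_rates (h : NullRelations A r y ρ ℓ j p Q) (hy : 0 < y)
    (hK : (r * p) ^ 2 / 2 ≤ j ^ 2) {n' p' Q' : ℝ} (h' : NullRates A r y ℓ j n' p' Q') {K K' : ℝ}
    (hKdef : K = j ^ 2 / (r * p) ^ 2)
    (hK' : K' = (n' * (r * p) ^ 2 - j ^ 2 * (2 * (r * p) * (ρ * p + r * p'))) / ((r * p) ^ 2) ^ 2) :
    0 ≤ K' ∧ (ρ * K - r * K') / K ^ 2 ≤ -(y / 6) := by
  have hr := h.pos
  have hp := h.radial_bounds hy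
  have hp0 : 0 < p := by linarith [hp.1]
  obtain ⟨j1, j2, j3, j4, j5⟩ := h.momentum_lower hy hK
  -- In the flat model `j' = 0`, so `K'/K = s/(rp)`, and `ρ - rK'/K = -(ℓ² + 3y²)/(2y)`. With `K =
  -- ℓ²/y²` this gives `(r/K)' ≤ -y/2`; the rate `y/6` absorbs all errors.
  set s := y ^ 2 + ℓ ^ 2 with hs
  have hs0 : 0 < s := by positivity
  have hP : 0 < r * p := mul_pos hr hp0
  have hK0 : 0 < K := by rw [hKdef]; positivity
  have hnull := h.null_bounds.2
  have hG : ρ * p + r * p' ≤ -(49 / 100 * s) := h.area_rate hy h'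
  have hn : -(2 * (j * (1 / 10000 * s))) ≤ n' := by
    have h1 := (abs_le.1 h'.momentum).1
    have := mul_le_mul_of_nonneg_left (h.rate_mul_le hs0.le) j3.le
    linarith
  have hnum : 97 / 100 * j ^ 2 * s ≤ n' * (r * p) - j ^ 2 * (2 * (ρ * p + r * p')) := by
    have e1 : -(2 * (j * (1 / 10000 * s))) * (r * p) ≤ n' * (r * p) :=
      mul_le_mul_of_nonneg_right hn hP.le
    have e2 : j ^ 2 * (2 * (ρ * p + r * p')) ≤ j ^ 2 * (2 * -(49 / 100 * s)) := by
      refine mul_le_mul_of_nonneg_left ?_ (sq_nonneg j); linarith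
    have e3 : (j * s) * (r * p) ≤ (j * s) * (10 / 7 * j) :=
      mul_le_mul_of_nonneg_left (by linarith) (by positivity)
    nlinarith [mul_pos (pow_pos j3 2) hs0]
  have hKeq : K' = (n' * (r * p) - j ^ 2 * (2 * (ρ * p + r * p'))) / (r * p) ^ 3 := by
    rw [hK']; field_simp
  have hK'1 : 97 / 100 * K * s / (r * p) ≤ K' := by
    rw [hKeq, hKdef]
    calc 97 / 100 * (j ^ 2 / (r * p) ^ 2) * s / (r * p) = 97 / 100 * j ^ 2 * s / (r * p) ^ 3 := by
          field_simp
      _ ≤ _ := div_le_div_of_nonneg_right hnum (by positivity)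
  refine ⟨le_trans (by positivity) hK'1, ?_⟩
  have hrK : 96 / 100 * K * s / y ≤ r * K' := by
    calc 96 / 100 * K * s / y ≤ 97 / 100 * K * s / p := by
          rw [div_le_div_iff₀ hy hp0]
          have : K * s * (96 / 100 * p) ≤ K * s * (97 / 100 * y) :=
            mul_le_mul_of_nonneg_left (by linarith [hp.2]) (by positivity)
          linarith
      _ = r * (97 / 100 * K * s / (r * p)) := by field_simp
      _ ≤ _ := mul_le_mul_of_nonneg_left hK'1 hr.le
  have hρ : ρ ≤ 51 / 100 * s / y := by
    rw [le_div_iff₀ hy, hs]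
    nlinarith [sq_nonneg y, sq_nonneg ℓ]
  have hKup : K * y ^ 2 ≤ 102 / 100 * s := by rw [hKdef]; exact h.ratio_mul_le hy hK
  rw [div_le_iff₀ (by positivity)]
  have e1 : ρ * K - r * K' ≤ -(45 / 100 * (K * s / y)) := by
    have := mul_le_mul_of_nonneg_right hρ hK0.le
    have e : 51 / 100 * s / y * K = 51 / 100 * (K * s / y) := by ring
    have e' : 96 / 100 * K * s / y = 96 / 100 * (K * s / y) := by ring
    linarith
  refine e1.trans ?_
  have e2 : y / 6 * K ^ 2 ≤ 45 / 100 * (K * s / y) := by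
    rw [show 45 / 100 * (K * s / y) = (45 / 100 * (K * s)) / y by ring, le_div_iff₀ hy]
    have := mul_le_mul_of_nonneg_left hKup hK0.le
    linarith [mul_pos hK0 hs0, this]
  linarith

/-- A ratio near `1` or larger forces `ℓ` to be almost `y` at least, and the null relation then
allows only a slight inward motion. -/
theorem radius_rate (h : NullRelations A r y ρ ℓ j p Q) (hy : 0 < y)
    (hK : 99 / 100 * (r * p) ^ 2 ≤ j ^ 2) : -(y / 50) ≤ ρ := by
  have hr := h.pos
  have hp := h.radial_bounds hy
  obtain ⟨j1, j2, j3, j4, j5⟩ := h.momentum_lower hy (by nlinarith [sq_nonneg (r * p)])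
  have e1 : j ^ 2 ≤ (1001 / 1000 * (r * ℓ)) ^ 2 := pow_le_pow_left₀ j3.le j5 2
  have e2 : (r * (9999 / 10000 * y)) ^ 2 ≤ (r * p) ^ 2 :=
    pow_le_pow_left₀ (by positivity) (mul_le_mul_of_nonneg_left hp.1 hr.le) 2
  have e3 : 985 / 1000 * y ^ 2 ≤ ℓ ^ 2 := by
    have : r ^ 2 * (985 / 1000 * y ^ 2) ≤ r ^ 2 * ℓ ^ 2 := by
      have : 0 ≤ r ^ 2 * y ^ 2 := by positivity
      nlinarith
    exact le_of_mul_le_mul_left this (by positivity)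
  have e4 := h.null_bounds.1
  have : y * (-(y / 50)) ≤ y * ρ := by nlinarith
  exact le_of_mul_le_mul_left this hy

/-- For an almost tangential ray the null relation gives `ℓ ≥ 997/1000 y`, and `j ≈ rℓ`, `p ≈ y`
yield a ratio of almost `1` at least. -/
theorem ratio_initial (h : NullRelations A r y ρ ℓ j p Q) (hy : 0 < y)
    (hρ : |ρ| ≤ (y + ℓ) / 1000) : 99 / 100 * (r * p) ^ 2 ≤ j ^ 2 := by
  have hr := h.pos
  have hp := h.radial_bounds hy
  have hj := abs_le.1 (h.momentum_bounds hy)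
  have hl := h.angular_nonneg
  have e4 := h.null_bounds
  have e5 := abs_le.1 hρ
  have e6 : y * -((y + ℓ) / 1000) ≤ y * ρ := mul_le_mul_of_nonneg_left (by linarith) hy.le
  have e7 : 997 / 1000 * y ≤ ℓ := by
    by_contra hcon
    push Not at hcon
    nlinarith
  have e8 : r * (997 / 1000 * y) ≤ r * ℓ := mul_le_mul_of_nonneg_left e7 hr.le
  have e9 : r * p ≤ r * (10001 / 10000 * y) := mul_le_mul_of_nonneg_left hp.2 hr.le
  have e10 : 9965 / 10000 * (r * p) ≤ j := by nlinarith [mul_pos hr hy]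
  have e11 : 0 ≤ r * p := mul_nonneg hr.le (by linarith [hp.1])
  nlinarith [pow_le_pow_left₀ (by positivity) e10 2, sq_nonneg (r * p)]

theorem energy_pos (h : NullRelations A r y ρ ℓ j p Q) (hy : 0 < y) : 0 < Q := by
  have := h.energy_bounds.1
  have : 0 < 2 * (y * Q) := lt_of_lt_of_le (by positivity) this
  exact pos_of_mul_pos_right (a := y) (by linarith) hy.le

theorem pos_of_energy_pos (h : NullRelations A r y ρ ℓ j p Q) (hy : y ≠ 0) (hQ : 0 < Q) :
    0 < y := by
  have := h.energy_bounds.1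
  have : 0 < 2 * (y * Q) := lt_of_lt_of_le (by positivity) this
  exact pos_of_mul_pos_left (b := Q) (by linarith) hQ.le

/-- Since `y² + ℓ²` is comparable to `2yQ`, the logarithmic derivative of `Q` is bounded by a
multiple of `u' / r`. Its integral is therefore controlled by the total change of `u`. -/
theorem abs_energy_rate_le (h : NullRelations A r y ρ ℓ j p Q) {n' p' Q' : ℝ}
    (h' : NullRates A r y ℓ j n' p' Q') : |Q'| ≤ 3 * (A / r) * (y * Q) := by
  refine h'.time.trans ?_
  have := mul_le_mul_of_nonneg_left h.energy_bounds.1 h.rate_nonneg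
  have h0 : 0 ≤ A / r * (y ^ 2 + ℓ ^ 2) := mul_nonneg h.rate_nonneg (by positivity)
  nlinarith

/-- The logarithmic derivative of `p` is at least `-3Q`, so `p` cannot vanish in finite parameter
while `Q` is bounded. -/
theorem radial_rate (h : NullRelations A r y ρ ℓ j p Q) (hy : 0 < y) {n' p' Q' : ℝ}
    (h' : NullRates A r y ℓ j n' p' Q') : -(3 * Q * p) ≤ p' := by
  have hr := h.pos
  have hp := h.radial_bounds hy
  have hQ := h.energy_pos hy
  have h1 := (abs_le.1 h'.radial).1
  have hs : 0 ≤ y ^ 2 + ℓ ^ 2 := by positivity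
  have e1 : ℓ ^ 2 / r ≤ ℓ ^ 2 := div_le_self (sq_nonneg _) h.one_le
  have e2 : A / r ^ 2 * (y ^ 2 + ℓ ^ 2) ≤ 1 / 10000 * (y ^ 2 + ℓ ^ 2) := by
    refine le_trans ?_ (h.rate_mul_le hs)
    refine mul_le_mul_of_nonneg_right ?_ hs
    refine div_le_div_of_nonneg_left h.nonneg hr ?_
    nlinarith [h.one_le]
  have e3 := h.energy_bounds.1
  have e4 : Q * (9999 / 10000 * y) ≤ Q * p := mul_le_mul_of_nonneg_left hp.1 hQ.le
  nlinarith [mul_pos hQ hy, sq_nonneg y]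

/-- The size of the velocity in terms of its energy. -/
theorem velocity_bounds (h : NullRelations A r y ρ ℓ j p Q) (hy : 0 < y) :
    y ≤ 3 * Q ∧ ℓ ≤ 3 * Q ∧ |ρ| ≤ 5 * Q ∧ Q / 2 ≤ y + ρ := by
  have hQ := h.energy_pos hy
  have e := h.energy_bounds.1
  have hl := h.angular_nonneg
  have h1 : y ≤ 3 * Q := by
    have : y * y ≤ y * (3 * Q) := by nlinarith [sq_nonneg ℓ, mul_pos hy hQ]
    exact le_of_mul_le_mul_left this hy
  have h2 : ℓ ≤ 3 * Q := by
    refine (sq_le_sq₀ hl (by positivity)).1 ?_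
    nlinarith [mul_le_mul_of_nonneg_right h1 hQ.le, sq_nonneg y]
  have ht := h.time
  rw [abs_of_pos hy] at ht
  have ht' := abs_le.1 (ht.trans (h.rate_mul_le (by positivity)))
  have h3 : |ρ| ≤ 5 * Q := by
    rcases abs_cases ρ with ⟨hc, -⟩ | ⟨hc, -⟩ <;> rw [hc] at ht' ⊢ <;> linarith [ht'.1, ht'.2]
  exact ⟨h1, h2, h3, by linarith [ht'.1, ht'.2]⟩

end NullRelations

/-! ### Integrated estimates along a light ray. -/

theorem monotoneOn_Ico_of_hasDerivAt {f : ℝ → ℝ} {a b : ℝ} (hc : ContinuousOn f (Ico a b))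
    (hd : ∀ t ∈ Ioo a b, ∃ f', HasDerivAt f f' t ∧ 0 ≤ f') : MonotoneOn f (Ico a b) := by
  refine monotoneOn_of_deriv_nonneg (convex_Ico a b) hc ?_ ?_ <;> rw [interior_Ico] <;> intro t ht
  · obtain ⟨f', h, -⟩ := hd t ht
    exact h.differentiableAt.differentiableWithinAt
  · obtain ⟨f', h, h'⟩ := hd t ht
    rwa [h.deriv]

/-- The components along a null geodesic near future null infinity, as functions of the affine
parameter. -/
structure NullFlow (A τ : ℝ) (u r y ρ ℓ j p Q : ℝ → ℝ) : Prop where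
  continuousOn_time : ContinuousOn u (Ico 0 τ)
  continuousOn_radius : ContinuousOn r (Ico 0 τ)
  continuousOn_momentum : ContinuousOn j (Ico 0 τ)
  continuousOn_radial : ContinuousOn p (Ico 0 τ)
  continuousOn_energy : ContinuousOn Q (Ico 0 τ)
  relations : ∀ t ∈ Ico 0 τ, NullRelations A (r t) (y t) (ρ t) (ℓ t) (j t) (p t) (Q t)
  rates : ∀ t ∈ Ioo 0 τ, ∃ n' p' Q', NullRates A (r t) (y t) (ℓ t) (j t) n' p' Q' ∧
    HasDerivAt (fun s => j s ^ 2) n' t ∧ HasDerivAt p p' t ∧ HasDerivAt Q Q' t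
  deriv_time : ∀ t ∈ Ioo 0 τ, HasDerivAt u (y t) t
  deriv_radius : ∀ t ∈ Ioo 0 τ, HasDerivAt r (ρ t) t

namespace NullFlow

variable {A τ : ℝ} {u r y ρ ℓ j p Q : ℝ → ℝ}

theorem time_monotoneOn (h : NullFlow A τ u r y ρ ℓ j p Q) (hy : ∀ t ∈ Ico 0 τ, 0 < y t) :
    MonotoneOn u (Ico 0 τ) :=
  monotoneOn_Ico_of_hasDerivAt h.continuousOn_time fun t ht =>
    ⟨_, h.deriv_time t ht, (hy t (Ioo_subset_Ico_self ht)).le⟩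

theorem radial_pos (h : NullFlow A τ u r y ρ ℓ j p Q) (hy : ∀ t ∈ Ico 0 τ, 0 < y t) :
    ∀ t ∈ Ico 0 τ, 0 < p t := fun t ht => by
  linarith [((h.relations t ht).radial_bounds (hy t ht)).1, hy t ht]

section ratio

variable (h : NullFlow A τ u r y ρ ℓ j p Q) (hy : ∀ t ∈ Ico 0 τ, 0 < y t)
  (hK : ∀ t ∈ Ico 0 τ, (r t * p t) ^ 2 / 2 ≤ j t ^ 2)

include h hy

theorem area_pos : ∀ t ∈ Ico 0 τ, 0 < r t * p t := fun t ht =>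
  mul_pos (h.relations t ht).pos (h.radial_pos hy t ht)

theorem continuousOn_ratio : ContinuousOn (fun t => j t ^ 2 / (r t * p t) ^ 2) (Ico 0 τ) :=
  (h.continuousOn_momentum.pow 2).div ((h.continuousOn_radius.mul h.continuousOn_radial).pow 2)
    fun t ht => (pow_pos (h.area_pos hy t ht) 2).ne'

include hK

theorem exists_ratio_deriv (t : ℝ) (ht : t ∈ Ioo 0 τ) :
    ∃ K', HasDerivAt (fun t => j t ^ 2 / (r t * p t) ^ 2) K' t ∧ 0 ≤ K' ∧
      (ρ t * (j t ^ 2 / (r t * p t) ^ 2) - r t * K') / (j t ^ 2 / (r t * p t) ^ 2) ^ 2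
        ≤ -(y t / 6) := by
  have ht' := Ioo_subset_Ico_self ht
  obtain ⟨n', p', Q', hrates, dn, dp, -⟩ := h.rates t ht
  have dP := ((h.deriv_radius t ht).mul dp).pow 2
  have hP := h.area_pos hy t ht'
  have dK := dn.div dP (by simpa using hP.ne')
  refine ⟨_, dK.congr_deriv rfl, ?_⟩
  refine (h.relations t ht').ratio_rates (hy t ht') (hK t ht') hrates rfl ?_
  simp

theorem ratio_monotoneOn : MonotoneOn (fun t => j t ^ 2 / (r t * p t) ^ 2) (Ico 0 τ) :=
  monotoneOn_Ico_of_hasDerivAt (h.continuousOn_ratio hy) fun t ht => by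
    obtain ⟨K', h1, h2, -⟩ := h.exists_ratio_deriv hy hK t ht
    exact ⟨K', h1, h2⟩

theorem half_le_ratio : ∀ t ∈ Ico 0 τ, 1 / 2 ≤ j t ^ 2 / (r t * p t) ^ 2 := fun t ht => by
  rw [le_div_iff₀ (pow_pos (h.area_pos hy t ht) 2)]
  linarith [hK t ht]

/-- Monotonicity preserves the initial `99/100`, which improves on the assumed `1/2`; this gap
closes the continuity argument. -/
theorem ratio_lower (h0 : 99 / 100 * (r 0 * p 0) ^ 2 ≤ j 0 ^ 2) :
    ∀ t ∈ Ico 0 τ, 99 / 100 * (r t * p t) ^ 2 ≤ j t ^ 2 := fun t ht => by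
  have ht0 : (0 : ℝ) ∈ Ico 0 τ := ⟨le_rfl, ht.1.trans_lt ht.2⟩
  rw [← le_div_iff₀ (pow_pos (h.area_pos hy t ht) 2)]
  rw [← le_div_iff₀ (pow_pos (h.area_pos hy 0 ht0) 2)] at h0
  exact h0.trans (h.ratio_monotoneOn hy hK ht0 ht ht.1)

/-- The retarded time increases by at most `12 r` in total. -/
theorem time_le : ∀ t ∈ Ico 0 τ, u t ≤ u 0 + 12 * r 0 := fun t ht => by
  have ht0 : (0 : ℝ) ∈ Ico 0 τ := ⟨le_rfl, ht.1.trans_lt ht.2⟩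
  set K : ℝ → ℝ := fun t => j t ^ 2 / (r t * p t) ^ 2
  have hK0 : ∀ t ∈ Ico 0 τ, 0 < K t := fun t ht => by
    linarith [h.half_le_ratio hy hK t ht]
  -- Here `r/K` falls at a rate of at least `u'/6` and stays nonnegative. Initially `r/K ≤ 2r`
  -- because `K ≥ 1/2`, which gives `6 · 2 = 12`.
  have hmono : MonotoneOn (fun t => -(6 * (r t / K t)) - u t) (Ico 0 τ) := by
    refine monotoneOn_Ico_of_hasDerivAt ?_ fun t ht => ?_
    · exact ((continuousOn_const.mul (h.continuousOn_radius.div (h.continuousOn_ratio hy)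
        fun t ht => (hK0 t ht).ne')).neg).sub h.continuousOn_time
    · obtain ⟨K', h1, -, h3⟩ := h.exists_ratio_deriv hy hK t ht
      have := (h.deriv_radius t ht).div h1 (hK0 t (Ioo_subset_Ico_self ht)).ne'
      refine ⟨_, ((this.const_mul 6).neg).sub (h.deriv_time t ht), ?_⟩
      linarith
  have h1 := hmono ht0 ht ht.1
  simp only at h1
  have h2 : 0 ≤ r t / K t := div_nonneg (h.relations t ht).pos.le (hK0 t ht).le
  have h3 : r 0 / K 0 ≤ 2 * r 0 := by
    rw [div_le_iff₀ (hK0 0 ht0)]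
    nlinarith [h.half_le_ratio hy hK 0 ht0, (h.relations 0 ht0).pos]
  linarith

/-- The function `r + u/50` is nondecreasing and `u` gains at most `12 r(0)`, so `r` loses at most
`12/50 < 1/4` of its initial value. -/
theorem radius_lower (h0 : 99 / 100 * (r 0 * p 0) ^ 2 ≤ j 0 ^ 2) :
    ∀ t ∈ Ico 0 τ, 3 / 4 * r 0 ≤ r t := fun t ht => by
  have ht0 : (0 : ℝ) ∈ Ico 0 τ := ⟨le_rfl, ht.1.trans_lt ht.2⟩
  have hmono : MonotoneOn (fun t => r t + 1 / 50 * u t) (Ico 0 τ) := by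
    refine monotoneOn_Ico_of_hasDerivAt ?_ fun t ht => ?_
    · exact h.continuousOn_radius.add (continuousOn_const.mul h.continuousOn_time)
    · refine ⟨_, (h.deriv_radius t ht).add ((h.deriv_time t ht).const_mul _), ?_⟩
      have ht' := Ioo_subset_Ico_self ht
      linarith [(h.relations t ht').radius_rate (hy t ht') (h.ratio_lower hy hK h0 t ht')]
  have h1 := hmono ht0 ht ht.1
  simp only at h1
  linarith [h.time_le hy hK t ht, (h.relations 0 ht0).pos]

theorem energy_bounds (hr : ∀ t ∈ Ico 0 τ, r 0 / 2 ≤ r t) :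
    ∀ t ∈ Ico 0 τ, Q t ≤ Q 0 * Real.exp (72 * A) ∧ Q 0 * Real.exp (-(72 * A)) ≤ Q t := by
  intro t ht
  have ht0 : (0 : ℝ) ∈ Ico 0 τ := ⟨le_rfl, ht.1.trans_lt ht.2⟩
  have hr0 := (h.relations 0 ht0).pos
  have hA := (h.relations 0 ht0).nonneg
  -- The rate `3A/r` with `r ≥ r(0)/2`. Multiplied by the bound `12 r(0)` on the change of `u` it
  -- gives the exponent `72A`, independent of the ray.
  set c := 6 * A / r 0 with hc
  have hc0 : 0 ≤ c := by positivity
  have hQ : ∀ t ∈ Ico 0 τ, 0 < Q t := fun t ht => (h.relations t ht).energy_pos (hy t ht)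
  have hrate : ∀ t ∈ Ioo 0 τ, ∃ Q', HasDerivAt Q Q' t ∧ |Q'| ≤ c * y t * Q t := by
    intro t ht
    have ht' := Ioo_subset_Ico_self ht
    obtain ⟨n', p', Q', hrates, -, -, dQ⟩ := h.rates t ht
    refine ⟨Q', dQ, ((h.relations t ht').abs_energy_rate_le hrates).trans ?_⟩
    have h1 : 3 * (A / r t) ≤ c := by
      rw [hc, ← mul_div_assoc, div_le_div_iff₀ (h.relations t ht').pos hr0]
      nlinarith [hr t ht']
    have := mul_le_mul_of_nonneg_right h1 (mul_pos (hy t ht') (hQ t ht')).le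
    linarith
  -- The signs `ε = -1` and `ε = 1` give the upper and the lower Grönwall bound.
  have key : ∀ ε : ℝ, |ε| = 1 → MonotoneOn (fun t => ε * (Q t * Real.exp (ε * (c * u t))))
      (Ico 0 τ) := by
    intro ε hε
    refine monotoneOn_Ico_of_hasDerivAt ?_ fun t ht => ?_
    · exact continuousOn_const.mul (h.continuousOn_energy.mul
        (continuousOn_const.mul (continuousOn_const.mul h.continuousOn_time)).rexp)
    · obtain ⟨Q', dQ, hQ'⟩ := hrate t ht
      refine ⟨_, (dQ.mul (((h.deriv_time t ht).const_mul c).const_mul ε).exp).const_mul ε, ?_⟩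
      have e : ε * (Q' * Real.exp (ε * (c * u t)) + Q t * (Real.exp (ε * (c * u t))
          * (ε * (c * y t)))) = (ε * Q' + ε ^ 2 * (c * y t * Q t)) * Real.exp (ε * (c * u t)) := by
        ring
      rw [e, ← sq_abs, hε, one_pow, one_mul]
      refine mul_nonneg ?_ (Real.exp_pos _).le
      have : |ε * Q'| ≤ c * y t * Q t := by rw [abs_mul, hε, one_mul]; exact hQ'
      linarith [(abs_le.1 this).1]
  have hu := h.time_le hy hK t ht
  have hcu : c * (u t - u 0) ≤ 72 * A := by
    calc c * (u t - u 0) ≤ c * (12 * r 0) := mul_le_mul_of_nonneg_left (by linarith) hc0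
      _ = 72 * A := by rw [hc]; field_simp; ring
  constructor
  · have h1 := key (-1) (by simp) ht0 ht ht.1
    simp only [neg_mul, one_mul, neg_le_neg_iff] at h1
    have h2 : Q t ≤ Q 0 * Real.exp (c * (u t - u 0)) := by
      have e1 : Q t = Q t * Real.exp (-(c * u t)) * Real.exp (c * u t) := by
        rw [mul_assoc, ← Real.exp_add, neg_add_cancel, Real.exp_zero, mul_one]
      rw [e1]
      refine (mul_le_mul_of_nonneg_right h1 (Real.exp_pos _).le).trans (le_of_eq ?_)
      rw [mul_assoc, ← Real.exp_add]
      congr 2; ring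
    exact h2.trans (mul_le_mul_of_nonneg_left (Real.exp_le_exp.2 hcu) (hQ 0 ht0).le)
  · have h1 := key 1 (by simp) ht0 ht ht.1
    simp only [one_mul] at h1
    have h2 : Q 0 * Real.exp (-(c * (u t - u 0))) ≤ Q t := by
      have e1 : Q t = Q t * Real.exp (c * u t) * Real.exp (-(c * u t)) := by
        rw [mul_assoc, ← Real.exp_add, add_neg_cancel, Real.exp_zero, mul_one]
      rw [e1]
      refine le_trans (le_of_eq ?_) (mul_le_mul_of_nonneg_right h1 (Real.exp_pos _).le)
      rw [mul_assoc, ← Real.exp_add]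
      congr 2; ring
    refine le_trans ?_ h2
    exact mul_le_mul_of_nonneg_left (Real.exp_le_exp.2 (neg_le_neg hcu)) (hQ 0 ht0).le

theorem radial_lower (hr : ∀ t ∈ Ico 0 τ, r 0 / 2 ≤ r t) :
    ∀ t ∈ Ico 0 τ, p 0 * Real.exp (-(3 * (Q 0 * Real.exp (72 * A)) * t)) ≤ p t := by
  intro t ht
  have ht0 : (0 : ℝ) ∈ Ico 0 τ := ⟨le_rfl, ht.1.trans_lt ht.2⟩
  set k := 3 * (Q 0 * Real.exp (72 * A)) with hk
  have hmono : MonotoneOn (fun t => p t * Real.exp (k * t)) (Ico 0 τ) := by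
    refine monotoneOn_Ico_of_hasDerivAt ?_ fun t ht => ?_
    · exact h.continuousOn_radial.mul (by fun_prop)
    · have ht' := Ioo_subset_Ico_self ht
      obtain ⟨n', p', Q', hrates, -, dp, -⟩ := h.rates t ht
      refine ⟨_, dp.mul (((hasDerivAt_id' t).const_mul k).exp), ?_⟩
      have h1 := (h.relations t ht').radial_rate (hy t ht') hrates
      have h2 := (h.energy_bounds hy hK hr t ht').1
      have h3 := h.radial_pos hy t ht'
      have h4 : 0 ≤ p' + p t * k := by
        have := mul_le_mul_of_nonneg_right h2 h3.le
        rw [hk]; linarith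
      have e : p' * Real.exp (k * t) + p t * (Real.exp (k * t) * (k * 1))
        = (p' + p t * k) * Real.exp (k * t) := by ring
      rw [e]
      exact mul_nonneg h4 (Real.exp_pos _).le
  have h1 := hmono ht0 ht ht.1
  simp only [mul_zero, Real.exp_zero, mul_one] at h1
  have e1 : p t = p t * Real.exp (k * t) * Real.exp (-(k * t)) := by
    rw [mul_assoc, ← Real.exp_add, add_neg_cancel, Real.exp_zero, mul_one]
  rw [e1]
  exact mul_le_mul_of_nonneg_right h1 (Real.exp_pos _).le

theorem velocity_le (hr : ∀ t ∈ Ico 0 τ, r 0 / 2 ≤ r t) :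
    ∀ t ∈ Ico 0 τ, y t ≤ 3 * (Q 0 * Real.exp (72 * A)) ∧ ℓ t ≤ 3 * (Q 0 * Real.exp (72 * A)) ∧
      |ρ t| ≤ 5 * (Q 0 * Real.exp (72 * A)) ∧ Q 0 * Real.exp (-(72 * A)) / 2 ≤ y t + ρ t := by
  intro t ht
  obtain ⟨h1, h2, h3, h4⟩ := (h.relations t ht).velocity_bounds (hy t ht)
  obtain ⟨h5, h6⟩ := h.energy_bounds hy hK hr t ht
  exact ⟨by linarith, by linarith, by linarith, by linarith⟩

theorem radius_le (hr : ∀ t ∈ Ico 0 τ, r 0 / 2 ≤ r t) :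
    ∀ t ∈ Ico 0 τ, r t ≤ r 0 + 5 * (Q 0 * Real.exp (72 * A)) * t := by
  intro t ht
  have hmono : MonotoneOn (fun t => 5 * (Q 0 * Real.exp (72 * A)) * t - r t) (Ico 0 τ) := by
    refine monotoneOn_Ico_of_hasDerivAt ?_ fun t ht => ?_
    · exact (by fun_prop : Continuous fun t => 5 * (Q 0 * Real.exp (72 * A)) * t).continuousOn.sub
        h.continuousOn_radius
    · refine ⟨_, ((hasDerivAt_id' t).const_mul _).sub (h.deriv_radius t ht), ?_⟩
      have := (h.velocity_le hy hK hr t (Ioo_subset_Ico_self ht)).2.2.1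
      linarith [le_abs_self (ρ t)]
  have h1 := hmono ⟨le_rfl, ht.1.trans_lt ht.2⟩ ht ht.1
  simp only [mul_zero, zero_sub] at h1
  linarith

/-- The rate of `u + r` is `y + ρ ≥ Q/2`, and `Q` is bounded below. Since `u` stays bounded, this is
what drives `r` to infinity. -/
theorem advanced_time_lower (hr : ∀ t ∈ Ico 0 τ, r 0 / 2 ≤ r t) :
    ∀ t ∈ Ico 0 τ, u 0 + r 0 + Q 0 * Real.exp (-(72 * A)) / 2 * t ≤ u t + r t := by
  intro t ht
  have hmono : MonotoneOn (fun t => u t + r t - Q 0 * Real.exp (-(72 * A)) / 2 * t)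
      (Ico 0 τ) := by
    refine monotoneOn_Ico_of_hasDerivAt ?_ fun t ht => ?_
    · exact (h.continuousOn_time.add h.continuousOn_radius).sub
        (by fun_prop : Continuous fun t => Q 0 * Real.exp (-(72 * A)) / 2 * t).continuousOn
    · refine ⟨_, ((h.deriv_time t ht).add (h.deriv_radius t ht)).sub
        ((hasDerivAt_id' t).const_mul _), ?_⟩
      have := (h.velocity_le hy hK hr t (Ioo_subset_Ico_self ht)).2.2.2
      linarith
  have h1 := hmono ⟨le_rfl, ht.1.trans_lt ht.2⟩ ht ht.1
  simp only [mul_zero, sub_zero] at h1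
  linarith

end ratio

end NullFlow

/-! ### From null geodesics to the flow estimates. -/

namespace Spacetime

variable {M : Type*} [TopologicalSpace M] [ChartedSpace E4 M] [IsManifold (𝓡 4) ∞ M]
variable {S : Spacetime M} {e : OpenPartialHomeomorph M E4}

theorem IsNullGeodesicOn.chart_continuousWithinAt (he : e ∈ IsManifold.maximalAtlas (𝓡 4) ∞ M)
    {γ : ℝ → M} {b : EReal} (h : S.IsNullGeodesicOn γ b) {t : ℝ}
    (ht : t ∈ parameterInterval b) (hes : γ t ∈ e.source) :
    ContinuousWithinAt (fun s => (e (γ s), derivWithin (fun s => e (γ s)) (parameterInterval b) s))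
      (parameterInterval b) t := by
  have hc : ContDiffWithinAt ℝ 2 (fun s => e (γ s)) (parameterInterval b) t := by
    have h3 : ContMDiffAt (𝓡 4) (𝓡 4) 2 e (γ t) :=
      ((contMDiffOn_of_mem_maximalAtlas he).contMDiffAt
        (e.open_source.mem_nhds hes)).of_le ENat.LEInfty.out
    exact (h3.comp_contMDiffWithinAt t (h.2.1.1 t ht)).contDiffWithinAt
  refine hc.continuousWithinAt.prodMk ?_
  have h3 : ContDiffWithinAt ℝ 1 (fderivWithin ℝ (fun s => e (γ s)) (parameterInterval b))
      (parameterInterval b) t :=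
    hc.fderivWithin_right (uniqueDiffOn_parameterInterval h.1) (by norm_num) ht
  exact (h3.clm_apply contDiffWithinAt_const).continuousWithinAt

namespace BondiChart

variable {B : S.BondiChart} {u₀ R C : ℝ}

namespace ScriBounds

theorem continuousAt_chartMetric (hB : B.ScriBounds u₀ R C) {q : E4 × E4}
    (hq : q.1 ∈ region u₀ R) {f : E4 × E4 → E4} (hf : ContinuousAt f q) :
    ContinuousAt (fun q => S.chartMetric B.chart q.1 q.2 (f q)) q := by
  have h1 : ContinuousAt (S.chartMetric B.chart) q.1 :=
    (differentiableAt_chartMetric B.chart_mem (hB.mem_target hq)).continuousAt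
  exact ((h1.comp continuousAt_fst).clm_apply continuousAt_snd).clm_apply hf

theorem continuousAt_polarR (q : E4 × E4) : ContinuousAt (fun q : E4 × E4 => polarR q.1) q :=
  (spatialCLM.continuous.norm.comp continuous_fst).continuousAt

theorem continuousAt_radialMomentum (hB : B.ScriBounds u₀ R C) {q : E4 × E4}
    (hq : q.1 ∈ region u₀ R) : ContinuousAt (fun q => B.radialMomentum q.1 q.2) q := by
  refine (hB.continuousAt_chartMetric hq ?_).neg
  refine spaceCLM.continuous.continuousAt.comp (g := spaceCLM) ?_
  exact ((continuousAt_polarR q).inv₀ (hB.polarR_pos hq).ne').smul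
    (spatialCLM.continuous.comp continuous_fst).continuousAt

theorem continuousAt_timeMomentum (hB : B.ScriBounds u₀ R C) {q : E4 × E4}
    (hq : q.1 ∈ region u₀ R) : ContinuousAt (fun q => B.timeMomentum q.1 q.2) q :=
  (hB.continuousAt_chartMetric hq continuousAt_const).neg

theorem continuousAt_angularMomentum (hB : B.ScriBounds u₀ R C) {q : E4 × E4}
    (hq : q.1 ∈ region u₀ R) : ContinuousAt (fun q => ‖B.angularMomentum q.1 q.2‖) q := by
  refine ContinuousAt.norm ?_
  refine (PiLp.continuous_toLp 2 _).continuousAt.comp (continuousAt_pi.2 fun k => ?_)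
  refine hB.continuousAt_chartMetric hq ?_
  exact ((spaceCLM.comp ((axisRotation k).comp spatialCLM)).continuous.comp
    continuous_fst).continuousAt

section geodesic

variable {γ : ℝ → M} {b : EReal}

/-- A null geodesic near future null infinity. -/
theorem nullFlow (hB : B.ScriBounds u₀ R C) (h : S.IsNullGeodesicOn γ b) {τ : ℝ}
    (hτ : (τ : EReal) ≤ b) (hmem : ∀ t ∈ Ico 0 τ, γ t ∈ B.chart.source ∧
      B.chart (γ t) ∈ region u₀ R ∧ 300 * C ≤ polarR (B.chart (γ t)) / 10000) :
    let z : ℝ → E4 := fun s => B.chart (γ s)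
    let v : ℝ → E4 := derivWithin z (parameterInterval b)
    NullFlow (300 * C) τ (fun t => z t 0) (fun t => polarR (z t)) (fun t => v t 0)
      (fun t => polarRho (z t) (v t)) (fun t => polarR (z t) * ‖polarXi (z t) (v t)‖)
      (fun t => ‖B.angularMomentum (z t) (v t)‖) (fun t => B.radialMomentum (z t) (v t))
      (fun t => B.timeMomentum (z t) (v t)) := by
  intro z v
  have hPI : ∀ t ∈ Ico 0 τ, t ∈ parameterInterval b := fun t ht =>
    ⟨ht.1, (EReal.coe_lt_coe_iff.2 ht.2).trans_le hτ⟩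
  have hc : ∀ f : E4 × E4 → ℝ, (∀ q : E4 × E4, q.1 ∈ region u₀ R → ContinuousAt f q) →
      ContinuousOn (fun t => f (z t, v t)) (Ico 0 τ) := by
    intro f hf t ht
    have h1 := h.chart_continuousWithinAt B.chart_mem (hPI t ht) (hmem t ht).1
    exact (ContinuousAt.comp_continuousWithinAt (f := fun s => (z s, v s))
      (hf (z t, v t) (hmem t ht).2.1) h1).mono hPI
  have hsol : ∀ t ∈ Ioo 0 τ, S.SolvesAt B.chart z v t := fun t ht =>
    h.solvesAt B.chart_mem ht.1 (hPI t (Ioo_subset_Ico_self ht)).2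
      (hmem t (Ioo_subset_Ico_self ht)).1
  have hnull : ∀ t ∈ Ico 0 τ, S.chartMetric B.chart (z t) (v t) (v t) = 0 := fun t ht =>
    (h.chart_null B.chart_mem (hPI t ht) (hmem t ht).1).2.2
  refine ⟨?_, ?_, ?_, ?_, ?_, ?_, ?_, ?_, ?_⟩
  · exact hc (fun q => q.1 0) fun q _ =>
      ((EuclideanSpace.proj (0 : Fin 4) : E4 →L[ℝ] ℝ).continuous.comp continuous_fst).continuousAt
  · exact hc (fun q => polarR q.1) fun q _ => continuousAt_polarR q
  · exact hc _ fun q hq => hB.continuousAt_angularMomentum hq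
  · exact hc _ fun q hq => hB.continuousAt_radialMomentum hq
  · exact hc _ fun q hq => hB.continuousAt_timeMomentum hq
  · exact fun t ht => hB.nullRelations (hmem t ht).2.1 (hmem t ht).2.2 (hnull t ht)
  · intro t ht
    have ht' := Ioo_subset_Ico_self ht
    exact hB.exists_nullRates (hsol t ht) (hmem t ht').2.1 (hmem t ht').2.2 (hnull t ht')
  · exact fun t ht => (hsol t ht).2.1.timePart
  · exact fun t ht => hasDerivAt_polarR (hB.polarR_pos (hmem t (Ioo_subset_Ico_self ht)).2.1)
      (hsol t ht).2.1

end geodesic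

/-- The states of outgoing light rays that started at radius `r₀`. -/
def OutgoingState (B : S.BondiChart) (u₀ r₀ : ℝ) (q : E4 × E4) : Prop :=
  q.1 ∈ region u₀ (r₀ / 2) ∧ 0 < q.2 0 ∧
    (polarR q.1 * B.radialMomentum q.1 q.2) ^ 2 / 2 < ‖B.angularMomentum q.1 q.2‖ ^ 2

theorem eventually_outgoingState (hB : B.ScriBounds u₀ R C) {r₀ : ℝ} (hr₀ : R ≤ r₀ / 2)
    {q : E4 × E4} (hq : OutgoingState B u₀ r₀ q) : ∀ᶠ q' in 𝓝 q, OutgoingState B u₀ r₀ q' := by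
  obtain ⟨h1, h2, h3⟩ := hq
  have hq' : q.1 ∈ region u₀ R := ⟨h1.1, hr₀.trans_lt h1.2⟩
  refine (continuousAt_fst.eventually_mem ((isOpen_region u₀ (r₀ / 2)).mem_nhds h1)).and
    (Eventually.and ?_ ?_)
  · exact ((EuclideanSpace.proj (0 : Fin 4) : E4 →L[ℝ] ℝ).continuous.comp
      continuous_snd).continuousAt.eventually_const_lt h2
  · exact ((((continuousAt_polarR q).mul (hB.continuousAt_radialMomentum hq')).pow 2).div_const
      2).eventually_lt ((hB.continuousAt_angularMomentum hq').pow 2) h3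

end ScriBounds

end BondiChart

end Spacetime

/-! ### The continuity argument. -/

/-- Induction along a parameter interval. -/
theorem parameterInterval_induction {b : EReal} {P : ℝ → Prop} (h0 : P 0)
    (hopen : ∀ t ∈ parameterInterval b, P t → ∀ᶠ s in 𝓝[parameterInterval b] t, P s)
    (hclosed : ∀ t ∈ parameterInterval b, 0 < t → (∀ s ∈ Ico 0 t, P s) → P t) :
    ∀ t ∈ parameterInterval b, P t := by
  by_contra! hcon
  obtain ⟨T, hT, hPT⟩ := hcon
  set bad : Set ℝ := {t | t ∈ parameterInterval b ∧ ¬ P t} with hbad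
  have hne : bad.Nonempty := ⟨T, hT, hPT⟩
  have hbd : BddBelow bad := ⟨0, fun t ht => ht.1.1⟩
  set τ := sInf bad with hτ
  have hτ0 : 0 ≤ τ := le_csInf hne fun t ht => ht.1.1
  have hτT : τ ≤ T := csInf_le hbd ⟨hT, hPT⟩
  have hτmem : τ ∈ parameterInterval b := ⟨hτ0, (EReal.coe_le_coe_iff.2 hτT).trans_lt hT.2⟩
  have hlt : ∀ s ∈ Ico 0 τ, P s := by
    intro s hs
    by_contra hP
    exact absurd (csInf_le hbd ⟨⟨hs.1, (EReal.coe_lt_coe_iff.2 hs.2).trans hτmem.2⟩, hP⟩)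
      (not_le.2 hs.2)
  have hPτ : P τ := by
    rcases hτ0.eq_or_lt with h | h
    · rwa [← h]
    · exact hclosed τ hτmem h hlt
  -- The property extends past the infimum of the bad parameters, which contradicts the definition
  -- of the infimum.
  obtain ⟨ε, hε, hball⟩ := Metric.mem_nhdsWithin_iff.1 (hopen τ hτmem hPτ)
  obtain ⟨t, ht, htε⟩ := exists_lt_of_csInf_lt hne (show sInf bad < τ + ε by linarith)
  refine ht.2 (hball ⟨?_, ht.1⟩)
  have := csInf_le hbd ht
  rw [Metric.mem_ball, Real.dist_eq, abs_of_nonneg (by linarith)]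
  linarith

theorem continuous_polarR : Continuous polarR := spatialCLM.continuous.norm

/-- Bounded ranges of retarded time and radius are compact. -/
theorem isCompact_bondiBox (u₁ u₂ r₁ r₂ : ℝ) :
    IsCompact {z : E4 | z 0 ∈ Icc u₁ u₂ ∧ polarR z ∈ Icc r₁ r₂} := by
  have h0 : Continuous fun z : E4 => z 0 := (EuclideanSpace.proj (0 : Fin 4)).continuous
  refine Metric.isCompact_of_isClosed_isBounded
    ((isClosed_Icc.preimage h0).inter (isClosed_Icc.preimage continuous_polarR)) ?_
  refine (Metric.isBounded_closedBall (x := (0 : E4)) (r := |u₁| + |u₂| + |r₂|)).subset ?_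
  rintro z ⟨h1, h2⟩
  rw [mem_closedBall_zero_iff]
  have h3 : |z 0| ≤ |u₁| + |u₂| := by
    rw [abs_le]
    constructor <;> linarith [h1.1, h1.2, neg_abs_le u₁, le_abs_self u₂, abs_nonneg u₁,
      abs_nonneg u₂]
  have h4 : polarR z ≤ |r₂| := h2.2.trans (le_abs_self _)
  have h5 : 0 ≤ polarR z := norm_nonneg _
  refine (sq_le_sq₀ (norm_nonneg _) (by positivity)).1 ?_
  rw [norm_sq_eq_spatialPart]
  change z 0 ^ 2 + polarR z ^ 2 ≤ _
  rw [← sq_abs (z 0)]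
  nlinarith [abs_nonneg (z 0), abs_nonneg r₂]

namespace Spacetime

variable {M : Type*} [TopologicalSpace M] [ChartedSpace E4 M] [IsManifold (𝓡 4) ∞ M]
variable {S : Spacetime M}

namespace BondiChart

variable {B : S.BondiChart} {u₀ R C : ℝ}

namespace ScriBounds

variable {γ : ℝ → M} {b : EReal}

/-- The consequences of the flow estimates for an outgoing light ray. -/
theorem outgoing_flow (hB : B.ScriBounds u₀ R C) (h : S.IsNullGeodesicOn γ b)
    {r₀ τ : ℝ} (hr₀ : polarR (B.chart (γ 0)) = r₀) (hR : R ≤ r₀ / 2)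
    (hC : 300 * C ≤ r₀ / 2 / 10000) (hτ : (τ : EReal) ≤ b)
    (hgood : ∀ t ∈ Ico 0 τ, γ t ∈ B.chart.source ∧ OutgoingState B u₀ r₀ (B.chart (γ t),
      derivWithin (fun s => B.chart (γ s)) (parameterInterval b) t)) :
    let z : ℝ → E4 := fun s => B.chart (γ s)
    let v : ℝ → E4 := derivWithin z (parameterInterval b)
    NullFlow (300 * C) τ (fun t => z t 0) (fun t => polarR (z t)) (fun t => v t 0)
        (fun t => polarRho (z t) (v t)) (fun t => polarR (z t) * ‖polarXi (z t) (v t)‖)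
        (fun t => ‖B.angularMomentum (z t) (v t)‖) (fun t => B.radialMomentum (z t) (v t))
        (fun t => B.timeMomentum (z t) (v t)) ∧
      (∀ t ∈ Ico 0 τ, 0 < v t 0) ∧
      (∀ t ∈ Ico 0 τ, (polarR (z t) * B.radialMomentum (z t) (v t)) ^ 2 / 2
        ≤ ‖B.angularMomentum (z t) (v t)‖ ^ 2) ∧
      (∀ t ∈ Ico 0 τ, polarR (z 0) / 2 ≤ polarR (z t)) := by
  intro z v
  refine ⟨hB.nullFlow h hτ fun t ht => ?_, fun t ht => (hgood t ht).2.2.1,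
    fun t ht => (hgood t ht).2.2.2.le, fun t ht => ?_⟩
  · obtain ⟨h1, h2, -⟩ := hgood t ht
    exact ⟨h1, ⟨h2.1, hR.trans_lt h2.2⟩, hC.trans (by
      have := h2.2
      simp only at this
      linarith)⟩
  · change polarR (B.chart (γ 0)) / 2 ≤ _
    rw [hr₀]
    exact (hgood t ht).2.1.2.le

/-- A light ray that starts nearly tangentially or outwards stays near future null infinity. -/
theorem outgoingState_of_initial [T2Space M] (hB : B.ScriBounds u₀ R C)
    (h : S.IsNullGeodesicOn γ b) {r₀ : ℝ} (hr₀ : polarR (B.chart (γ 0)) = r₀) (hR : R ≤ r₀ / 2)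
    (hC : 300 * C ≤ r₀ / 2 / 10000) (hsrc : γ 0 ∈ B.chart.source)
    (hu₀ : u₀ < B.chart (γ 0) 0)
    (hy : 0 < derivWithin (fun s => B.chart (γ s)) (parameterInterval b) 0 0)
    (hj : 99 / 100 * (polarR (B.chart (γ 0)) * B.radialMomentum (B.chart (γ 0))
      (derivWithin (fun s => B.chart (γ s)) (parameterInterval b) 0)) ^ 2
      ≤ ‖B.angularMomentum (B.chart (γ 0))
        (derivWithin (fun s => B.chart (γ s)) (parameterInterval b) 0)‖ ^ 2) :
    ∀ t ∈ parameterInterval b, γ t ∈ B.chart.source ∧ OutgoingState B u₀ r₀ (B.chart (γ t),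
      derivWithin (fun s => B.chart (γ s)) (parameterInterval b) t) := by
  set z : ℝ → E4 := fun s => B.chart (γ s) with hz
  set v : ℝ → E4 := derivWithin z (parameterInterval b) with hv
  have hR1 := hB.one_le
  have hr₀pos : 0 < r₀ := by linarith
  have hrel : ∀ t ∈ parameterInterval b, γ t ∈ B.chart.source → z t ∈ region u₀ (r₀ / 2) →
      NullRelations (300 * C) (polarR (z t)) (v t 0) (polarRho (z t) (v t))
      (polarR (z t) * ‖polarXi (z t) (v t)‖) ‖B.angularMomentum (z t) (v t)‖
      (B.radialMomentum (z t) (v t)) (B.timeMomentum (z t) (v t)) := by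
    intro t ht hs hreg
    refine hB.nullRelations ⟨hreg.1, hR.trans_lt hreg.2⟩ (hC.trans ?_)
      (h.chart_null B.chart_mem ht hs).2.2
    have := hreg.2
    linarith
  -- the strict inequality for the momenta follows from the weak one with a better constant
  have hstrict : ∀ t ∈ parameterInterval b, γ t ∈ B.chart.source → z t ∈ region u₀ (r₀ / 2) →
      0 < v t 0 → 99 / 100 * (polarR (z t) * B.radialMomentum (z t) (v t)) ^ 2
        ≤ ‖B.angularMomentum (z t) (v t)‖ ^ 2 → OutgoingState B u₀ r₀ (z t, v t) := by
    intro t ht hs hreg hy hj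
    have hrel := hrel t ht hs hreg
    have hp : 0 < polarR (z t) * B.radialMomentum (z t) (v t) :=
      mul_pos hrel.pos (by linarith [(hrel.radial_bounds hy).1])
    refine ⟨hreg, hy, ?_⟩
    simp only
    nlinarith [pow_pos hp 2]
  have h0mem : (0 : ℝ) ∈ parameterInterval b := ⟨le_rfl, h.1⟩
  refine parameterInterval_induction ?_ ?_ ?_
  · refine ⟨hsrc, hstrict 0 h0mem hsrc ⟨hu₀, ?_⟩ hy hj⟩
    rw [hz]
    simp only
    rw [hr₀]
    linarith
  · rintro t ht ⟨h1, h2⟩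
    have hγ : ContinuousWithinAt γ (parameterInterval b) t :=
      (h.2.1.1 t ht).continuousWithinAt
    exact (hγ.eventually_mem (B.chart.open_source.mem_nhds h1)).and
      ((h.chart_continuousWithinAt B.chart_mem ht h1).eventually
        (hB.eventually_outgoingState hR h2))
  · intro τ hτ hτ0 hgood
    obtain ⟨hF, hFy, hFK, hFr⟩ := hB.outgoing_flow h hr₀ hR hC hτ.2.le hgood
    have h0τ : (0 : ℝ) ∈ Ico 0 τ := ⟨le_rfl, hτ0⟩
    have hQ0 := (hF.relations 0 h0τ).energy_pos (hFy 0 h0τ)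
    have hp0 := hF.radial_pos hFy 0 h0τ
    set Qm := B.timeMomentum (z 0) (v 0) * Real.exp (72 * (300 * C)) with hQm
    have hQm0 : 0 < Qm := mul_pos hQ0 (Real.exp_pos _)
    -- The estimates on `[0, τ)` confine the ray to a compact box with `r ≥ 3/4 r₀`, strictly inside
    -- the region `r > r₀/2` in which they were derived.
    set K : Set E4 := {z' : E4 | z' 0 ∈ Icc (z 0 0) (z 0 0 + 12 * r₀) ∧
      polarR z' ∈ Icc (3 / 4 * r₀) (r₀ + 5 * Qm * τ)} with hK
    have hKc : IsCompact K := isCompact_bondiBox _ _ _ _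
    have hKreg : K ⊆ region u₀ (r₀ / 2) := fun q hq =>
      ⟨hu₀.trans_le hq.1.1, lt_of_lt_of_le (by linarith) hq.2.1⟩
    have hKt : K ⊆ B.chart.target := fun q hq =>
      hB.mem_target ⟨(hKreg hq).1, hR.trans_lt (hKreg hq).2⟩
    have hzK : ∀ s ∈ Ico 0 τ, z s ∈ K := by
      intro s hs
      have e1 := hF.time_monotoneOn hFy h0τ hs hs.1
      have e2 := hF.time_le hFy hFK s hs
      have e3 := hF.radius_lower hFy hFK hj s hs
      have e4 := hF.radius_le hFy hFK hFr s hs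
      have e5 : 5 * Qm * s ≤ 5 * Qm * τ := mul_le_mul_of_nonneg_left hs.2.le (by positivity)
      simp only at e1 e2 e3 e4
      change _ ≤ polarR (z 0) + 5 * Qm * s at e4
      rw [show polarR (z 0) = r₀ from hr₀] at e2 e3 e4
      exact ⟨⟨e1, e2⟩, e3, e4.trans (by linarith)⟩
    have hsub : Ico 0 τ ⊆ parameterInterval b := fun s hs =>
      ⟨hs.1, (EReal.coe_lt_coe_iff.2 hs.2).trans hτ.2⟩
    have : NeBot (𝓝[Ico 0 τ] τ) := right_nhdsWithin_Ico_neBot hτ0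
    have hγ : Tendsto γ (𝓝[Ico 0 τ] τ) (𝓝 (γ τ)) :=
      ((h.2.1.1 τ hτ).continuousWithinAt).mono hsub
    -- The manifold is Hausdorff, so the compact image of the box is closed and contains the limit
    -- point; the curve has not left the chart at `τ`.
    have hmem : γ τ ∈ B.chart.symm '' K := by
      refine (hKc.image_of_continuousOn (B.chart.continuousOn_symm.mono hKt)).isClosed.mem_of_tendsto
        hγ ?_
      filter_upwards [self_mem_nhdsWithin] with s hs
      exact ⟨z s, hzK s hs, B.chart.left_inv (hgood s hs).1⟩
    obtain ⟨q, hqK, hq⟩ := hmem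
    have hsτ : γ τ ∈ B.chart.source := by rw [← hq]; exact B.chart.map_target (hKt hqK)
    have hzτ : z τ = q := by
      rw [hz]; simp only; rw [← hq, B.chart.right_inv (hKt hqK)]
    have hregτ : z τ ∈ region u₀ (r₀ / 2) := by rw [hzτ]; exact hKreg hqK
    have hregτ' : z τ ∈ region u₀ R := ⟨hregτ.1, hR.trans_lt hregτ.2⟩
    have hlim : Tendsto (fun s => (z s, v s)) (𝓝[Ico 0 τ] τ) (𝓝 (z τ, v τ)) :=
      (h.chart_continuousWithinAt B.chart_mem hτ hsτ).mono hsub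
    have lp := (hB.continuousAt_radialMomentum (q := (z τ, v τ)) hregτ').tendsto.comp hlim
    have lj := ((hB.continuousAt_angularMomentum (q := (z τ, v τ)) hregτ').tendsto.comp hlim).pow 2
    have lr := (continuousAt_polarR (z τ, v τ)).tendsto.comp hlim
    have hrelτ := hrel τ hτ hsτ hregτ
    -- The uniform positive lower bound for `p` passes to the limit, and `p ≈ y` turns it into `y >
    -- 0` at `τ`.
    have hpτ : 0 < B.radialMomentum (z τ) (v τ) := by
      set c := B.radialMomentum (z 0) (v 0) * Real.exp (-(3 * Qm * τ)) with hc
      have hc0 : 0 < c := mul_pos hp0 (Real.exp_pos _)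
      refine hc0.trans_le (ge_of_tendsto lp ?_)
      filter_upwards [self_mem_nhdsWithin] with s hs
      refine le_trans ?_ (hF.radial_lower hFy hFK hFr s hs)
      refine mul_le_mul_of_nonneg_left (Real.exp_le_exp.2 (neg_le_neg ?_)) hp0.le
      exact mul_le_mul_of_nonneg_left hs.2.le (by positivity)
    have hyτ : 0 < v τ 0 := by
      have h1 := abs_le.1 (hrelτ.radial.trans (hrelτ.rate_mul_le (abs_nonneg _)))
      rcases abs_cases (v τ 0) with ⟨hc, -⟩ | ⟨hc, -⟩ <;> rw [hc] at h1 <;> linarith [h1.1, h1.2]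
    refine ⟨hsτ, hstrict τ hτ hsτ hregτ hyτ ?_⟩
    refine le_of_tendsto_of_tendsto (((lr.mul lp).pow 2).const_mul (99 / 100)) lj ?_
    filter_upwards [self_mem_nhdsWithin] with s hs
    exact hF.ratio_lower hFy hFK hj s hs

end ScriBounds

end BondiChart

end Spacetime

/-! ### Completeness of outgoing light rays and arrival at infinity. -/

namespace Spacetime

variable {M : Type*} [TopologicalSpace M] [ChartedSpace E4 M] [IsManifold (𝓡 4) ∞ M]
variable {S : Spacetime M}

namespace BondiChart

variable {B : S.BondiChart} {u₀ R C : ℝ}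

namespace ScriBounds

variable {γ : ℝ → M} {b : EReal}

/-- A light ray that stays near future null infinity cannot end at a finite parameter. -/
theorem not_isMaximal_of_outgoing (hB : B.ScriBounds u₀ R C) {b : ℝ}
    (h : S.IsNullGeodesicOn γ b) {r₀ : ℝ} (hr₀ : polarR (B.chart (γ 0)) = r₀) (hR : R ≤ r₀ / 2)
    (hC : 300 * C ≤ r₀ / 2 / 10000)
    (hj : 99 / 100 * (polarR (B.chart (γ 0)) * B.radialMomentum (B.chart (γ 0))
      (derivWithin (fun s => B.chart (γ s)) (parameterInterval b) 0)) ^ 2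
      ≤ ‖B.angularMomentum (B.chart (γ 0))
        (derivWithin (fun s => B.chart (γ s)) (parameterInterval b) 0)‖ ^ 2)
    (hgood : ∀ t ∈ parameterInterval (b : EReal), γ t ∈ B.chart.source ∧
      OutgoingState B u₀ r₀ (B.chart (γ t),
        derivWithin (fun s => B.chart (γ s)) (parameterInterval b) t)) :
    ¬ S.IsMaximalNullGeodesicOn γ b := by
  have hb0 : 0 < b := EReal.coe_pos.1 h.1
  have hPI := parameterInterval_coe b
  obtain ⟨hF, hFy, hFK, hFr⟩ := hB.outgoing_flow h hr₀ hR hC le_rfl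
    (fun t ht => hgood t (hPI ▸ ht))
  set z : ℝ → E4 := fun s => B.chart (γ s) with hz
  set v : ℝ → E4 := derivWithin z (parameterInterval b) with hv
  have hR1 := hB.one_le
  have hr₀pos : 0 < r₀ := by linarith
  have h0 : (0 : ℝ) ∈ Ico 0 b := ⟨le_rfl, hb0⟩
  have hu₀ : u₀ < z 0 0 := (hgood 0 (hPI ▸ h0)).2.1.1
  have hQ0 := (hF.relations 0 h0).energy_pos (hFy 0 h0)
  have hp0 := hF.radial_pos hFy 0 h0
  set Qm := B.timeMomentum (z 0) (v 0) * Real.exp (72 * (300 * C)) with hQm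
  have hQm0 : 0 < Qm := mul_pos hQ0 (Real.exp_pos _)
  set c := B.radialMomentum (z 0) (v 0) * Real.exp (-(3 * Qm * b)) with hc
  have hc0 : 0 < c := mul_pos hp0 (Real.exp_pos _)
  set K : Set E4 := {z' : E4 | z' 0 ∈ Icc (z 0 0) (z 0 0 + 12 * r₀) ∧
    polarR z' ∈ Icc (3 / 4 * r₀) (r₀ + 5 * Qm * b)} with hK
  have hKreg : K ⊆ region u₀ (r₀ / 2) := fun q hq =>
    ⟨hu₀.trans_le hq.1.1, lt_of_lt_of_le (by linarith) hq.2.1⟩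
  have hKt : K ⊆ B.chart.target := fun q hq =>
    hB.mem_target ⟨(hKreg hq).1, hR.trans_lt (hKreg hq).2⟩
  have hzK : ∀ s ∈ Ico 0 b, z s ∈ K := by
    intro s hs
    have e1 := hF.time_monotoneOn hFy h0 hs hs.1
    have e2 := hF.time_le hFy hFK s hs
    have e3 := hF.radius_lower hFy hFK hj s hs
    have e4 := hF.radius_le hFy hFK hFr s hs
    have e5 : 5 * Qm * s ≤ 5 * Qm * b := mul_le_mul_of_nonneg_left hs.2.le (by positivity)
    simp only at e1 e2 e3 e4
    change _ ≤ polarR (z 0) + 5 * Qm * s at e4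
    rw [show polarR (z 0) = r₀ from hr₀] at e2 e3 e4
    exact ⟨⟨e1, e2⟩, e3, e4.trans (by linarith)⟩
  -- Velocities stay in a compact set that excludes zero: `y ≥ c/2` by the lower bound on `p`, and
  -- the norm is at most `√(3² + 5² + 3²) Qm ≤ 11 Qm`.
  set N : Set E4 := {w : E4 | c / 2 ≤ w 0} ∩ Metric.closedBall 0 (11 * Qm) with hN
  have hNc : IsCompact N :=
    (isCompact_closedBall _ _).inter_left
      (isClosed_le continuous_const (EuclideanSpace.proj (0 : Fin 4) : E4 →L[ℝ] ℝ).continuous)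
  refine h.not_isMaximal_of_isCompact B.chart_mem ((isCompact_bondiBox _ _ _ _).prod hNc)
    (K := K ×ˢ N) ?_ le_rfl hb0 ?_
  · rintro q ⟨h1, h2⟩
    refine ⟨hKt h1, fun h3 => ?_⟩
    have h4 : c / 2 ≤ q.2 0 := h2.1
    rw [h3] at h4
    simp only [PiLp.zero_apply] at h4
    linarith
  · intro t ht
    have ht' := Ioo_subset_Ico_self ht
    refine ⟨(hgood t (hPI ▸ ht')).1, hzK t ht', ?_, ?_⟩
    · change c / 2 ≤ v t 0
      have h1 := hF.radial_lower hFy hFK hFr t ht'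
      have h2 : c ≤ B.radialMomentum (z t) (v t) := by
        refine le_trans ?_ h1
        refine mul_le_mul_of_nonneg_left (Real.exp_le_exp.2 (neg_le_neg ?_)) hp0.le
        exact mul_le_mul_of_nonneg_left ht.2.le (by positivity)
      have h3 := ((hF.relations t ht').radial_bounds (hFy t ht')).2
      have h4 := hFy t ht'
      linarith
    · obtain ⟨h1, h2, h3, -⟩ := hF.velocity_le hFy hFK hFr t ht'
      change v t 0 ≤ 3 * Qm at h1
      change polarR (z t) * ‖polarXi (z t) (v t)‖ ≤ 3 * Qm at h2
      change |polarRho (z t) (v t)| ≤ 5 * Qm at h3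
      have h4 := hFy t ht'
      rw [mem_closedBall_zero_iff]
      refine (sq_le_sq₀ (norm_nonneg _) (by positivity)).1 ?_
      change ‖v t‖ ^ 2 ≤ _
      rw [norm_sq_eq_spatialPart, norm_spatialPart_sq_polar (hF.relations t ht').pos,
        ← sq_abs (polarRho _ _)]
      have k1 := pow_le_pow_left₀ h4.le h1 2
      have k2 := pow_le_pow_left₀ (hF.relations t ht').angular_nonneg h2 2
      have k3 := pow_le_pow_left₀ (abs_nonneg _) h3 2
      nlinarith [sq_nonneg Qm]

/-- A light ray that stays near future null infinity for all parameters reaches it. -/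
theorem reaches_of_outgoing (hB : B.ScriBounds u₀ R C)
    (h : S.IsNullGeodesicOn γ ⊤) {r₀ : ℝ} (hr₀ : polarR (B.chart (γ 0)) = r₀) (hR : R ≤ r₀ / 2)
    (hC : 300 * C ≤ r₀ / 2 / 10000)
    (hgood : ∀ t ∈ parameterInterval ⊤, γ t ∈ B.chart.source ∧
      OutgoingState B u₀ r₀ (B.chart (γ t),
        derivWithin (fun s => B.chart (γ s)) (parameterInterval ⊤) t)) :
    B.Reaches γ ⊤ := by
  have hPI : ∀ τ : ℝ, Ico 0 τ ⊆ parameterInterval ⊤ := fun τ t ht => ⟨ht.1, EReal.coe_lt_top t⟩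
  have hflow := fun τ : ℝ => hB.outgoing_flow h hr₀ hR hC (τ := τ) le_top
    (fun t ht => hgood t (hPI τ ht))
  set z : ℝ → E4 := fun s => B.chart (γ s) with hz
  set v : ℝ → E4 := derivWithin z (parameterInterval ⊤) with hv
  have hmono : Monotone fun t : parameterInterval ⊤ => z t 0 := by
    intro s t hst
    -- The estimates hold on half-open intervals, so the endpoint `t + 1` makes `t` an admissible
    -- parameter.
    obtain ⟨hF, hFy, -, -⟩ := hflow (t + 1)
    exact hF.time_monotoneOn hFy ⟨s.2.1, (Subtype.coe_le_coe.2 hst).trans_lt (lt_add_one _)⟩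
      ⟨t.2.1, lt_add_one _⟩ hst
  have hle : ∀ t : parameterInterval ⊤, z t 0 ≤ z 0 0 + 12 * r₀ := by
    intro t
    obtain ⟨hF, hFy, hFK, -⟩ := hflow (t + 1)
    have := hF.time_le hFy hFK t ⟨t.2.1, lt_add_one _⟩
    simp only at this
    rwa [show polarR (z 0) = r₀ from hr₀] at this
  set q := B.timeMomentum (z 0) (v 0) * Real.exp (-(72 * (300 * C))) / 2 with hq
  have hq0 : 0 < q := by
    obtain ⟨hF, hFy, -, -⟩ := hflow 1
    have h0 : (0 : ℝ) ∈ Ico (0 : ℝ) 1 := ⟨le_rfl, one_pos⟩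
    have := (hF.relations 0 h0).energy_pos (hFy 0 h0)
    exact half_pos (mul_pos this (Real.exp_pos _))
  -- Subtract the bound `u ≤ u(0) + 12 r₀` from the linear lower bound for `u + r`.
  have hadv : ∀ t : parameterInterval ⊤, q * t - 12 * r₀ ≤ polarR (z t) := by
    intro t
    obtain ⟨hF, hFy, hFK, hFr⟩ := hflow (t + 1)
    have := hF.advanced_time_lower hFy hFK hFr t ⟨t.2.1, lt_add_one _⟩
    simp only at this
    change z 0 0 + polarR (z 0) + q * t ≤ _ at this
    have h3 : 0 ≤ polarR (z 0) := norm_nonneg _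
    linarith [hle t]
  refine ⟨Eventually.of_forall fun t => (hgood t t.2).1, ?_, ?_⟩
  · refine tendsto_atTop_mono hadv ?_
    refine tendsto_atTop_add_const_right _ _ (Tendsto.const_mul_atTop hq0 ?_)
    refine tendsto_atTop.2 fun a => ?_
    filter_upwards [eventually_ge_atTop (⟨max a 0, le_max_right _ _, EReal.coe_lt_top _⟩ :
      parameterInterval ⊤)] with t ht
    exact (le_max_left a 0).trans ht
  · exact ⟨_, tendsto_atTop_ciSup hmono ⟨z 0 0 + 12 * r₀, by
      rintro _ ⟨t, rfl⟩
      exact hle t⟩⟩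

/-- A maximal light ray near future null infinity that starts nearly tangentially or outwards
reaches future null infinity. -/
theorem reaches_of_initial [T2Space M] (hB : B.ScriBounds u₀ R C)
    (h : S.IsMaximalNullGeodesicOn γ b) (hR : R ≤ polarR (B.chart (γ 0)) / 2)
    (hC : 300 * C ≤ polarR (B.chart (γ 0)) / 2 / 10000) (hsrc : γ 0 ∈ B.chart.source)
    (hu₀ : u₀ < B.chart (γ 0) 0)
    (hy : 0 < derivWithin (fun s => B.chart (γ s)) (parameterInterval b) 0 0)
    (hj : 99 / 100 * (polarR (B.chart (γ 0)) * B.radialMomentum (B.chart (γ 0))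
      (derivWithin (fun s => B.chart (γ s)) (parameterInterval b) 0)) ^ 2
      ≤ ‖B.angularMomentum (B.chart (γ 0))
        (derivWithin (fun s => B.chart (γ s)) (parameterInterval b) 0)‖ ^ 2) :
    B.Reaches γ b := by
  have hgood := hB.outgoingState_of_initial h.1 rfl hR hC hsrc hu₀ hy hj
  induction b with
  | bot => exact absurd h.1.1 (by simp)
  | coe b => exact absurd h (hB.not_isMaximal_of_outgoing h.1 rfl hR hC hj hgood)
  | top => exact hB.reaches_of_outgoing h.1 rfl hR hC hgood

end ScriBounds

end BondiChart

end Spacetime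

/-! ### The test direction `∂_u - ∂_r` and the conclusion. -/

namespace Spacetime

variable {M : Type*} [TopologicalSpace M] [ChartedSpace E4 M] [IsManifold (𝓡 4) ∞ M]
variable {S : Spacetime M}

namespace BondiChart

variable {B : S.BondiChart} {u₀ R C : ℝ}

/-- The vector `∂_u - ∂_r` annihilates `u + r`. -/
theorem mfderiv_u_add_r (B : S.BondiChart) {z : E4} (hz : z ∈ B.chart.target) (h0 : 0 < polarR z) :
    mfderiv (𝓡 4) 𝓘(ℝ, ℝ) (fun q => B.u q + B.r q) (B.chart.symm z)
      (mfderiv (𝓡 4) (𝓡 4) B.chart.symm z (bondiPoint 1 (-polarX z))) = (0 : ℝ) := by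
  set N := bondiPoint 1 (-polarX z) with hN
  set F : E4 → ℝ := fun z => z 0 + polarR z with hF
  have hmd := mdifferentiable_of_mem_maximalAtlas B.chart_mem
  have hFd : DifferentiableAt ℝ F z := by
    have h1 : DifferentiableAt ℝ (fun z : E4 => spatialPart z) z := spatialCLM.differentiableAt
    have h2 : DifferentiableAt ℝ (fun z : E4 => z 0) z :=
      (EuclideanSpace.proj (0 : Fin 4) : E4 →L[ℝ] ℝ).differentiableAt
    exact h2.add (h1.norm ℝ (norm_pos_iff.1 h0))
  have hsymm : MDifferentiableAt (𝓡 4) (𝓡 4) B.chart.symm z := hmd.mdifferentiableAt_symm hz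
  have hFe : MDifferentiableAt (𝓡 4) 𝓘(ℝ, ℝ) (fun q => B.u q + B.r q) (B.chart.symm z) := by
    have h1 : MDifferentiableAt (𝓡 4) 𝓘(ℝ, ℝ) F (B.chart (B.chart.symm z)) := by
      rw [B.chart.right_inv hz]; exact hFd.mdifferentiableAt
    exact h1.comp (B.chart.symm z) (hmd.mdifferentiableAt (B.chart.map_target hz))
  have hcomp := mfderiv_comp z hFe hsymm
  have heq : (fun q => B.u q + B.r q) ∘ B.chart.symm =ᶠ[𝓝 z] F := by
    filter_upwards [B.chart.open_target.mem_nhds hz] with w hw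
    simp only [Function.comp_apply, hF, BondiChart.u, BondiChart.r, polarR]
    rw [B.chart.right_inv hw]
  have h1 : mfderiv (𝓡 4) 𝓘(ℝ, ℝ) ((fun q => B.u q + B.r q) ∘ B.chart.symm) z = fderiv ℝ F z := by
    rw [heq.mfderiv_eq, mfderiv_eq_fderiv]
  have h2 : fderiv ℝ F z N = 0 := by
    set Z : ℝ → E4 := fun s => z + s • N with hZdef
    have hZ0 : Z 0 = z := by simp [hZdef]
    have hZ : HasDerivAt Z N 0 :=
      (((hasDerivAt_id' (0 : ℝ)).smul_const N).const_add z).congr_deriv (one_smul _ _)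
    have h3 := hZ.timePart.add (hasDerivAt_polarR (by rw [hZ0]; exact h0) hZ)
    have h4 : HasFDerivAt F (fderiv ℝ F z) (Z 0) := by rw [hZ0]; exact hFd.hasFDerivAt
    rw [(h4.comp_hasDerivAt 0 hZ).unique h3, hZ0, hN, polarRho, spatialPart_bondiPoint,
      inner_neg_right, inner_polarX_self h0, bondiPoint_zero_apply, add_neg_cancel]
  rw [← h2, ← h1]
  exact (DFunLike.congr_fun hcomp N).symm

namespace ScriBounds

theorem bondiPoint_one_neg_polarX (z : E4) :
    bondiPoint 1 (-polarX z) = bondiPoint 1 0 - bondiPoint 0 (polarX z) := by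
  rw [bondiPoint_eq 1 (-polarX z), sub_eq_add_neg, one_smul]
  exact congrArg _ (map_neg spaceCLM _)

theorem chartMetric_time_time (hB : B.ScriBounds u₀ R C) {z : E4} (hz : z ∈ region u₀ R)
    (hC : 300 * C ≤ polarR z / 10000) :
    S.chartMetric B.chart z (bondiPoint 1 0) (bondiPoint 1 0) < 0 := by
  have h0 := hB.polarR_pos hz
  have h := hB.abs_chartMetric_time hz (bondiPoint 1 0)
  have hin : inner ℝ (polarX z) (0 : E3) = 0 := inner_zero_right _
  rw [polarRho_tangent h0 hin, polarXi_tangent h0 hin] at h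
  simp only [bondiPoint_zero_apply, smul_zero, norm_zero, abs_zero, mul_zero, add_zero,
    abs_one, mul_one] at h
  have h1 : C / polarR z ≤ 1 / 2 := by
    rw [div_le_iff₀ h0]; linarith
  linarith [(abs_le.1 h).2]

/-- Since `g_rr = 0`, the norm is `g_uu - 2 g_ur`, which is close to `-1 + 2 = 1`. -/
theorem chartMetric_inward_pos (hB : B.ScriBounds u₀ R C) {z : E4} (hz : z ∈ region u₀ R)
    (hC : 300 * C ≤ polarR z / 10000) :
    0 < S.chartMetric B.chart z (bondiPoint 1 (-polarX z)) (bondiPoint 1 (-polarX z)) := by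
  have h0 := hB.polarR_pos hz
  have hr1 : 1 ≤ polarR z := hB.one_le.trans hz.2.le
  have hC0 := hB.nonneg
  set N := bondiPoint 1 (-polarX z) with hN
  have hρ : polarRho z N = -1 := by
    rw [hN, polarRho, spatialPart_bondiPoint, inner_neg_right, inner_polarX_self h0]
  have hξ : polarXi z N = 0 := by
    rw [polarXi, hρ, hN, spatialPart_bondiPoint, neg_one_smul, sub_neg_eq_add, neg_add_cancel,
      smul_zero]
  have h1 := hB.abs_chartMetric_time hz N
  have h2 := hB.abs_chartMetric_radial hz N
  have hN0 : N 0 = 1 := rfl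
  rw [hρ, hξ, hN0, norm_zero, mul_zero, mul_zero, add_zero, abs_neg, abs_one, mul_one,
    mul_one] at h1
  rw [hN0, abs_one, mul_one] at h2
  have e1 : C / polarR z ≤ 1 / 10 := by
    rw [div_le_iff₀ h0]; linarith
  have e2 : C / polarR z ^ 2 ≤ C / polarR z := by
    refine div_le_div_of_nonneg_left hC0 h0 ?_
    nlinarith
  have e3 : S.chartMetric B.chart z N N = S.chartMetric B.chart z N (bondiPoint 1 0)
      - S.chartMetric B.chart z N (bondiPoint 0 (polarX z)) := by
    rw [← map_sub, ← bondiPoint_one_neg_polarX]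
  rw [e3]
  linarith [(abs_le.1 h1).1, (abs_le.1 h2).2]

/-- A maximal light ray near future null infinity that starts orthogonally to `∂_u - ∂_r` reaches
future null infinity. -/
theorem reaches_of_orthogonal [T2Space M] (hB : B.ScriBounds u₀ R C) {γ : ℝ → M} {b : EReal}
    (h : S.IsMaximalNullGeodesicOn γ b) (hsrc : γ 0 ∈ B.chart.source)
    (hz : B.chart (γ 0) ∈ region u₀ (2 * R + 6000000 * C))
    (horth : S.g (γ 0) (velocity γ b 0)
      (mfderiv (𝓡 4) (𝓡 4) B.chart.symm (B.chart (γ 0))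
        (bondiPoint 1 (-polarX (B.chart (γ 0)))) : E4) = 0) : B.Reaches γ b := by
  have h0mem : (0 : ℝ) ∈ parameterInterval b := ⟨le_rfl, h.1.1⟩
  have hC0 := hB.nonneg
  have hR1 := hB.one_le
  obtain ⟨hvel, hfut, hnull⟩ := h.1.chart_null B.chart_mem h0mem hsrc
  set z := B.chart (γ 0) with hzdef
  set v := derivWithin (fun s => B.chart (γ s)) (parameterInterval b) 0 with hvdef
  have hzr := hz.2
  have hz' : z ∈ region u₀ R := ⟨hz.1, by linarith⟩
  have h0 := hB.polarR_pos hz'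
  -- The radius `2R + 6000000 C` is chosen for this: `300 · 2 · 10000 = 6000000`, and half the
  -- radius still exceeds `R`.
  have hC : 300 * C ≤ polarR z / 2 / 10000 := by linarith
  have hC' : 300 * C ≤ polarR z / 10000 := by linarith
  have horth' : S.chartMetric B.chart z v (bondiPoint 1 (-polarX z)) = 0 :=
    (S.g_congr (B.chart.left_inv hsrc) hvel.symm rfl).trans horth
  have hrel := hB.nullRelations hz' hC' hnull
  have hQ : 0 < B.timeMomentum z v := by
    have := (hB.future_mem hz').neg_of_timelike (hB.chartMetric_time_time hz' hC') hfut
    have h1 : S.chartMetric B.chart z (bondiPoint 1 0) v < 0 := this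
    rw [S.chartMetric_symm] at h1
    exact neg_pos.2 h1
  -- Orthogonality to `∂_u - ∂_r` says `Q = p`. As `Q ≈ y + ρ` and `p ≈ y`, the radial velocity `ρ`
  -- is then nearly zero.
  have hpQ : B.timeMomentum z v = B.radialMomentum z v := by
    rw [bondiPoint_one_neg_polarX, map_sub, sub_eq_zero] at horth'
    rw [timeMomentum, radialMomentum, horth']
  -- If `y = 0`, then `p = 0`, hence `Q = 0`, against `Q > 0`.
  have hy : 0 < v 0 := by
    refine hrel.pos_of_energy_pos (fun hy => ?_) hQ
    have := hrel.radial
    rw [hy, abs_zero, mul_zero, sub_zero] at this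
    rw [hpQ, abs_nonpos_iff.1 this] at hQ
    exact lt_irrefl _ hQ
  have hρ : |polarRho z v| ≤ (v 0 + polarR z * ‖polarXi z v‖) / 1000 := by
    have h1 := hrel.radial.trans (hrel.rate_mul_le (abs_nonneg _))
    have h2 := hrel.time.trans (hrel.rate_mul_le (add_nonneg (add_nonneg (abs_nonneg _)
      (abs_nonneg _)) hrel.angular_nonneg))
    have h3 := hrel.angular_nonneg
    rw [hpQ] at h2
    rw [abs_of_pos hy] at h1 h2
    have h1' := abs_le.1 h1
    have h2' := abs_le.1 h2
    rcases abs_cases (polarRho z v) with ⟨hc, -⟩ | ⟨hc, -⟩ <;> rw [hc] at h2' ⊢ <;>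
      linarith [h1'.1, h1'.2, h2'.1, h2'.2]
  exact hB.reaches_of_initial h (by linarith) hC hsrc hz.1 hy (hrel.ratio_initial hy hρ)

end ScriBounds

/-- Near future null infinity there are no points of the outer dark domain. -/
theorem exists_region_disjoint [T2Space M] (B : S.BondiChart) {T : (p : M) → TangentSpace (𝓡 4) p}
    (hT : B.ProportionalToGradient T) (u₀ : ℝ) : ∃ R, 0 < R ∧ ∀ p ∈ B.chart.source,
      B.chart p ∈ region u₀ R → p ∉ B.outerDarkDomain T := by
  obtain ⟨R, C, hB⟩ := B.exists_scriBounds u₀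
  obtain ⟨R', hR', hgrad⟩ := hT u₀
  have hC0 := hB.nonneg
  have hR1 := hB.one_le
  refine ⟨2 * R + 6000000 * C + R', by linarith, fun p hp hreg hdark => ?_⟩
  set z := B.chart p with hz
  have hzr := hreg.2
  have hz' : z ∈ region u₀ R := ⟨hreg.1, by linarith⟩
  have h0 := hB.polarR_pos hz'
  have hC : 300 * C ≤ polarR z / 10000 := by linarith
  set N := bondiPoint 1 (-polarX z) with hN
  set n : TangentSpace (𝓡 4) p := (mfderiv (𝓡 4) (𝓡 4) B.chart.symm z N : E4) with hn
  have hpz : B.chart.symm z = p := B.chart.left_inv hp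
  have hnn : 0 < S.g p n n :=
    (hB.chartMetric_inward_pos hz' hC).trans_eq (S.g_congr hpz rfl rfl)
  -- The one-form of `T` is a multiple of `d(u + r)`, which annihilates `∂_u - ∂_r`.
  have hnT : S.g p n (T p) = 0 := by
    obtain ⟨c, hc⟩ := hgrad (z 0) (polarR z) hreg.1.le (by linarith) (polarX z) (norm_polarX h0)
    rw [bondiPoint_polar h0, hpz] at hc
    rw [S.symm, hc n]
    have := B.mfderiv_u_add_r (hB.mem_target hz') h0
    rw [hpz] at this
    exact mul_eq_zero_of_right c this
  obtain ⟨k, γ, b, hmax, htb, hk, hnr⟩ := hdark n hnn hnT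
  obtain ⟨h1, h2⟩ := (Bundle.TotalSpace.mk.injEq _ _ _ _).mp htb
  subst h1
  obtain rfl := eq_of_heq h2
  exact hnr (hB.reaches_of_orthogonal hmax hp ⟨hreg.1, by linarith⟩ hk)

end BondiChart

end Spacetime

theorem mainTheorem6 {M : Type*} [TopologicalSpace M] [T2Space M] [ConnectedSpace M]
    [ChartedSpace E4 M] [IsManifold (𝓡 4) ∞ M]
    (S : Spacetime M) (B : S.BondiChart)
    (T : (p : M) → TangentSpace (𝓡 4) p)
    (hT_unit : ∀ p : M, S.g p (T p) (T p) = -1)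
    (hT_grad : B.ProportionalToGradient T)
    (hΩ : 0 < B.OmegaInf)
    (hBH : B.blackHole.Nonempty) :
    (B.outerDarkHorizon T).Nonempty ∧ B.NotConnectedToScri (B.outerDarkHorizon T) := by
  constructor
  -- Connectedness enters here: the dark domain is nonempty by the black hole and proper because
  -- points far out are missing from it.
  · refine nonempty_frontier_iff.2 ⟨hBH.mono (B.blackHole_subset_outerDarkDomain hT_unit), ?_⟩
    intro huniv
    obtain ⟨R, hR, hdisj⟩ := B.exists_region_disjoint hT_grad 0
    obtain ⟨R', hR', hdom⟩ := B.domain 1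
    set x : E3 := EuclideanSpace.single 0 1
    have hx : ‖x‖ = 1 := by simp [x]
    -- An explicit far point; `u = 1` lies strictly above the bound `0` of the region.
    have hmem := hdom 1 (R + R') le_rfl (by linarith) x hx
    refine hdisj _ (B.chart.map_target hmem) ?_ (huniv ▸ mem_univ _)
    rw [B.chart.right_inv hmem]
    refine ⟨by simp, ?_⟩
    rw [polarR, spatialPart_bondiPoint, norm_smul, hx, mul_one, Real.norm_of_nonneg (by linarith)]
    linarith
  · intro u₀
    -- Replacing `u₀` by `u₀ - 1` makes the points with `u ≥ u₀` interior to the open region, so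
    -- they are not even in the closure of the dark domain.
    obtain ⟨R, -, hdisj⟩ := B.exists_region_disjoint hT_grad (u₀ - 1)
    refine ⟨R, fun p hp hu hr hfr => ?_⟩
    have hopen : IsOpen (B.chart.source ∩
        B.chart ⁻¹' Spacetime.BondiChart.region (u₀ - 1) R) :=
      B.chart.isOpen_inter_preimage (Spacetime.BondiChart.isOpen_region _ _)
    have hpmem : p ∈ B.chart.source ∩
        B.chart ⁻¹' Spacetime.BondiChart.region (u₀ - 1) R :=
      ⟨hp, (sub_one_lt u₀).trans_le hu, hr⟩
    obtain ⟨q, hq, hqD⟩ := mem_closure_iff.1 (frontier_subset_closure hfr) _ hopen hpmem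
    exact hdisj q hq.1 hq.2 hqD
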